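/- Let $H_1,H_2\in(0,1)$, $\sigma_1,\sigma_2>0$, $|\rho|\le 1$, $\lambda_0\in\mathbb R$. Let $B_1,B_2$ be independent two-sided standard Brownian motions, $\tilde B_1=B_1$, $\tilde B_2=\rho B_1+\sqrt{1-\rho^2}\,B_2$, and let $(Z_1(t),Z_2(t))_{t\ge 0}$, $Z_j(t)=\int_{\mathbb R} g_j(s;t)\,d\tilde B_j(s)$, be the two-dimensional fractional Brownian motion of one of the following two types, where $f_\pm(s;t,\beta)=(t-s)_\pm^{\beta}-(-s)_\pm^{\beta}$ (with $x_+^{\beta}=x^\beta 1_{x>0}$ and $x_-^\beta=(-x)_+^\beta$): (causal) $g_j=\sigma_j a_j f_+(s;t,H_j-\tfrac12)$ with $a_j\ge0$, $a_j^2=\dfrac{\Gamma(2H_j+1)\sin(\pi H_j)}{\Gamma(H_j+\frac12)^2}$; (well-balanced, $H_1,H_2\neq\frac12$) $g_j=\sigma_j a_j\big(f_+(s;t,H_j-\tfrac12)+f_-(s;t,H_j-\tfrac12)\big)$ with $a_j\ge0$, $a_j^2=\dfrac{2H_j(1-2H_j)\pi}{8\,\Gamma(2-2H_j)\cos(\pi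 H_j)\Gamma(H_j+\frac12)^2\cos^2(\frac{\pi}{2}(H_j+\frac12))}$. Put $b_j(n)=Z_j(n+1)-Z_j(n)$ and let $Y(n)=\cos(\lambda_0n)\,b_1(n)+\sin(\lambda_0n)\,b_2(n)$, $n\in\mathbb N_0$, be the cyclic fractional Gaussian noise. Let $\tilde c_{jk}$ be, in the causal case, $$\tilde c_{jj}=\tfrac1{2\pi}\sigma_j^2\Gamma(H_j+\tfrac12)^2a_j^2,\qquad \tilde c_{jk}=\tfrac1{2\pi}\rho\sigma_j\sigma_k\Gamma(H_j+\tfrac12)\Gamma(H_k+\tfrac12)a_ja_k\,e^{-i\frac\pi2(H_j-H_k)}\ (j\ne k),$$ and in the well-balanced case, with $\kappa_j=\cos(\frac\pi2(H_j+\frac12))\,\Gamma(H_j+\tfrac12)\,a_j$, $$\tilde c_{jj}=\tfrac2\pi\sigma_j^2\kappa_j^2,\qquad \tilde c_{jk}=\tfrac2\pi\rho\,\sigma_j\sigma_k\,\kappa_j\kappa_k\ (j\neq k).$$ Let $$f_{jk}(\lambda)=|1-e^{-i\lambda}|^2\sum_{n\in\mathbb Z}\frac{(\lambda+2\pi n)_+^{1-H_j-H_k}\tilde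 c_{jk}+(\lambda+2\pi n)_-^{1-H_j-H_k}\overline{\tilde c_{jk}}}{(\lambda+2\pi n)^2},$$ $$S^{2\lambda_0}(\lambda)=\tfrac14\big[f_{11}(\lambda-\lambda_0)-f_{22}(\lambda-\lambda_0)-2i\,\mathrm{Re}\,f_{12}(\lambda-\lambda_0)\big].$$ (i) With $d_j=H_j-\frac12$ and $d_{\max}=\max(d_1,d_2)$, $$S^{2\lambda_0}(\lambda)\sim\mathcal K\,|\lambda-\lambda_0|^{-2d_{\max}}\quad(\lambda\to\lambda_0,\ \lambda\ne\lambda_0),\qquad \mathcal K=\begin{cases}\tilde c_{11}/4,&d_1>d_2,\\-\tilde c_{22}/4,&d_2>d_1,\\\frac14[\tilde c_{11}-\tilde c_{22}-2i\,\mathrm{Re}\,\tilde c_{12}],&d_1=d_2.\end{cases}$$ (When $\mathcal K=0$ this means that $S^{2\lambda_0}$ vanishes on a punctured neighbourhood of $\lambda_0$.) (ii) $S^{2\lambda_0}$ is the cyclic spectrum of $Y$ at the cyclic frequency $2\lambda_0$: if $0,2\lambda_0,-2\lambda_0$ are distinct modulo $2\pi$ (that is, $\lambda_0\notin\frac\pi2\mathbb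 Z$), then the autocovariance has an expansion $\mathrm{Cov}(Y(n+h),Y(n))=\sum_{\alpha\in\{0,2\lambda_0,-2\lambda_0\}}R^\alpha(h)e^{i\alpha n}$ for all $h\in\mathbb Z$ and all $n\ge\max(0,-h)$, and for the cyclic autocorrelation functions $R^\alpha$ of this expansion and every $\lambda$ with $\lambda-\lambda_0\notin2\pi\mathbb Z$, $$\frac1{2\pi}\sum_{h=-\infty}^{\infty}R^{2\lambda_0}(h)e^{-i\lambda h}=S^{2\lambda_0}(\lambda),$$ the series converging in the sense of symmetric partial sums. -/

import Mathlib

open MeasureTheory ProbabilityTheory Filter Topology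
open scoped NNReal ENNReal

noncomputable section

namespace CFGN

/-! ### Powers of positive and negative parts -/

/-- `x₊ ^ a`, with the usual convention that it vanishes for `x ≤ 0` (also when `a ≤ 0`). -/
def posPow (a x : ℝ) : ℝ := if 0 < x then x ^ a else 0

/-- `x₋ ^ a`, with the convention that it vanishes for `x ≥ 0`. -/
def negPow (a x : ℝ) : ℝ := posPow a (-x)

/-- `f₊(x; t, β) = (t - x)₊ ^ β - (-x)₊ ^ β`. -/
def kernelPlus (t β x : ℝ) : ℝ := posPow β (t - x) - posPow β (-x)

/-- `f₋(x; t, β) = (t - x)₋ ^ β - (-x)₋ ^ β`. -/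
def kernelMinus (t β x : ℝ) : ℝ := negPow β (t - x) - negPow β (-x)

/-! ### Two-sided Brownian motion and Wiener integrals -/

/-- `B` is a standard Brownian motion on the whole real line: the processes `(B t)_{t ≥ 0}` and
`(B (-t))_{t ≥ 0}` are independent standard Brownian motions. -/
structure IsTwoSidedBM {Ω : Type*} [MeasurableSpace Ω] (B : ℝ → Ω → ℝ) (P : Measure Ω) :
    Prop where
  forward : IsBrownianReal (fun (t : ℝ≥0) (ω : Ω) => B (t : ℝ) ω) P
  backward : IsBrownianReal (fun (t : ℝ≥0) (ω : Ω) => B (-(t : ℝ)) ω) P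
  indep : IndepFun (fun (ω : Ω) (t : ℝ≥0) => B (t : ℝ) ω)
    (fun (ω : Ω) (t : ℝ≥0) => B (-(t : ℝ)) ω) P

/-- Data of a step function `∑ᵢ cᵢ 1_{(aᵢ, bᵢ]}` on the real line. -/
structure StepData where
  n : ℕ
  c : Fin n → ℝ
  a : Fin n → ℝ
  b : Fin n → ℝ
  le : ∀ i, a i ≤ b i

/-- The step function itself. -/
def StepData.toFun (s : StepData) (x : ℝ) : ℝ :=
  ∑ i, s.c i * (Set.Ioc (s.a i) (s.b i)).indicator (fun _ => (1 : ℝ)) x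

/-- The elementary integral `∑ᵢ cᵢ (B(bᵢ) - B(aᵢ))` of a step function. -/
def StepData.integral {Ω : Type*} (s : StepData) (B : ℝ → Ω → ℝ) (ω : Ω) : ℝ :=
  ∑ i, s.c i * (B (s.b i) ω - B (s.a i) ω)

/-- `X = ∫ f(x) dB(x)`: the random variable `X` is (a version of) the Wiener integral of the
deterministic function `f ∈ L²(ℝ)`, that is, the `L²(P)`-limit of the elementary integrals of a
sequence of step functions converging to `f` in `L²(ℝ)`. -/
def IsWienerIntegral {Ω : Type*} [MeasurableSpace Ω] (B : ℝ → Ω → ℝ) (f : ℝ → ℝ) (X : Ω → ℝ)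
    (P : Measure Ω) : Prop :=
  MemLp f 2 volume ∧ MemLp X 2 P ∧ ∃ s : ℕ → StepData,
    Tendsto (fun m => eLpNorm (fun x => (s m).toFun x - f x) 2 volume) atTop (𝓝 0) ∧
    Tendsto (fun m => eLpNorm (fun ω => (s m).integral B ω - X ω) 2 P) atTop (𝓝 0)

/-! ### Two-dimensional fractional Brownian motion -/

/-- The two constructions of two-dimensional fractional Brownian motion. -/
inductive Model where
  | causal : Model
  | wellBalanced : Model

/-- The normalising constant `a_H` (causal case) or `a*_H` (well-balanced case, `H ≠ 1/2`), for
which a coordinate with scale `σ` has variance `σ ^ 2` at time `1`. -/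
def normConst : Model → ℝ → ℝ
  | .causal, H =>
      Real.sqrt (Real.Gamma (2 * H + 1) * Real.sin (H * Real.pi) / Real.Gamma (H + 1 / 2) ^ 2)
  | .wellBalanced, H =>
      Real.sqrt (2 * H * (1 - 2 * H) * Real.pi /
        (8 * Real.Gamma (2 - 2 * H) * Real.cos (H * Real.pi) * Real.Gamma (H + 1 / 2) ^ 2 *
          Real.cos ((H + 1 / 2) * Real.pi / 2) ^ 2))

/-- The kernel of one coordinate: `σ a_H f₊(x; t, H - 1/2)` in the causal case and
`σ a*_H (f₊(x; t, H - 1/2) + f₋(x; t, H - 1/2))` in the well-balanced case. -/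
def fbmKernel (M : Model) (H σ t x : ℝ) : ℝ :=
  match M with
  | .causal => σ * normConst .causal H * kernelPlus t (H - 1 / 2) x
  | .wellBalanced => σ * normConst .wellBalanced H *
      (kernelPlus t (H - 1 / 2) x + kernelMinus t (H - 1 / 2) x)

/-- The correlated drivers `B̃₁ = B₁`, `B̃₂ = ρ B₁ + √(1 - ρ²) B₂`. Coordinates `1, 2` are
indexed by `0, 1 : Fin 2` throughout. -/
def driver {Ω : Type*} (ρ : ℝ) (B : Fin 2 → ℝ → Ω → ℝ) : Fin 2 → ℝ → Ω → ℝ :=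
  ![B 0, fun t ω => ρ * B 0 t ω + Real.sqrt (1 - ρ ^ 2) * B 1 t ω]

/-- `Z` is a two-dimensional (causal or well-balanced) fractional Brownian motion with Hurst
exponents `H`, scales `σ` and correlation `ρ`: there are two independent Brownian motions on the
line such that each `Z j t` is the Wiener integral of the `j`-th kernel against the `j`-th
correlated driver. -/
def IsFBM2 {Ω : Type*} [MeasurableSpace Ω] (M : Model) (H σ : Fin 2 → ℝ) (ρ : ℝ)
    (Z : Fin 2 → ℝ → Ω → ℝ) (P : Measure Ω) : Prop :=
  ∃ B : Fin 2 → ℝ → Ω → ℝ,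
    (∀ j, IsTwoSidedBM (B j) P) ∧
    IndepFun (fun (ω : Ω) (t : ℝ) => B 0 t ω) (fun (ω : Ω) (t : ℝ) => B 1 t ω) P ∧
    ∀ j, ∀ t : ℝ, 0 ≤ t →
      IsWienerIntegral (driver ρ B j) (fbmKernel M (H j) (σ j) t) (Z j t) P

/-- The two-dimensional fractional Gaussian noise `Z(n+1) - Z(n)`. -/
def fgn {Ω : Type*} (Z : Fin 2 → ℝ → Ω → ℝ) (j : Fin 2) (n : ℕ) (ω : Ω) : ℝ :=
  Z j ((n : ℝ) + 1) ω - Z j (n : ℝ) ω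

/-- The cyclic fractional Gaussian noise
`Y(n) = cos(λ₀ n) b₁(n) + sin(λ₀ n) b₂(n)`, where `(b₁, b₂)` are the increments of `Z`. -/
def cfgn {Ω : Type*} (lam0 : ℝ) (Z : Fin 2 → ℝ → Ω → ℝ) (n : ℕ) (ω : Ω) : ℝ :=
  Real.cos (lam0 * n) * fgn Z 0 n ω + Real.sin (lam0 * n) * fgn Z 1 n ω

/-! ### Cyclic autocorrelation functions and cyclic spectrum -/

/-- The functions `R α`, `α ∈ A`, are the cyclic autocorrelation functions of `Y`: the
autocovariance `γ_Y(n, h) = Cov(Y(n+h), Y(n))` has the convergent expansion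
`∑_{α ∈ A} R α h e^{iαn}`, the frequencies in `A` being distinct modulo `2π`. Here `m = n + h`
runs over `ℕ` and `h = m - n ∈ ℤ`. -/
structure HasCAF {Ω : Type*} [MeasurableSpace Ω] (Y : ℕ → Ω → ℝ) (P : Measure Ω) (A : Set ℝ)
    (R : ℝ → ℤ → ℂ) : Prop where
  distinct : ∀ α ∈ A, ∀ β ∈ A, (∃ k : ℤ, α - β = 2 * Real.pi * k) → α = β
  expansion : ∀ m n : ℕ, HasSum
    (fun α : A => R α ((m : ℤ) - (n : ℤ)) * Complex.exp (Complex.I * ((α : ℝ) : ℂ) * (n : ℂ)))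
    ((cov[Y m, Y n; P] : ℝ) : ℂ)

/-- The cyclic spectrum `(2π)⁻¹ ∑_{h ∈ ℤ} r(h) e^{-iλh}` attached to the cyclic autocorrelation
function `r` converges (in the sense of symmetric partial sums) at `λ = lam` and has the
value `z`. -/
def HasCyclicSpectrum (r : ℤ → ℂ) (lam : ℝ) (z : ℂ) : Prop :=
  HasSum (fun h : ℤ => (2 * (Real.pi : ℂ))⁻¹ * (r h * Complex.exp (-Complex.I * lam * h))) z
    (SummationFilter.symmetricIcc ℤ)

/-! ### Explicit spectral quantities -/

/-- The matrix `C̃` of the causal or of the well-balanced model. -/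
def cTilde (M : Model) (H σ : Fin 2 → ℝ) (ρ : ℝ) (j k : Fin 2) : ℂ :=
  match M with
  | .causal =>
      if j = k then
        ((1 / (2 * Real.pi) * σ j ^ 2 * Real.Gamma (H j + 1 / 2) ^ 2 *
          normConst .causal (H j) ^ 2 : ℝ) : ℂ)
      else
        ((1 / (2 * Real.pi) * ρ * σ j * σ k * Real.Gamma (H j + 1 / 2) *
          Real.Gamma (H k + 1 / 2) * normConst .causal (H j) * normConst .causal (H k) : ℝ) : ℂ) *
        Complex.exp (-Complex.I * (Real.pi / 2) * (H j - H k))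
  | .wellBalanced =>
      if j = k then
        ((2 / Real.pi * σ j ^ 2 * Real.cos ((H j + 1 / 2) * Real.pi / 2) ^ 2 *
          Real.Gamma (H j + 1 / 2) ^ 2 * normConst .wellBalanced (H j) ^ 2 : ℝ) : ℂ)
      else
        ((2 / Real.pi * ρ * σ j * σ k * Real.cos ((H j + 1 / 2) * Real.pi / 2) *
          Real.cos ((H k + 1 / 2) * Real.pi / 2) * Real.Gamma (H j + 1 / 2) *
          Real.Gamma (H k + 1 / 2) * normConst .wellBalanced (H j) *
          normConst .wellBalanced (H k) : ℝ) : ℂ)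

/-- The spectral density
`f_{jk}(λ) = |1 - e^{-iλ}|² ∑_{n ∈ ℤ}
  ((λ + 2πn)₊^{1-Hⱼ-Hₖ} c̃_{jk} + (λ + 2πn)₋^{1-Hⱼ-Hₖ} conj c̃_{jk}) / (λ + 2πn)²`. -/
def specDensity (M : Model) (H σ : Fin 2 → ℝ) (ρ : ℝ) (j k : Fin 2) (lam : ℝ) : ℂ :=
  ((‖1 - Complex.exp (-Complex.I * lam)‖ ^ 2 : ℝ) : ℂ) *
    ∑' n : ℤ, ((posPow (1 - H j - H k) (lam + 2 * Real.pi * n) : ℂ) * cTilde M H σ ρ j k +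
        (negPow (1 - H j - H k) (lam + 2 * Real.pi * n) : ℂ) *
          (starRingEnd ℂ) (cTilde M H σ ρ j k)) /
      ((lam + 2 * Real.pi * n : ℝ) : ℂ) ^ 2

/-- The explicit form of the cyclic spectrum of cyclic fractional Gaussian noise at the cyclic
frequency `2λ₀`:
`(f₁₁(λ - λ₀) - f₂₂(λ - λ₀) - 2i Re f₁₂(λ - λ₀)) / 4`. -/
def cfgnSpectrum (M : Model) (H σ : Fin 2 → ℝ) (ρ lam0 lam : ℝ) : ℂ :=
  1 / 4 * (specDensity M H σ ρ 0 0 (lam - lam0) - specDensity M H σ ρ 1 1 (lam - lam0) -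
    2 * Complex.I * ((specDensity M H σ ρ 0 1 (lam - lam0)).re : ℂ))

/-- The diagonal elements `dⱼ = Hⱼ - 1/2` of the memory matrix. -/
def memD (H : Fin 2 → ℝ) (j : Fin 2) : ℝ := H j - 1 / 2

/-- The coefficient `𝒦`. -/
def coeffK (M : Model) (H σ : Fin 2 → ℝ) (ρ : ℝ) : ℂ :=
  if memD H 1 < memD H 0 then cTilde M H σ ρ 0 0 / 4
  else if memD H 0 < memD H 1 then -(cTilde M H σ ρ 1 1) / 4
  else 1 / 4 * (cTilde M H σ ρ 0 0 - cTilde M H σ ρ 1 1 -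
    2 * Complex.I * ((cTilde M H σ ρ 0 1).re : ℂ))

end CFGN

end

/-! Write `γ_jk(h)` for the cross-covariances of the increments and `h = m - n`. Product-to-sum
formulas split `Cov(Y(m), Y(n))` into terms in `λ₀(m - n)`, which feed frequency `0`, and terms in
`λ₀(m + n) = λ₀(h + 2n)`, which feed `±2λ₀`. This gives `R^{2λ₀}(h) = ¼ e^{iλ₀h} (γ₁₁ - γ₂₂ - i(γ₁₂
+ γ₂₁))(h)` (`IsFBM2.covariance_expansion`). It is the only choice, because `1, zⁿ, z⁻ⁿ` with `z =
e^{2iλ₀}` are linearly independent when `z² ≠ 1` (`HasCAF.eq_of_hasCAF`).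

Cross-covariances enter only through the symmetric sum `γ₁₂ + γ₂₁`. By the Wiener isometry,
stationarity of increments, self-similarity and polarization, this sum is a constant times the
second difference of `|h|^{H₁+H₂}` (`incrInner_add`), so the skew part of the cross-covariance never
has to be computed. On the spectral side the same symmetry shows up as `Re f₁₂`: `c̃` and its
conjugate have the same real part, so `Re f_jk` is `Re c̃_jk` times one universal density
`fgnDensity` with exponent `s = H_j + H_k` (`re_specDensity`).

Two computations remain. First, the Fourier series of the second difference of `|h|^s` must be
summed to `Γ(s+1) sin(πs/2)` times that density (`hasSum_fgnCov`). The second difference is a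
Fourier integral of `(1 - cos x)|x|^{-1-s}`; folding the line onto a circle turns it into a Fourier
coefficient of a periodic function that is locally Lipschitz off `2πℤ`, where its Fourier series
converges pointwise. The convergence need not be absolute, hence symmetric partial sums. Second, the
inner products of the kernels at time `1` must match `2π Re c̃_jk` (`re_cTilde`). They come from
integrating the holomorphic function `((z+1)^a - z^a)((z+1)^b - z^b)` along horizontal lines in the
upper half-plane: the integral is zero, and the limit on the real axis is a linear relation between
the products of `f₊` and `f₋`, the mixed ones being Beta integrals.

For the asymptotics, the `n = 0` term of the periodized power dominates at the origin, so the
density behaves like `|μ|^{1-s}` (`tendsto_fgnDensity`). The largest exponent wins if `H₁ ≠ H₂`. If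
`H₁ = H₂` all three densities coincide and the spectrum is exactly `𝒦` times one density, which also
settles `𝒦 = 0`. -/

noncomputable section

namespace CFGN

/-! ### Increments of complex powers on the upper half-plane -/

/-- The increment `(z + 1) ^ a - z ^ a`. -/
def cpowIncr (a : ℝ) (z : ℂ) : ℂ := (z + 1) ^ (a : ℂ) - z ^ (a : ℂ)

/-- The profile of the bound for `cpowIncr`. -/
def incrBound (a r : ℝ) : ℝ := if r ≤ 3 then r ^ a + 4 else 4 * r ^ (a - 1)

/-- A square-integrable bound for `cpowIncr` on horizontal lines. -/
def lineBound (a x : ℝ) : ℝ := incrBound a |x| + incrBound a |x + 1|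

lemma incrBound_nonneg (a : ℝ) {r : ℝ} (hr : 0 ≤ r) : 0 ≤ incrBound a r := by
  unfold incrBound
  split_ifs <;> positivity

lemma lineBound_nonneg (a x : ℝ) : 0 ≤ lineBound a x :=
  add_nonneg (incrBound_nonneg a (abs_nonneg x)) (incrBound_nonneg a (abs_nonneg _))

lemma integrable_comp_abs {f : ℝ → ℝ} (hf : IntegrableOn f (Set.Ioi 0)) :
    Integrable (fun x => f |x|) := by
  have h1 : IntegrableOn (fun x => f |x|) (Set.Ioi 0) :=
    hf.congr_fun (fun x hx => by simp only [abs_of_pos (Set.mem_Ioi.1 hx)]) measurableSet_Ioi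
  have h2 : IntegrableOn (fun x => f |x|) (Set.Iic 0) := by
    rw [integrableOn_Iic_iff_integrableOn_Iio]
    have := (IntegrableOn.comp_neg_Iio (c := 0) (f := f) (by simpa using hf))
    refine this.congr_fun (fun x hx => ?_) measurableSet_Iio
    simp only [abs_of_neg (Set.mem_Iio.1 hx)]
  rw [← integrableOn_univ, ← Set.Iic_union_Ioi (a := (0 : ℝ))]
  exact h2.union h1

lemma measurable_incrBound (a : ℝ) : Measurable (incrBound a) := by
  unfold incrBound
  exact Measurable.ite measurableSet_Iic (by fun_prop) (by fun_prop)

/-- The square behaves like `r^{2a}` at the origin and `r^{2a-2}` at infinity; the two endpoints of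
`|a| < 1/2` are exactly what makes these integrable. -/
lemma memLp_incrBound_abs {a : ℝ} (ha : -(1 / 2) < a) (ha' : a < 1 / 2) :
    MemLp (fun x : ℝ => incrBound a |x|) 2 volume := by
  have hm : Measurable fun x : ℝ => incrBound a |x| :=
    (measurable_incrBound a).comp measurable_id.abs
  rw [memLp_two_iff_integrable_sq hm.aestronglyMeasurable]
  refine integrable_comp_abs (f := fun r => incrBound a r ^ 2) ?_
  rw [← Set.Ioc_union_Ioi_eq_Ioi (show (0 : ℝ) ≤ 3 by norm_num)]
  refine IntegrableOn.union ?_ ?_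
  · have h : IntegrableOn (fun r : ℝ => r ^ (2 * a) + 8 * r ^ a + 16) (Set.Ioc 0 3) := by
      rw [← intervalIntegrable_iff_integrableOn_Ioc_of_le (by norm_num)]
      exact ((intervalIntegral.intervalIntegrable_rpow' (by linarith)).add
        ((intervalIntegral.intervalIntegrable_rpow' (by linarith)).const_mul 8)).add
        _root_.intervalIntegrable_const
    refine h.congr_fun (fun r hr => ?_) measurableSet_Ioc
    have : r ^ (2 * a) = r ^ a * r ^ a := by rw [← Real.rpow_add hr.1]; ring_nf
    simp only [incrBound, if_pos hr.2, this]
    ring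
  · have h : IntegrableOn (fun r : ℝ => 16 * r ^ (2 * a - 2)) (Set.Ioi 3) :=
      (integrableOn_Ioi_rpow_of_lt (by linarith) (by norm_num)).const_mul _
    refine h.congr_fun (fun r hr => ?_) measurableSet_Ioi
    have hr : 3 < r := hr
    have : r ^ (2 * a - 2) = r ^ (a - 1) * r ^ (a - 1) := by
      rw [← Real.rpow_add (by linarith)]; ring_nf
    simp only [incrBound, if_neg (not_le.2 hr), this]
    ring

lemma memLp_lineBound {a : ℝ} (ha : -(1 / 2) < a) (ha' : a < 1 / 2) :
    MemLp (lineBound a) 2 volume := by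
  refine (memLp_incrBound_abs ha ha').add ?_
  exact (memLp_incrBound_abs ha ha').comp_measurePreserving
    (measurePreserving_add_right volume (1 : ℝ))

lemma integrable_lineBound_mul {a b : ℝ} (ha : -(1 / 2) < a) (ha' : a < 1 / 2)
    (hb : -(1 / 2) < b) (hb' : b < 1 / 2) :
    Integrable (fun x => lineBound a x * lineBound b x) :=
  (memLp_lineBound ha ha').integrable_mul (memLp_lineBound hb hb')

/-- Mean value inequality on the segment from `z` to `z + 1`. It stays in the upper half-plane, away
from the branch cut, and has norm at least `‖z‖ - 1 ≥ ‖z‖ / 2`. The factor `4` absorbs `|a| ≤ 1` and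
`2^{1-a} ≤ 4`. -/
lemma norm_cpowIncr_le_of_two_le {a : ℝ} (ha : -(1 / 2) < a) (ha' : a < 1 / 2) {z : ℂ}
    (hz : 0 < z.im) (hz2 : 2 ≤ ‖z‖) : ‖cpowIncr a z‖ ≤ 4 * ‖z‖ ^ (a - 1) := by
  have hseg : ∀ w ∈ segment ℝ z (z + 1), 0 < w.im ∧ ‖z‖ / 2 ≤ ‖w‖ := by
    intro w hw
    obtain ⟨t, ⟨ht0, ht1⟩, rfl⟩ := (segment_eq_image' ℝ z (z + 1)) ▸ hw
    refine ⟨by simpa using hz, ?_⟩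
    have h1 : ‖t • (z + 1 - z)‖ ≤ 1 := by
      simp only [add_sub_cancel_left, Complex.real_smul, mul_one, Complex.norm_real,
        Real.norm_eq_abs, abs_of_nonneg ht0, ht1]
    have h2 := norm_sub_le (z + t • (z + 1 - z)) (t • (z + 1 - z))
    rw [add_sub_cancel_right] at h2
    linarith
  have hderiv : ∀ w ∈ segment ℝ z (z + 1), HasDerivWithinAt (fun w : ℂ => w ^ (a : ℂ))
      ((a : ℂ) * w ^ ((a : ℂ) - 1)) (segment ℝ z (z + 1)) w := by
    intro w hw
    have hs : w ∈ Complex.slitPlane := Or.inr (hseg w hw).1.ne'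
    simpa using ((hasDerivAt_id w).cpow_const (c := (a : ℂ)) hs).hasDerivWithinAt
  have hbound : ∀ w ∈ segment ℝ z (z + 1),
      ‖(a : ℂ) * w ^ ((a : ℂ) - 1)‖ ≤ 4 * ‖z‖ ^ (a - 1) := by
    intro w hw
    have hw2 := (hseg w hw).2
    have e : ((a : ℂ) - 1) = ((a - 1 : ℝ) : ℂ) := by push_cast; rfl
    rw [norm_mul, e, Complex.norm_cpow_real, Complex.norm_real, Real.norm_eq_abs]
    have h1 : ‖w‖ ^ (a - 1) ≤ (‖z‖ / 2) ^ (a - 1) :=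
      Real.rpow_le_rpow_of_nonpos (by linarith) hw2 (by linarith)
    have h2 : (‖z‖ / 2) ^ (a - 1) = ‖z‖ ^ (a - 1) * 2 ^ (1 - a) := by
      rw [Real.div_rpow (norm_nonneg _) (by norm_num), div_eq_mul_inv,
        ← Real.rpow_neg (by norm_num)]
      ring_nf
    have h3 : (2 : ℝ) ^ (1 - a) ≤ 2 ^ (2 : ℝ) :=
      Real.rpow_le_rpow_of_exponent_le (by norm_num) (by linarith)
    have h4 : |a| ≤ 1 := abs_le.2 ⟨by linarith, by linarith⟩
    norm_num at h3
    have h5 : 0 ≤ ‖z‖ ^ (a - 1) := by positivity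
    calc |a| * ‖w‖ ^ (a - 1) ≤ 1 * (‖z‖ ^ (a - 1) * 2 ^ (1 - a)) := by
          rw [← h2]; gcongr
      _ ≤ 1 * (‖z‖ ^ (a - 1) * 4) := by gcongr
      _ = _ := by ring
  have := Convex.norm_image_sub_le_of_norm_hasDerivWithin_le hderiv hbound
    (convex_segment z (z + 1)) (left_mem_segment ℝ z (z + 1)) (right_mem_segment ℝ z (z + 1))
  simpa [cpowIncr] using this

/-- The two summands of the profile `r^a + 4` serve the two signs of `a`: for `a ≤ 0` the power is
largest at the smallest radius `r`, for `a ≥ 0` it is at most `4^a ≤ 4`. -/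
lemma norm_cpow_le_incrBound {a : ℝ} (ha' : a < 1 / 2) {z : ℂ} {r : ℝ}
    (hr : 0 < r) (hr3 : r ≤ 3) (hrz : r ≤ ‖z‖) (hz : ‖z‖ ≤ 4) :
    ‖z ^ (a : ℂ)‖ ≤ incrBound a r := by
  rw [Complex.norm_cpow_real, incrBound, if_pos hr3]
  rcases le_total 0 a with h | h
  · have h1 : ‖z‖ ^ a ≤ 4 ^ a := Real.rpow_le_rpow (norm_nonneg _) hz h
    have h2 : (4 : ℝ) ^ a ≤ 4 ^ (1 : ℝ) :=
      Real.rpow_le_rpow_of_exponent_le (by norm_num) (by linarith)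
    rw [Real.rpow_one] at h2
    have : 0 ≤ r ^ a := by positivity
    linarith
  · have := Real.rpow_le_rpow_of_nonpos hr hrz h
    linarith

/-- The point is uniformity in the height `y`: the same majorant serves dominated convergence both
as `y → 0` and as `y → ∞`. Near the singularities `0, -1` the two powers are bounded separately;
elsewhere the mean value bound applies. -/
lemma norm_cpowIncr_le_lineBound {a : ℝ} (ha : -(1 / 2) < a) (ha' : a < 1 / 2) {x y : ℝ}
    (hy : 0 < y) (hx : x ≠ 0) (hx1 : x + 1 ≠ 0) :
    ‖cpowIncr a (x + y * Complex.I)‖ ≤ lineBound a x := by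
  set z : ℂ := x + y * Complex.I with hz
  have hre : z.re = x := by simp [hz]
  have him : z.im = y := by simp [hz]
  have hxz : |x| ≤ ‖z‖ := hre ▸ Complex.abs_re_le_norm z
  have hxz1 : |x + 1| ≤ ‖z + 1‖ := by
    have := Complex.abs_re_le_norm (z + 1)
    simpa [hre] using this
  have hyz : y ≤ ‖z‖ := by
    have := Complex.abs_im_le_norm z
    rwa [him, abs_of_pos hy] at this
  have h0 := abs_pos.2 hx
  have h1 := incrBound_nonneg a (abs_nonneg (x + 1))
  by_cases h2 : |x| ≤ 2
  · have hb : |x| ≤ 3 := by linarith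
    have h3 : |x + 1| ≤ 3 := (abs_add_le x 1).trans (by norm_num; linarith)
    by_cases hy2 : y ≤ 2
    · have h4 : ‖z‖ ≤ 3 := by
        have := Complex.sq_norm z
        rw [Complex.normSq_apply, hre, him] at this
        have : x * x ≤ 4 := by nlinarith [abs_mul_abs_self x]
        nlinarith [norm_nonneg z]
      have h5 : ‖z + 1‖ ≤ 4 := (norm_add_le z 1).trans (by simp; linarith)
      refine (norm_sub_le _ _).trans ?_
      rw [lineBound, add_comm]
      exact add_le_add (norm_cpow_le_incrBound ha' h0 hb hxz (by linarith))
        (norm_cpow_le_incrBound ha' (abs_pos.2 hx1) h3 hxz1 h5)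
    · refine (norm_cpowIncr_le_of_two_le ha ha' (him ▸ hy) (by linarith)).trans ?_
      have h6 : ‖z‖ ^ (a - 1) ≤ 1 :=
        Real.rpow_le_one_of_one_le_of_nonpos (by linarith) (by linarith)
      have h7 : 4 ≤ incrBound a |x| := by
        rw [incrBound, if_pos hb]
        have : 0 ≤ |x| ^ a := by positivity
        linarith
      rw [lineBound]
      linarith
  · push Not at h2
    refine (norm_cpowIncr_le_of_two_le ha ha' (him ▸ hy) (by linarith)).trans ?_
    have h8 : ‖z‖ ^ (a - 1) ≤ |x| ^ (a - 1) :=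
      Real.rpow_le_rpow_of_nonpos h0 hxz (by linarith)
    rw [lineBound]
    by_cases hb : |x| ≤ 3
    · have h6 : ‖z‖ ^ (a - 1) ≤ 1 :=
        Real.rpow_le_one_of_one_le_of_nonpos (by linarith) (by linarith)
      rw [incrBound, if_pos hb]
      have : 0 ≤ |x| ^ a := by positivity
      linarith
    · rw [incrBound, if_neg hb]
      linarith

lemma differentiableOn_cpowIncr (a : ℝ) :
    DifferentiableOn ℂ (cpowIncr a) {z | 0 < z.im} := by
  intro z hz
  have hz : 0 < z.im := hz
  have h1 : z ∈ Complex.slitPlane := Or.inr hz.ne'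
  have h2 : z + 1 ∈ Complex.slitPlane := Or.inr (by simpa using hz.ne')
  refine DifferentiableAt.differentiableWithinAt ?_
  unfold cpowIncr
  exact ((differentiableAt_id.add_const 1).cpow (differentiableAt_const _) h2).sub
    (differentiableAt_id.cpow (differentiableAt_const _) h1)

/-- The product of two increments along the horizontal line at height `y`. -/
def lineProd (a b y x : ℝ) : ℂ :=
  cpowIncr a (x + y * Complex.I) * cpowIncr b (x + y * Complex.I)

lemma continuous_lineProd (a b : ℝ) {y : ℝ} (hy : 0 < y) : Continuous (lineProd a b y) := by
  have h : ∀ a : ℝ, Continuous (fun x : ℝ => cpowIncr a (x + y * Complex.I)) := fun a =>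
    (differentiableOn_cpowIncr a).continuousOn.comp_continuous (by fun_prop)
      (fun x => by simpa using hy)
  exact (h a).mul (h b)

lemma ae_ne_zero_and_add_one_ne_zero : ∀ᵐ x : ℝ, x ≠ 0 ∧ x + 1 ≠ 0 := by
  have h0 : ∀ᵐ x : ℝ, x ≠ 0 := by simp [ae_iff, measure_singleton]
  have h1 : ∀ᵐ x : ℝ, x ≠ -1 := by simp [ae_iff, measure_singleton]
  filter_upwards [h0, h1] with x hx hx1
  exact ⟨hx, fun h => hx1 (by linarith)⟩

section

variable {a b : ℝ} (ha : -(1 / 2) < a) (ha' : a < 1 / 2) (hb : -(1 / 2) < b) (hb' : b < 1 / 2)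

include ha ha' hb hb'

lemma norm_lineProd_le {y : ℝ} (hy : 0 < y) :
    ∀ᵐ x : ℝ, ‖lineProd a b y x‖ ≤ lineBound a x * lineBound b x := by
  filter_upwards [ae_ne_zero_and_add_one_ne_zero] with x hx
  rw [lineProd, norm_mul]
  exact mul_le_mul (norm_cpowIncr_le_lineBound ha ha' hy hx.1 hx.2)
    (norm_cpowIncr_le_lineBound hb hb' hy hx.1 hx.2) (norm_nonneg _) (lineBound_nonneg _ _)

lemma integrable_lineProd {y : ℝ} (hy : 0 < y) : Integrable (lineProd a b y) :=
  (integrable_lineBound_mul ha ha' hb hb').mono'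
    (continuous_lineProd a b hy).aestronglyMeasurable (norm_lineProd_le ha ha' hb hb' hy)

lemma norm_cpowIncr_mul_le {z : ℂ} (hz : 0 < z.im) (hz2 : 2 ≤ ‖z‖) :
    ‖cpowIncr a z * cpowIncr b z‖ ≤ 16 * ‖z‖ ^ (a + b - 2) := by
  have h : ‖z‖ ^ (a + b - 2) = ‖z‖ ^ (a - 1) * ‖z‖ ^ (b - 1) := by
    rw [← Real.rpow_add (by linarith)]; ring_nf
  rw [norm_mul, h]
  calc _ ≤ (4 * ‖z‖ ^ (a - 1)) * (4 * ‖z‖ ^ (b - 1)) := by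
        gcongr
        · exact norm_cpowIncr_le_of_two_le ha ha' hz hz2
        · exact norm_cpowIncr_le_of_two_le hb hb' hz hz2
    _ = _ := by ring

/-- Sides of fixed length on which the integrand is `O(R^{a+b-2})`; the sign `ε` covers the left and
the right side of the rectangle at once. -/
lemma tendsto_integral_side {y₁ y₂ : ℝ} (hy₁ : 0 < y₁) (hy : y₁ ≤ y₂) {ε : ℝ} (hε : |ε| = 1) :
    Tendsto (fun R : ℝ => ∫ y in y₁..y₂, cpowIncr a ((ε * R : ℝ) + y * Complex.I) *
      cpowIncr b ((ε * R : ℝ) + y * Complex.I)) atTop (𝓝 0) := by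
  have hlim : Tendsto (fun R : ℝ => 16 * R ^ (a + b - 2) * |y₂ - y₁|) atTop (𝓝 0) := by
    have := tendsto_rpow_neg_atTop (y := -(a + b - 2)) (by linarith)
    rw [neg_neg] at this
    simpa using (this.const_mul 16).mul_const |y₂ - y₁|
  refine squeeze_zero_norm' ?_ hlim
  filter_upwards [eventually_ge_atTop 2] with R hR
  refine intervalIntegral.norm_integral_le_of_norm_le_const fun y hy' => ?_
  rw [Set.uIoc_of_le hy] at hy'
  set z : ℂ := ((ε * R : ℝ) : ℂ) + y * Complex.I with hz
  have him : z.im = y := by simp [hz]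
  have hre : z.re = ε * R := by simp [hz]
  have hRz : R ≤ ‖z‖ := by
    have := Complex.abs_re_le_norm z
    rwa [hre, abs_mul, hε, one_mul, abs_of_pos (by linarith)] at this
  refine (norm_cpowIncr_mul_le ha ha' hb hb' (by rw [him]; linarith [hy'.1])
    (hR.trans hRz)).trans ?_
  have := Real.rpow_le_rpow_of_nonpos (by linarith : 0 < R) hRz (by linarith : a + b - 2 ≤ 0)
  linarith

/-- Cauchy's theorem on `[-R, R] × [y₁, y₂]`, with the vertical sides disappearing as `R → ∞`. -/
lemma integral_lineProd_eq {y₁ y₂ : ℝ} (hy₁ : 0 < y₁) (hy : y₁ ≤ y₂) :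
    ∫ x, lineProd a b y₁ x = ∫ x, lineProd a b y₂ x := by
  have hrect : ∀ R : ℝ, (∫ x in (-R)..R, lineProd a b y₁ x) - (∫ x in (-R)..R, lineProd a b y₂ x)
      + Complex.I * (∫ y in y₁..y₂, cpowIncr a (((1 : ℝ) * R : ℝ) + y * Complex.I) *
      cpowIncr b (((1 : ℝ) * R : ℝ) + y * Complex.I))
      - Complex.I * (∫ y in y₁..y₂, cpowIncr a (((-1 : ℝ) * R : ℝ) + y * Complex.I) *
      cpowIncr b (((-1 : ℝ) * R : ℝ) + y * Complex.I)) = 0 := by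
    intro R
    have := Complex.integral_boundary_rect_eq_zero_of_differentiableOn
      (fun z => cpowIncr a z * cpowIncr b z) ⟨-R, y₁⟩ ⟨R, y₂⟩
      (((differentiableOn_cpowIncr a).mul (differentiableOn_cpowIncr b)).mono fun z hz => by
        have := hz.2
        simp only [Set.mem_preimage, Set.uIcc_of_le hy] at this
        exact hy₁.trans_le this.1)
    simpa [lineProd] using this
  have h1 := intervalIntegral_tendsto_integral (integrable_lineProd ha ha' hb hb' hy₁)
    tendsto_neg_atTop_atBot tendsto_id
  have h2 := intervalIntegral_tendsto_integral
    (integrable_lineProd ha ha' hb hb' (hy₁.trans_le hy)) tendsto_neg_atTop_atBot tendsto_id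
  have h3 := tendsto_integral_side ha ha' hb hb' hy₁ hy (ε := 1) (by simp)
  have h4 := tendsto_integral_side ha ha' hb hb' hy₁ hy (ε := -1) (by simp)
  have h5 := ((h1.sub h2).add (h3.const_mul Complex.I)).sub (h4.const_mul Complex.I)
  simp only [mul_zero, add_zero, sub_zero, id] at h5
  exact sub_eq_zero.1 (tendsto_nhds_unique h5
    (tendsto_const_nhds.congr fun R => (hrect R).symm))

/-- The integral does not depend on the height, and it tends to zero when the line is pushed up to
infinity. -/
lemma integral_lineProd {y : ℝ} (hy : 0 < y) : ∫ x, lineProd a b y x = 0 := by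
  have h : Tendsto (fun t => ∫ x, lineProd a b t x) atTop (𝓝 (∫ _ : ℝ, (0 : ℂ))) := by
    refine tendsto_integral_filter_of_dominated_convergence
      (fun x => lineBound a x * lineBound b x) ?_ ?_
      (integrable_lineBound_mul ha ha' hb hb') ?_
    · filter_upwards [eventually_gt_atTop 0] with t ht
      exact (continuous_lineProd a b ht).aestronglyMeasurable
    · filter_upwards [eventually_gt_atTop 0] with t ht
      exact norm_lineProd_le ha ha' hb hb' ht
    · refine ae_of_all _ fun x => ?_
      have hlim : Tendsto (fun t : ℝ => 16 * t ^ (a + b - 2)) atTop (𝓝 0) := by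
        have := tendsto_rpow_neg_atTop (y := -(a + b - 2)) (by linarith)
        rw [neg_neg] at this
        simpa using this.const_mul 16
      refine squeeze_zero_norm' ?_ hlim
      filter_upwards [eventually_ge_atTop 2] with t ht
      have him : ((x : ℂ) + t * Complex.I).im = t := by simp
      have htz : t ≤ ‖(x : ℂ) + t * Complex.I‖ := by
        have := Complex.abs_im_le_norm ((x : ℂ) + t * Complex.I)
        rwa [him, abs_of_pos (by linarith)] at this
      refine (norm_cpowIncr_mul_le ha ha' hb hb' (by rw [him]; linarith) (ht.trans htz)).trans ?_
      have := Real.rpow_le_rpow_of_nonpos (by linarith : 0 < t) htz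
        (by linarith : a + b - 2 ≤ 0)
      linarith
  rw [integral_zero] at h
  refine tendsto_nhds_unique (tendsto_const_nhds.congr' ?_) h
  filter_upwards [eventually_ge_atTop y] with t ht
  exact integral_lineProd_eq ha ha' hb hb' hy ht

end

/-! ### Inner products of the kernels -/

/-- Near the negative axis the principal branch has its cut; passing to `-z`, which lies near the
positive axis, makes the limit from above a matter of continuity. -/
lemma cpow_eq_exp_mul_neg_cpow (a : ℝ) {z : ℂ} (hz : 0 < z.im) :
    z ^ (a : ℂ) = Complex.exp (Complex.I * (Real.pi * a)) * (-z) ^ (a : ℂ) := by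
  have h0 : z ≠ 0 := by
    rintro rfl
    simp at hz
  rw [Complex.cpow_def_of_ne_zero h0, Complex.cpow_def_of_ne_zero (neg_ne_zero.2 h0),
    ← Complex.exp_add, Complex.log, Complex.log, norm_neg,
    Complex.arg_neg_eq_arg_sub_pi_of_im_pos hz]
  congr 1
  push_cast
  ring

/-- The boundary value `(x + i0) ^ a`. -/
def cpowBoundary (a x : ℝ) : ℂ :=
  posPow a x + Complex.exp (Complex.I * (Real.pi * a)) * negPow a x

lemma tendsto_cpow_boundary (a : ℝ) {x : ℝ} (hx : x ≠ 0) :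
    Tendsto (fun y : ℝ => ((x : ℂ) + y * Complex.I) ^ (a : ℂ)) (𝓝[>] 0)
      (𝓝 (cpowBoundary a x)) := by
  have hline : Tendsto (fun y : ℝ => (x : ℂ) + y * Complex.I) (𝓝[>] 0) (𝓝 (x : ℂ)) := by
    have : Continuous fun y : ℝ => (x : ℂ) + y * Complex.I := by fun_prop
    simpa using (this.tendsto 0).mono_left nhdsWithin_le_nhds
  rcases lt_or_gt_of_ne hx with h | h
  · have hs : -(x : ℂ) ∈ Complex.slitPlane := by
      rw [← Complex.ofReal_neg, Complex.ofReal_mem_slitPlane]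
      linarith
    have h1 := ((continuousAt_cpow_const (b := (a : ℂ)) hs).tendsto.comp hline.neg).const_mul
      (Complex.exp (Complex.I * (Real.pi * a)))
    have h2 : cpowBoundary a x =
        Complex.exp (Complex.I * (Real.pi * a)) * (-(x : ℂ)) ^ (a : ℂ) := by
      rw [cpowBoundary, negPow, posPow, posPow, if_neg (not_lt.2 h.le), if_pos (by linarith),
        Complex.ofReal_cpow (by linarith)]
      simp
    rw [h2]
    refine h1.congr' ?_
    filter_upwards [self_mem_nhdsWithin] with y hy
    exact (cpow_eq_exp_mul_neg_cpow a (by simpa using hy)).symm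
  · have hs : (x : ℂ) ∈ Complex.slitPlane := Complex.ofReal_mem_slitPlane.2 h
    have h2 : cpowBoundary a x = (x : ℂ) ^ (a : ℂ) := by
      rw [cpowBoundary, negPow, posPow, posPow, if_pos h, if_neg (by linarith),
        Complex.ofReal_cpow h.le]
      simp
    rw [h2]
    exact (continuousAt_cpow_const (b := (a : ℂ)) hs).tendsto.comp hline

/-- This is where the kernels meet the holomorphic function: the boundary value of the increment is
`f₊ + e^{iπa} f₋`, read in the reflected variable. -/
lemma cpowBoundary_incr (a x : ℝ) : cpowBoundary a (x + 1) - cpowBoundary a x =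
    kernelPlus 1 a (-x) + Complex.exp (Complex.I * (Real.pi * a)) * kernelMinus 1 a (-x) := by
  simp only [cpowBoundary, kernelPlus, kernelMinus, sub_neg_eq_add, neg_neg, add_comm (1 : ℝ) x]
  push_cast
  ring

lemma tendsto_cpowIncr (a : ℝ) {x : ℝ} (hx : x ≠ 0) (hx1 : x + 1 ≠ 0) :
    Tendsto (fun y : ℝ => cpowIncr a (x + y * Complex.I)) (𝓝[>] 0)
      (𝓝 (kernelPlus 1 a (-x) +
        Complex.exp (Complex.I * (Real.pi * a)) * kernelMinus 1 a (-x))) := by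
  rw [← cpowBoundary_incr]
  refine ((tendsto_cpow_boundary a hx1).sub (tendsto_cpow_boundary a hx)).congr fun y => ?_
  rw [cpowIncr]
  congr 2
  push_cast
  ring

/-! ### Square integrability and reflection symmetry of the kernels. -/

lemma measurable_posPow (a : ℝ) : Measurable (posPow a) := by
  unfold posPow
  exact Measurable.ite measurableSet_Ioi (by fun_prop) (by fun_prop)

lemma measurable_kernelPlus (t a : ℝ) : Measurable (kernelPlus t a) := by
  unfold kernelPlus
  exact ((measurable_posPow a).comp (by fun_prop)).sub ((measurable_posPow a).comp (by fun_prop))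

lemma kernelMinus_eq (t a x : ℝ) : kernelMinus t a x = -kernelPlus t a (t - x) := by
  simp only [kernelMinus, kernelPlus, negPow]
  ring_nf

/-- For `x > 0` the kernel `f₋` vanishes at `-x`, so `|f₊|` is the limit of `‖cpowIncr‖` from above
and inherits its bound; for `x < 0` at most the single power `(x + 1)^a` survives. -/
lemma abs_kernelPlus_le {a : ℝ} (ha : -(1 / 2) < a) (ha' : a < 1 / 2) {x : ℝ} (hx : x ≠ 0)
    (hx1 : x + 1 ≠ 0) : |kernelPlus 1 a (-x)| ≤ lineBound a x := by
  have e1 : kernelPlus 1 a (-x) = posPow a (x + 1) - posPow a x := by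
    simp [kernelPlus, add_comm]
  rcases lt_or_gt_of_ne hx with h | h
  · have h0 : posPow a x = 0 := if_neg (not_lt.2 h.le)
    rcases lt_or_gt_of_ne hx1 with h1 | h1
    · rw [e1, h0, posPow, if_neg (not_lt.2 h1.le)]
      simpa using lineBound_nonneg a x
    · rw [e1, h0, posPow, if_pos h1, sub_zero, abs_of_nonneg (by positivity), lineBound,
        abs_of_pos h1]
      have := incrBound_nonneg a (abs_nonneg x)
      have h2 : incrBound a (x + 1) = (x + 1) ^ a + 4 := if_pos (by linarith)
      linarith
  · have hm : kernelMinus 1 a (-x) = 0 := by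
      simp only [kernelMinus, negPow, posPow]
      rw [if_neg (by linarith), if_neg (by linarith), sub_zero]
    have hl := (tendsto_cpowIncr a hx hx1).norm
    rw [hm, Complex.ofReal_zero, mul_zero, add_zero, Complex.norm_real, Real.norm_eq_abs] at hl
    refine le_of_tendsto hl ?_
    filter_upwards [self_mem_nhdsWithin] with y hy
    exact norm_cpowIncr_le_lineBound ha ha' hy hx hx1

lemma memLp_kernelPlus {a : ℝ} (ha : -(1 / 2) < a) (ha' : a < 1 / 2) :
    MemLp (kernelPlus 1 a) 2 volume := by
  have h : MemLp (fun x => kernelPlus 1 a (-x)) 2 volume := by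
    refine (memLp_lineBound ha ha').mono
      ((measurable_kernelPlus 1 a).comp measurable_neg).aestronglyMeasurable ?_
    filter_upwards [ae_ne_zero_and_add_one_ne_zero] with x hx
    rw [Real.norm_eq_abs, Real.norm_eq_abs, abs_of_nonneg (lineBound_nonneg a x)]
    exact abs_kernelPlus_le ha ha' hx.1 hx.2
  have h2 := h.comp_measurePreserving (Measure.measurePreserving_neg (volume : Measure ℝ))
  simpa [Function.comp_def] using h2

lemma memLp_kernelMinus {a : ℝ} (ha : -(1 / 2) < a) (ha' : a < 1 / 2) :
    MemLp (kernelMinus 1 a) 2 volume := by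
  have h := ((memLp_kernelPlus ha ha').comp_measurePreserving
    (Measure.measurePreserving_sub_left (volume : Measure ℝ) 1)).neg
  refine (memLp_congr_ae (ae_of_all _ fun x => ?_)).1 h
  rw [kernelMinus_eq]
  rfl

lemma integral_kernelMinus_mul_kernelMinus (a b : ℝ) :
    ∫ x, kernelMinus 1 a x * kernelMinus 1 b x = ∫ x, kernelPlus 1 a x * kernelPlus 1 b x := by
  simp only [kernelMinus_eq, neg_mul_neg]
  exact integral_sub_left_eq_self (fun x => kernelPlus 1 a x * kernelPlus 1 b x) volume 1

lemma integral_kernelMinus_mul_kernelPlus (a b : ℝ) :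
    ∫ x, kernelMinus 1 a x * kernelPlus 1 b x = ∫ x, kernelPlus 1 a x * kernelMinus 1 b x := by
  simp only [kernelMinus_eq]
  rw [← integral_sub_left_eq_self (fun x => kernelPlus 1 a x * -kernelPlus 1 b (1 - x)) volume 1]
  simp only [sub_sub_cancel, neg_mul, mul_neg]

lemma integral_rpow_mul_one_sub_rpow {a b : ℝ} (ha : -1 < a) (hb : -1 < b) :
    ∫ x in Set.Ioo (0 : ℝ) 1, x ^ a * (1 - x) ^ b =
      Real.Gamma (a + 1) * Real.Gamma (b + 1) / Real.Gamma (a + b + 2) := by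
  have h := Complex.betaIntegral_eq_Gamma_mul_div ((a + 1 : ℝ) : ℂ) ((b + 1 : ℝ) : ℂ)
    (by rw [Complex.ofReal_re]; linarith) (by rw [Complex.ofReal_re]; linarith)
  rw [← Complex.ofReal_add, Complex.Gamma_ofReal, Complex.Gamma_ofReal, Complex.Gamma_ofReal,
    Complex.betaIntegral, intervalIntegral.integral_of_le zero_le_one,
    integral_Ioc_eq_integral_Ioo] at h
  have h2 : ∫ x in Set.Ioo (0 : ℝ) 1, (x : ℂ) ^ (((a + 1 : ℝ) : ℂ) - 1) *
      (1 - (x : ℂ)) ^ (((b + 1 : ℝ) : ℂ) - 1) =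
      ∫ x in Set.Ioo (0 : ℝ) 1, ((x ^ a * (1 - x) ^ b : ℝ) : ℂ) := by
    refine setIntegral_congr_fun measurableSet_Ioo fun x hx => ?_
    have h1 : 0 ≤ 1 - x := by linarith [hx.2]
    rw [Complex.ofReal_mul, Complex.ofReal_cpow hx.1.le, Complex.ofReal_cpow h1]
    push_cast
    simp
  rw [h2, integral_complex_ofReal] at h
  have h3 : a + 1 + (b + 1) = a + b + 2 := by ring
  rw [h3] at h
  exact_mod_cast h

/-- `f₊` vanishes for `x > 1` and `f₋` for `x < 0`, so the product lives on `(0, 1)`, where it is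
`-(1 - x)^a x^b`: a Beta integral. -/
lemma integral_kernelPlus_mul_kernelMinus {a b : ℝ} (ha : -1 < a) (hb : -1 < b) :
    ∫ x, kernelPlus 1 a x * kernelMinus 1 b x =
      -(Real.Gamma (a + 1) * Real.Gamma (b + 1) / Real.Gamma (a + b + 2)) := by
  have h : ∫ x, kernelPlus 1 a x * kernelMinus 1 b x =
      ∫ x, (Set.Ioo (0 : ℝ) 1).indicator (fun x => -(x ^ b * (1 - x) ^ a)) x := by
    refine integral_congr_ae ?_
    have h0 : ∀ᵐ x : ℝ, x ≠ 0 := by simp [ae_iff, measure_singleton]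
    have h1 : ∀ᵐ x : ℝ, x ≠ 1 := by simp [ae_iff, measure_singleton]
    filter_upwards [h0, h1] with x hx0 hx1
    simp only [kernelPlus, kernelMinus, negPow, posPow, Set.indicator, Set.mem_Ioo, neg_neg,
      neg_sub]
    rcases lt_or_gt_of_ne hx0 with h | h
    · rw [if_neg (show ¬ 0 < x - 1 by linarith), if_neg (show ¬ 0 < x by linarith),
        if_neg (show ¬ (0 < x ∧ x < 1) by simp [h.not_gt])]
      simp
    · rcases lt_or_gt_of_ne hx1 with h' | h'
      · rw [if_pos (show 0 < 1 - x by linarith), if_neg (show ¬ 0 < x - 1 by linarith),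
          if_neg (show ¬ 0 < -x by linarith), if_pos h, if_pos ⟨h, h'⟩]
        ring
      · rw [if_neg (show ¬ 0 < 1 - x by linarith), if_neg (show ¬ 0 < -x by linarith),
          if_neg (show ¬ (0 < x ∧ x < 1) by simp [h'.not_gt])]
        simp
  rw [h, integral_indicator measurableSet_Ioo, integral_neg, integral_rpow_mul_one_sub_rpow hb ha,
    add_comm b a]
  ring

section

variable {a b : ℝ} (ha : -(1 / 2) < a) (ha' : a < 1 / 2) (hb : -(1 / 2) < b) (hb' : b < 1 / 2)

include ha ha' hb hb'

/-- The vanishing line integrals, taken to the limit `y → 0+` by dominated convergence. -/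
lemma integral_boundary_eq_zero :
    ∫ x : ℝ, ((kernelPlus 1 a x : ℂ) +
        Complex.exp (Complex.I * (Real.pi * a)) * kernelMinus 1 a x) *
      ((kernelPlus 1 b x : ℂ) +
        Complex.exp (Complex.I * (Real.pi * b)) * kernelMinus 1 b x) = 0 := by
  rw [← integral_neg_eq_self (fun x : ℝ => ((kernelPlus 1 a x : ℂ) +
        Complex.exp (Complex.I * (Real.pi * a)) * kernelMinus 1 a x) *
      ((kernelPlus 1 b x : ℂ) +
        Complex.exp (Complex.I * (Real.pi * b)) * kernelMinus 1 b x)) volume]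
  have h : Tendsto (fun y => ∫ x, lineProd a b y x) (𝓝[>] 0) (𝓝 (∫ x : ℝ,
      ((kernelPlus 1 a (-x) : ℂ) +
        Complex.exp (Complex.I * (Real.pi * a)) * kernelMinus 1 a (-x)) *
      ((kernelPlus 1 b (-x) : ℂ) +
        Complex.exp (Complex.I * (Real.pi * b)) * kernelMinus 1 b (-x)))) := by
    refine tendsto_integral_filter_of_dominated_convergence
      (fun x => lineBound a x * lineBound b x) ?_ ?_
      (integrable_lineBound_mul ha ha' hb hb') ?_
    · filter_upwards [self_mem_nhdsWithin] with y hy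
      exact (continuous_lineProd a b hy).aestronglyMeasurable
    · filter_upwards [self_mem_nhdsWithin] with y hy
      exact norm_lineProd_le ha ha' hb hb' hy
    · filter_upwards [ae_ne_zero_and_add_one_ne_zero] with x hx
      exact (tendsto_cpowIncr a hx.1 hx.2).mul (tendsto_cpowIncr b hx.1 hx.2)
  refine tendsto_nhds_unique h (tendsto_const_nhds.congr' ?_)
  filter_upwards [self_mem_nhdsWithin] with y hy
  exact (integral_lineProd ha ha' hb hb' hy).symm

/-- Expanding the boundary relation and using the reflection `x ↦ 1 - x`, which exchanges `f₊` and
`-f₋`, leaves a single unknown: `J (1 + e^{iπ(a+b)}) = B (e^{iπa} + e^{iπb})`. -/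
lemma integral_kernelPlus_mul_cos :
    (∫ x, kernelPlus 1 a x * kernelPlus 1 b x) * Real.cos (Real.pi * (a + b) / 2) =
      Real.Gamma (a + 1) * Real.Gamma (b + 1) / Real.Gamma (a + b + 2) *
        Real.cos (Real.pi * (a - b) / 2) := by
  set J := ∫ x, kernelPlus 1 a x * kernelPlus 1 b x with hJ
  set B := Real.Gamma (a + 1) * Real.Gamma (b + 1) / Real.Gamma (a + b + 2) with hB
  set ea := Complex.exp (Complex.I * (Real.pi * a)) with hea
  set eb := Complex.exp (Complex.I * (Real.pi * b)) with heb
  have hpa := memLp_kernelPlus ha ha'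
  have hpb := memLp_kernelPlus hb hb'
  have hma := memLp_kernelMinus ha ha'
  have hmb := memLp_kernelMinus hb hb'
  have hpp : Integrable fun x => ((kernelPlus 1 a x * kernelPlus 1 b x : ℝ) : ℂ) :=
    (hpa.integrable_mul hpb).ofReal
  have hpm : Integrable fun x => eb * ((kernelPlus 1 a x * kernelMinus 1 b x : ℝ) : ℂ) :=
    (hpa.integrable_mul hmb).ofReal.const_mul eb
  have hmp : Integrable fun x => ea * ((kernelMinus 1 a x * kernelPlus 1 b x : ℝ) : ℂ) :=
    (hma.integrable_mul hpb).ofReal.const_mul ea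
  have hmm : Integrable fun x => ea * eb * ((kernelMinus 1 a x * kernelMinus 1 b x : ℝ) : ℂ) :=
    (hma.integrable_mul hmb).ofReal.const_mul (ea * eb)
  have h₁ : Integrable fun x => ((kernelPlus 1 a x * kernelPlus 1 b x : ℝ) : ℂ) +
      eb * ((kernelPlus 1 a x * kernelMinus 1 b x : ℝ) : ℂ) := hpp.add hpm
  have h₂ : Integrable fun x => ea * ((kernelMinus 1 a x * kernelPlus 1 b x : ℝ) : ℂ) +
      ea * eb * ((kernelMinus 1 a x * kernelMinus 1 b x : ℝ) : ℂ) := hmp.add hmm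
  have h := integral_boundary_eq_zero ha ha' hb hb'
  have e : (fun x : ℝ => ((kernelPlus 1 a x : ℂ) + ea * kernelMinus 1 a x) *
      ((kernelPlus 1 b x : ℂ) + eb * kernelMinus 1 b x)) = fun x =>
      (((kernelPlus 1 a x * kernelPlus 1 b x : ℝ) : ℂ) +
        eb * ((kernelPlus 1 a x * kernelMinus 1 b x : ℝ) : ℂ)) +
      (ea * ((kernelMinus 1 a x * kernelPlus 1 b x : ℝ) : ℂ) +
        ea * eb * ((kernelMinus 1 a x * kernelMinus 1 b x : ℝ) : ℂ)) := by
    funext x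
    push_cast
    ring
  rw [← hea, ← heb, e, integral_add h₁ h₂, integral_add hpp hpm,
    integral_add hmp hmm, integral_const_mul, integral_const_mul, integral_const_mul,
    integral_complex_ofReal, integral_complex_ofReal, integral_complex_ofReal,
    integral_complex_ofReal, integral_kernelMinus_mul_kernelMinus,
    integral_kernelMinus_mul_kernelPlus,
    integral_kernelPlus_mul_kernelMinus (by linarith) (by linarith), ← hJ, ← hB] at h
  -- Multiplying by `e^{-iπ(a+b)/2}` centres the phases, so that both sides become twice a cosine.
  set c : ℂ := Complex.exp (-(Complex.I * (Real.pi * (a + b) / 2))) with hc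
  have h1 : c * (ea * eb) = Complex.exp (((Real.pi * (a + b) / 2 : ℝ) : ℂ) * Complex.I) := by
    rw [hc, hea, heb, ← Complex.exp_add, ← Complex.exp_add]
    congr 1
    push_cast
    ring
  have h2 : c * ea = Complex.exp (((Real.pi * (a - b) / 2 : ℝ) : ℂ) * Complex.I) := by
    rw [hc, hea, ← Complex.exp_add]
    congr 1
    push_cast
    ring
  have h3 : c * eb = Complex.exp (((-(Real.pi * (a - b) / 2) : ℝ) : ℂ) * Complex.I) := by
    rw [hc, heb, ← Complex.exp_add]
    congr 1
    push_cast
    ring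
  have h4 : c = Complex.exp (((-(Real.pi * (a + b) / 2) : ℝ) : ℂ) * Complex.I) := by
    rw [hc]
    congr 1
    push_cast
    ring
  have h5 : (J : ℂ) * (c + c * (ea * eb)) = B * (c * ea + c * eb) := by
    push_cast at h
    linear_combination c * h
  rw [h1, h2, h3, h4] at h5
  have h6 := congrArg Complex.re h5
  rw [Complex.re_ofReal_mul, Complex.re_ofReal_mul, Complex.add_re, Complex.add_re,
    Complex.exp_ofReal_mul_I_re, Complex.exp_ofReal_mul_I_re, Complex.exp_ofReal_mul_I_re,
    Complex.exp_ofReal_mul_I_re, Real.cos_neg, Real.cos_neg] at h6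
  linarith

/-- With `s = a + b + 1` the factor on the left is `Γ(s+1) sin(πs/2)`, the one that appears in the
Fourier series of `fgnCov s`. -/
lemma integral_kernelPlus_mul_kernelPlus :
    (∫ x, kernelPlus 1 a x * kernelPlus 1 b x) *
        (Real.Gamma (a + b + 2) * Real.sin (Real.pi * (a + b + 1) / 2)) =
      Real.Gamma (a + 1) * Real.Gamma (b + 1) * Real.cos (Real.pi * (a - b) / 2) := by
  have h := integral_kernelPlus_mul_cos ha ha' hb hb'
  have h1 : Real.sin (Real.pi * (a + b + 1) / 2) = Real.cos (Real.pi * (a + b) / 2) := by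
    rw [← Real.sin_add_pi_div_two]
    ring_nf
  have h2 : Real.Gamma (a + b + 2) ≠ 0 := (Real.Gamma_pos_of_pos (by linarith)).ne'
  rw [h1, mul_comm (Real.Gamma (a + b + 2)), ← mul_assoc, h]
  field_simp

/-- By reflection the four products add up to `2J - 2B`, and the difference `cos(π(a-b)/2) -
cos(π(a+b)/2)` factors as `2 sin(πa/2) sin(πb/2)`. -/
lemma integral_wellBalanced :
    (∫ x, (kernelPlus 1 a x + kernelMinus 1 a x) * (kernelPlus 1 b x + kernelMinus 1 b x)) *
        (Real.Gamma (a + b + 2) * Real.sin (Real.pi * (a + b + 1) / 2)) =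
      4 * Real.Gamma (a + 1) * Real.Gamma (b + 1) *
        Real.cos ((a + 1) * Real.pi / 2) * Real.cos ((b + 1) * Real.pi / 2) := by
  have hpa := memLp_kernelPlus ha ha'
  have hpb := memLp_kernelPlus hb hb'
  have hma := memLp_kernelMinus ha ha'
  have hmb := memLp_kernelMinus hb hb'
  have hpp : Integrable fun x => kernelPlus 1 a x * kernelPlus 1 b x := hpa.integrable_mul hpb
  have hpm : Integrable fun x => kernelPlus 1 a x * kernelMinus 1 b x := hpa.integrable_mul hmb
  have hmp : Integrable fun x => kernelMinus 1 a x * kernelPlus 1 b x := hma.integrable_mul hpb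
  have hmm : Integrable fun x => kernelMinus 1 a x * kernelMinus 1 b x := hma.integrable_mul hmb
  have h₁ : Integrable fun x => kernelPlus 1 a x * kernelPlus 1 b x +
      kernelPlus 1 a x * kernelMinus 1 b x := hpp.add hpm
  have h₂ : Integrable fun x => kernelMinus 1 a x * kernelPlus 1 b x +
      kernelMinus 1 a x * kernelMinus 1 b x := hmp.add hmm
  have h := integral_kernelPlus_mul_kernelPlus ha ha' hb hb'
  have h2 : Real.Gamma (a + b + 2) ≠ 0 := (Real.Gamma_pos_of_pos (by linarith)).ne'
  have e : (fun x => (kernelPlus 1 a x + kernelMinus 1 a x) *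
      (kernelPlus 1 b x + kernelMinus 1 b x)) = fun x =>
      (kernelPlus 1 a x * kernelPlus 1 b x + kernelPlus 1 a x * kernelMinus 1 b x) +
      (kernelMinus 1 a x * kernelPlus 1 b x + kernelMinus 1 a x * kernelMinus 1 b x) := by
    funext x
    ring
  rw [e, integral_add h₁ h₂, integral_add hpp hpm, integral_add hmp hmm,
    integral_kernelMinus_mul_kernelMinus, integral_kernelMinus_mul_kernelPlus,
    integral_kernelPlus_mul_kernelMinus (by linarith) (by linarith)]
  have h1 : Real.sin (Real.pi * (a + b + 1) / 2) = Real.cos (Real.pi * a / 2 + Real.pi * b / 2) := by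
    rw [← Real.sin_add_pi_div_two]
    ring_nf
  have h3 : Real.cos (Real.pi * (a - b) / 2) = Real.cos (Real.pi * a / 2 - Real.pi * b / 2) := by
    ring_nf
  have h4 : ∀ c : ℝ, Real.cos ((c + 1) * Real.pi / 2) = -Real.sin (Real.pi * c / 2) := fun c => by
    rw [← Real.cos_add_pi_div_two]
    ring_nf
  rw [h1, h3] at h
  rw [h1, h4, h4]
  have h5 : Real.Gamma (a + 1) * Real.Gamma (b + 1) / Real.Gamma (a + b + 2) *
      Real.Gamma (a + b + 2) = Real.Gamma (a + 1) * Real.Gamma (b + 1) := by field_simp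
  rw [Real.cos_sub] at h
  rw [Real.cos_add] at h ⊢
  linear_combination 2 * h - 2 * (Real.cos (Real.pi * a / 2) * Real.cos (Real.pi * b / 2) -
    Real.sin (Real.pi * a / 2) * Real.sin (Real.pi * b / 2)) * h5

end

/-! ### Second moments of Wiener integrals -/

section L2

variable {α : Type*} [MeasurableSpace α] {μ : Measure α}

lemma tendsto_integral_mul_of_tendsto_eLpNorm {u v : ℕ → α → ℝ} {f g : α → ℝ}
    (hu : ∀ m, MemLp (u m) 2 μ) (hv : ∀ m, MemLp (v m) 2 μ) (hf : MemLp f 2 μ)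
    (hg : MemLp g 2 μ)
    (huf : Tendsto (fun m => eLpNorm (fun x => u m x - f x) 2 μ) atTop (𝓝 0))
    (hvg : Tendsto (fun m => eLpNorm (fun x => v m x - g x) 2 μ) atTop (𝓝 0)) :
    Tendsto (fun m => ∫ x, u m x * v m x ∂μ) atTop (𝓝 (∫ x, f x * g x ∂μ)) := by
  have h1 := (Lp.tendsto_Lp_iff_tendsto_eLpNorm'' u hu f hf).2 huf
  have h2 := (Lp.tendsto_Lp_iff_tendsto_eLpNorm'' v hv g hg).2 hvg
  have key : ∀ (p q : α → ℝ) (hp : MemLp p 2 μ) (hq : MemLp q 2 μ),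
      inner ℝ (hp.toLp p) (hq.toLp q) = ∫ x, p x * q x ∂μ := by
    intro p q hp hq
    rw [L2.inner_def]
    refine integral_congr_ae ?_
    filter_upwards [hp.coeFn_toLp, hq.coeFn_toLp] with x hx hy
    rw [hx, hy]
    simp [mul_comm]
  have h3 := h1.inner (𝕜 := ℝ) h2
  simpa only [key] using h3

end L2

/-- The covariance function of two-sided Brownian motion. -/
def bmCov (s t : ℝ) : ℝ := (|s| + |t| - |s - t|) / 2

lemma bmCov_comm (s t : ℝ) : bmCov s t = bmCov t s := by
  rw [bmCov, bmCov, abs_sub_comm]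
  ring

/-- The overlap length of two intervals is the rectangular increment of the Brownian covariance: the
Wiener isometry on single intervals. -/
lemma integral_indicator_mul_indicator {a b c d : ℝ} (hab : a ≤ b) (hcd : c ≤ d) :
    ∫ x, (Set.Ioc a b).indicator (fun _ => (1 : ℝ)) x *
        (Set.Ioc c d).indicator (fun _ => (1 : ℝ)) x =
      bmCov b d - bmCov b c - bmCov a d + bmCov a c := by
  have h : (fun x => (Set.Ioc a b).indicator (fun _ => (1 : ℝ)) x *
      (Set.Ioc c d).indicator (fun _ => (1 : ℝ)) x) =
      (Set.Ioc (max a c) (min b d)).indicator 1 := by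
    rw [← Set.Ioc_inter_Ioc, Set.inter_indicator_one]
    rfl
  rw [h, integral_indicator_one measurableSet_Ioc, Real.volume_real_Ioc]
  simp only [bmCov]
  grind

section Moments

variable {Ω : Type*} [MeasurableSpace Ω] {P : Measure Ω}

lemma memLp_of_isBrownianReal {X : ℝ≥0 → Ω → ℝ} (h : IsBrownianReal X P) (t : ℝ≥0) :
    MemLp (X t) 2 P := (h.hasLaw_eval t).hasGaussianLaw.memLp_two

lemma integral_mul_of_isBrownianReal [IsProbabilityMeasure P] {X : ℝ≥0 → Ω → ℝ}
    (h : IsBrownianReal X P) (s t : ℝ≥0) : ∫ ω, X s ω * X t ω ∂P = min (s : ℝ) t := by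
  have h1 := h.covariance_eval s t
  rw [covariance_eq_sub (memLp_of_isBrownianReal h s) (memLp_of_isBrownianReal h t),
    h.integral_eval, h.integral_eval, mul_zero, sub_zero] at h1
  simpa using h1

lemma exists_neg_coe_of_nonpos {t : ℝ} (ht : t ≤ 0) : ∃ u : ℝ≥0, t = -(u : ℝ) :=
  ⟨Real.toNNReal (-t), by rw [Real.coe_toNNReal _ (by linarith), neg_neg]⟩

lemma IsTwoSidedBM.memLp {B : ℝ → Ω → ℝ} (hB : IsTwoSidedBM B P) (t : ℝ) : MemLp (B t) 2 P := by
  rcases le_total 0 t with h | h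
  · exact memLp_of_isBrownianReal hB.forward ⟨t, h⟩
  · obtain ⟨u, rfl⟩ := exists_neg_coe_of_nonpos h
    exact memLp_of_isBrownianReal hB.backward u

lemma IsTwoSidedBM.integral_eq_zero {B : ℝ → Ω → ℝ} (hB : IsTwoSidedBM B P) (t : ℝ) :
    ∫ ω, B t ω ∂P = 0 := by
  rcases le_total 0 t with h | h
  · exact hB.forward.integral_eval ⟨t, h⟩
  · obtain ⟨u, rfl⟩ := exists_neg_coe_of_nonpos h
    exact hB.backward.integral_eval u

/-- Times of opposite sign belong to independent centred halves, and `bmCov` vanishes for such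
times. -/
lemma IsTwoSidedBM.integral_mul_of_nonneg_of_nonpos {B : ℝ → Ω → ℝ} (hB : IsTwoSidedBM B P)
    {s t : ℝ} (hs : 0 ≤ s) (ht : t ≤ 0) : ∫ ω, B s ω * B t ω ∂P = bmCov s t := by
  have h1 : IndepFun (B s) (B t) P := by
    lift s to ℝ≥0 using hs
    obtain ⟨u, rfl⟩ := exists_neg_coe_of_nonpos ht
    exact hB.indep.comp (measurable_pi_apply s) (measurable_pi_apply u)
  rw [h1.integral_fun_mul_eq_mul_integral (hB.memLp s).aestronglyMeasurable
    (hB.memLp t).aestronglyMeasurable, hB.integral_eq_zero, zero_mul, bmCov, abs_of_nonneg hs,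
    abs_of_nonpos ht, abs_of_nonneg (by linarith)]
  ring

lemma IsTwoSidedBM.integral_mul [IsProbabilityMeasure P] {B : ℝ → Ω → ℝ}
    (hB : IsTwoSidedBM B P) (s t : ℝ) : ∫ ω, B s ω * B t ω ∂P = bmCov s t := by
  rcases le_total 0 s with hs | hs <;> rcases le_total 0 t with ht | ht
  · rw [bmCov, abs_of_nonneg hs, abs_of_nonneg ht]
    lift s to ℝ≥0 using hs
    lift t to ℝ≥0 using ht
    refine (integral_mul_of_isBrownianReal hB.forward s t).trans ?_
    grind
  · exact hB.integral_mul_of_nonneg_of_nonpos hs ht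
  · rw [bmCov_comm, ← hB.integral_mul_of_nonneg_of_nonpos ht hs]
    simp only [mul_comm]
  · rw [bmCov, abs_of_nonpos hs, abs_of_nonpos ht]
    obtain ⟨u, rfl⟩ := exists_neg_coe_of_nonpos hs
    obtain ⟨v, rfl⟩ := exists_neg_coe_of_nonpos ht
    refine (integral_mul_of_isBrownianReal hB.backward u v).trans ?_
    grind

/-- The correlation matrix of the drivers. -/
def driverCorr (ρ : ℝ) (j k : Fin 2) : ℝ := if j = k then 1 else ρ

variable [IsProbabilityMeasure P] {ρ : ℝ} {B : Fin 2 → ℝ → Ω → ℝ}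

omit [IsProbabilityMeasure P] in
lemma memLp_driver (hB : ∀ j, IsTwoSidedBM (B j) P) (j : Fin 2) (t : ℝ) :
    MemLp (driver ρ B j t) 2 P := by
  fin_cases j
  · exact (hB 0).memLp t
  · exact (((hB 0).memLp t).const_mul ρ).add (((hB 1).memLp t).const_mul √(1 - ρ ^ 2))

lemma integral_driver (hB : ∀ j, IsTwoSidedBM (B j) P) (j : Fin 2) (t : ℝ) :
    ∫ ω, driver ρ B j t ω ∂P = 0 := by
  fin_cases j
  · exact (hB 0).integral_eq_zero t
  · have h0 := (((hB 0).memLp t).const_mul ρ).integrable one_le_two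
    have h1 := (((hB 1).memLp t).const_mul √(1 - ρ ^ 2)).integrable one_le_two
    change ∫ ω, (ρ * B 0 t ω + √(1 - ρ ^ 2) * B 1 t ω) ∂P = 0
    rw [integral_add h0 h1, integral_const_mul, integral_const_mul, (hB 0).integral_eq_zero,
      (hB 1).integral_eq_zero]
    simp

lemma integral_driver_mul (hB : ∀ j, IsTwoSidedBM (B j) P) (hρ : |ρ| ≤ 1)
    (hind : IndepFun (fun (ω : Ω) (t : ℝ) => B 0 t ω) (fun (ω : Ω) (t : ℝ) => B 1 t ω) P)
    (j k : Fin 2) (s t : ℝ) :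
    ∫ ω, driver ρ B j s ω * driver ρ B k t ω ∂P = driverCorr ρ j k * bmCov s t := by
  have hcross : ∀ s t, ∫ ω, B 0 s ω * B 1 t ω ∂P = 0 := by
    intro s t
    have h1 : IndepFun (B 0 s) (B 1 t) P :=
      hind.comp (measurable_pi_apply s) (measurable_pi_apply t)
    rw [h1.integral_fun_mul_eq_mul_integral ((hB 0).memLp s).aestronglyMeasurable
      ((hB 1).memLp t).aestronglyMeasurable, (hB 0).integral_eq_zero, zero_mul]
  have h00 : ∀ s t, Integrable (fun ω => B 0 s ω * B 0 t ω) P := fun s t =>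
    ((hB 0).memLp s).integrable_mul ((hB 0).memLp t)
  have h01 : ∀ s t, Integrable (fun ω => B 0 s ω * B 1 t ω) P := fun s t =>
    ((hB 0).memLp s).integrable_mul ((hB 1).memLp t)
  have h11 : ∀ s t, Integrable (fun ω => B 1 s ω * B 1 t ω) P := fun s t =>
    ((hB 1).memLp s).integrable_mul ((hB 1).memLp t)
  have e01 : ∀ s t, ∫ ω, B 0 s ω * (ρ * B 0 t ω + √(1 - ρ ^ 2) * B 1 t ω) ∂P = ρ * bmCov s t := by
    intro s t
    have e : (fun ω => B 0 s ω * (ρ * B 0 t ω + √(1 - ρ ^ 2) * B 1 t ω)) =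
        fun ω => ρ * (B 0 s ω * B 0 t ω) + √(1 - ρ ^ 2) * (B 0 s ω * B 1 t ω) := by
      funext ω
      ring
    rw [e, integral_add ((h00 s t).const_mul _) ((h01 s t).const_mul _), integral_const_mul,
      integral_const_mul, (hB 0).integral_mul, hcross]
    ring
  fin_cases j <;> fin_cases k
  · change ∫ ω, B 0 s ω * B 0 t ω ∂P = _
    rw [(hB 0).integral_mul]
    simp [driverCorr]
  · change ∫ ω, B 0 s ω * (ρ * B 0 t ω + √(1 - ρ ^ 2) * B 1 t ω) ∂P = _
    rw [e01]
    simp [driverCorr]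
  · change ∫ ω, (ρ * B 0 s ω + √(1 - ρ ^ 2) * B 1 s ω) * B 0 t ω ∂P = _
    simp only [mul_comm _ (B 0 t _)]
    rw [e01, bmCov_comm]
    simp [driverCorr]
  · change ∫ ω, (ρ * B 0 s ω + √(1 - ρ ^ 2) * B 1 s ω) *
      (ρ * B 0 t ω + √(1 - ρ ^ 2) * B 1 t ω) ∂P = _
    have e : (fun ω => (ρ * B 0 s ω + √(1 - ρ ^ 2) * B 1 s ω) *
        (ρ * B 0 t ω + √(1 - ρ ^ 2) * B 1 t ω)) = fun ω =>
        (ρ ^ 2 * (B 0 s ω * B 0 t ω) + ρ * √(1 - ρ ^ 2) * (B 0 s ω * B 1 t ω)) +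
        (ρ * √(1 - ρ ^ 2) * (B 0 t ω * B 1 s ω) +
          √(1 - ρ ^ 2) ^ 2 * (B 1 s ω * B 1 t ω)) := by
      funext ω
      ring
    have i₁ : Integrable (fun ω => ρ ^ 2 * (B 0 s ω * B 0 t ω) +
        ρ * √(1 - ρ ^ 2) * (B 0 s ω * B 1 t ω)) P :=
      ((h00 s t).const_mul _).add ((h01 s t).const_mul _)
    have i₂ : Integrable (fun ω => ρ * √(1 - ρ ^ 2) * (B 0 t ω * B 1 s ω) +
        √(1 - ρ ^ 2) ^ 2 * (B 1 s ω * B 1 t ω)) P :=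
      ((h01 t s).const_mul _).add ((h11 s t).const_mul _)
    have hsq : √(1 - ρ ^ 2) ^ 2 = 1 - ρ ^ 2 :=
      Real.sq_sqrt (by rw [sub_nonneg]; exact (sq_le_one_iff_abs_le_one ρ).2 hρ)
    rw [e, integral_add i₁ i₂, integral_add ((h00 s t).const_mul _) ((h01 s t).const_mul _),
      integral_add ((h01 t s).const_mul _) ((h11 s t).const_mul _), integral_const_mul,
      integral_const_mul, integral_const_mul, integral_const_mul, (hB 0).integral_mul,
      (hB 1).integral_mul, hcross, hcross, hsq]
    simp only [driverCorr, if_true]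
    ring

omit [IsProbabilityMeasure P] in
lemma StepData.memLp_integral {W : ℝ → Ω → ℝ} (hW : ∀ t, MemLp (W t) 2 P) (s : StepData) :
    MemLp (s.integral W) 2 P := by
  have : s.integral W = fun ω => ∑ i, s.c i * (W (s.b i) ω - W (s.a i) ω) := rfl
  rw [this]
  exact memLp_finsetSum _ fun i _ => ((hW _).sub (hW _)).const_mul _

lemma memLp_indicator_Ioc (a b : ℝ) :
    MemLp ((Set.Ioc a b).indicator fun _ => (1 : ℝ)) 2 volume :=
  memLp_indicator_const 2 measurableSet_Ioc 1 (Or.inr (by simp))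

lemma StepData.memLp_toFun (s : StepData) : MemLp s.toFun 2 volume := by
  have : s.toFun = fun x =>
    ∑ i, s.c i * (Set.Ioc (s.a i) (s.b i)).indicator (fun _ => (1 : ℝ)) x := rfl
  rw [this]
  exact memLp_finsetSum _ fun i _ => (memLp_indicator_Ioc _ _).const_mul _

lemma StepData.integral_integral_eq_zero {W : ℝ → Ω → ℝ} (hW : ∀ t, MemLp (W t) 2 P)
    (h0 : ∀ t, ∫ ω, W t ω ∂P = 0) (s : StepData) : ∫ ω, s.integral W ω ∂P = 0 := by
  have hi : ∀ t, Integrable (W t) P := fun t => (hW t).integrable one_le_two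
  have hd : ∀ i, Integrable (fun ω => s.c i * (W (s.b i) ω - W (s.a i) ω)) P := fun i =>
    ((hi _).sub (hi _)).const_mul _
  simp only [StepData.integral]
  rw [integral_finsetSum _ fun i _ => hd i]
  refine Finset.sum_eq_zero fun i _ => ?_
  rw [integral_const_mul, integral_sub (hi _) (hi _), h0, h0]
  simp

-- The isometry for step functions, polarized to two integrators whose covariance is `r` times the
-- Brownian one; bilinearity reduces it to pairs of intervals.
omit [IsProbabilityMeasure P] in
lemma StepData.integral_mul {W W' : ℝ → Ω → ℝ} (hW : ∀ t, MemLp (W t) 2 P)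
    (hW' : ∀ t, MemLp (W' t) 2 P) {r : ℝ}
    (h : ∀ s t, ∫ ω, W s ω * W' t ω ∂P = r * bmCov s t) (s s' : StepData) :
    ∫ ω, s.integral W ω * s'.integral W' ω ∂P = r * ∫ x, s.toFun x * s'.toFun x := by
  have hi : ∀ u v, Integrable (fun ω => W u ω * W' v ω) P := fun u v =>
    (hW u).integrable_mul (hW' v)
  have hm : ∀ i k, Integrable (fun ω => s.c i * (W (s.b i) ω - W (s.a i) ω) *
      (s'.c k * (W' (s'.b k) ω - W' (s'.a k) ω))) P := fun i k =>
    (((hW _).sub (hW _)).const_mul _).integrable_mul (((hW' _).sub (hW' _)).const_mul _)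
  have hm' : ∀ i k, Integrable (fun x =>
      s.c i * (Set.Ioc (s.a i) (s.b i)).indicator (fun _ => (1 : ℝ)) x *
      (s'.c k * (Set.Ioc (s'.a k) (s'.b k)).indicator (fun _ => (1 : ℝ)) x)) := fun i k =>
    ((memLp_indicator_Ioc _ _).const_mul _).integrable_mul
      ((memLp_indicator_Ioc _ _).const_mul _)
  simp only [StepData.integral, StepData.toFun, Finset.sum_mul_sum]
  rw [integral_finsetSum _ fun i _ => integrable_finsetSum _ fun k _ => hm i k,
    integral_finsetSum _ fun i _ => integrable_finsetSum _ fun k _ => hm' i k,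
    Finset.mul_sum]
  refine Finset.sum_congr rfl fun i _ => ?_
  rw [integral_finsetSum _ fun k _ => hm i k, integral_finsetSum _ fun k _ => hm' i k,
    Finset.mul_sum]
  refine Finset.sum_congr rfl fun k _ => ?_
  have e1 : (fun ω => s.c i * (W (s.b i) ω - W (s.a i) ω) *
      (s'.c k * (W' (s'.b k) ω - W' (s'.a k) ω))) = fun ω => s.c i * s'.c k *
      ((W (s.b i) ω * W' (s'.b k) ω - W (s.b i) ω * W' (s'.a k) ω) -
        (W (s.a i) ω * W' (s'.b k) ω - W (s.a i) ω * W' (s'.a k) ω)) := by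
    funext ω
    ring
  have e2 : (fun x => s.c i * (Set.Ioc (s.a i) (s.b i)).indicator (fun _ => (1 : ℝ)) x *
      (s'.c k * (Set.Ioc (s'.a k) (s'.b k)).indicator (fun _ => (1 : ℝ)) x)) = fun x =>
      s.c i * s'.c k * ((Set.Ioc (s.a i) (s.b i)).indicator (fun _ => (1 : ℝ)) x *
      (Set.Ioc (s'.a k) (s'.b k)).indicator (fun _ => (1 : ℝ)) x) := by
    funext x
    ring
  have i₁ : ∀ u v v', Integrable (fun ω => W u ω * W' v ω - W u ω * W' v' ω) P :=
    fun u v v' => (hi u v).sub (hi u v')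
  rw [e1, e2, integral_const_mul, integral_const_mul, integral_sub (i₁ _ _ _) (i₁ _ _ _),
    integral_sub (hi _ _) (hi _ _), integral_sub (hi _ _) (hi _ _),
    integral_indicator_mul_indicator (s.le i) (s'.le k), h, h, h, h]
  ring

lemma IsWienerIntegral.integral_eq_zero {W : ℝ → Ω → ℝ} (hW : ∀ t, MemLp (W t) 2 P)
    (h0 : ∀ t, ∫ ω, W t ω ∂P = 0) {f : ℝ → ℝ} {X : Ω → ℝ} (hX : IsWienerIntegral W f X P) :
    ∫ ω, X ω ∂P = 0 := by
  obtain ⟨-, hX2, s, -, hs⟩ := hX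
  have h := tendsto_integral_mul_of_tendsto_eLpNorm (v := fun _ _ => 1) (g := fun _ => 1)
    (fun m => (s m).memLp_integral hW) (fun _ => memLp_const 1) hX2 (memLp_const 1) hs
    (by simp)
  simp only [mul_one, StepData.integral_integral_eq_zero hW h0] at h
  exact tendsto_nhds_unique h tendsto_const_nhds

-- Both sides are inner products of `L²` limits, so the identity for step functions passes to the
-- limit.
omit [IsProbabilityMeasure P] in
lemma IsWienerIntegral.integral_mul {W W' : ℝ → Ω → ℝ} (hW : ∀ t, MemLp (W t) 2 P)
    (hW' : ∀ t, MemLp (W' t) 2 P) {r : ℝ}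
    (h : ∀ s t, ∫ ω, W s ω * W' t ω ∂P = r * bmCov s t) {f f' : ℝ → ℝ} {X X' : Ω → ℝ}
    (hX : IsWienerIntegral W f X P) (hX' : IsWienerIntegral W' f' X' P) :
    ∫ ω, X ω * X' ω ∂P = r * ∫ x, f x * f' x := by
  obtain ⟨hf, hX2, s, hsf, hs⟩ := hX
  obtain ⟨hf', hX2', s', hsf', hs'⟩ := hX'
  have h1 := tendsto_integral_mul_of_tendsto_eLpNorm (fun m => (s m).memLp_integral hW)
    (fun m => (s' m).memLp_integral hW') hX2 hX2' hs hs'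
  have h2 := tendsto_integral_mul_of_tendsto_eLpNorm (fun m => (s m).memLp_toFun)
    (fun m => (s' m).memLp_toFun) hf hf' hsf hsf'
  simp only [StepData.integral_mul hW hW' h] at h1
  exact tendsto_nhds_unique h1 (h2.const_mul r)

end Moments

/-! ### The spectral integral of `1 - cos` -/

lemma integral_Ioi_swap_of_nonneg {f : ℝ → ℝ → ℝ} (hm : Measurable (Function.uncurry f))
    (h0 : ∀ x, 0 < x → ∀ y, 0 < y → 0 ≤ f x y)
    (h1 : ∀ x, 0 < x → IntegrableOn (f x) (Set.Ioi 0))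
    (h2 : IntegrableOn (fun x => ∫ y in Set.Ioi 0, f x y) (Set.Ioi 0)) :
    ∫ x in Set.Ioi 0, ∫ y in Set.Ioi 0, f x y = ∫ y in Set.Ioi 0, ∫ x in Set.Ioi 0, f x y := by
  refine integral_integral_swap ((integrable_prod_iff hm.aestronglyMeasurable).2 ⟨?_, ?_⟩)
  · filter_upwards [ae_restrict_mem measurableSet_Ioi] with x hx using h1 x hx
  · refine h2.congr_fun (fun x hx => ?_) measurableSet_Ioi
    refine setIntegral_congr_fun measurableSet_Ioi fun y hy => ?_
    exact (Real.norm_of_nonneg (h0 x hx y hy)).symm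

/-- Write `1/(1+t²)` as `∫ e^{-(1+t²)u} du` and swap: a Gaussian moment gives `Γ(s/2)`, the
`u`-integral gives `Γ(1 - s/2)`, and the reflection formula finishes. -/
lemma integral_rpow_div_one_add_sq {s : ℝ} (hs : 0 < s) (hs2 : s < 2) :
    ∫ t in Set.Ioi (0 : ℝ), t ^ (s - 1) / (1 + t ^ 2) = Real.pi / (2 * Real.sin (Real.pi * s / 2)) := by
  have hG : 0 < Real.Gamma (s / 2) := Real.Gamma_pos_of_pos (by linarith)
  have e1 : ∀ u : ℝ, 0 < u → ∫ t in Set.Ioi (0 : ℝ), t ^ (s - 1) * Real.exp (-u * t ^ (2 : ℝ)) =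
      u ^ (-(s / 2)) * (1 / 2) * Real.Gamma (s / 2) := by
    intro u hu
    rw [integral_rpow_mul_exp_neg_mul_rpow (by norm_num) (by linarith) hu]
    ring_nf
  have i1 : ∀ u : ℝ, 0 < u →
      IntegrableOn (fun t : ℝ => t ^ (s - 1) * Real.exp (-u * t ^ (2 : ℝ))) (Set.Ioi 0) := by
    intro u hu
    -- A non-integrable function has integral `0` by convention, so a nonzero value certifies
    -- integrability.
    refine Integrable.of_integral_ne_zero ?_
    rw [e1 u hu]
    positivity
  have e2 : ∀ t : ℝ, ∫ u in Set.Ioi (0 : ℝ),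
      t ^ (s - 1) * Real.exp (-u * t ^ (2 : ℝ)) * Real.exp (-u) = t ^ (s - 1) / (1 + t ^ 2) := by
    intro t
    have h := integral_exp_mul_Ioi (a := -(1 + t ^ 2)) (by nlinarith [sq_nonneg t]) 0
    have e : (fun u : ℝ => t ^ (s - 1) * Real.exp (-u * t ^ (2 : ℝ)) * Real.exp (-u)) =
        fun u => t ^ (s - 1) * Real.exp (-(1 + t ^ 2) * u) := by
      funext u
      rw [mul_assoc, ← Real.exp_add, Real.rpow_two]
      ring_nf
    rw [e, integral_const_mul, h]
    simp only [mul_zero, Real.exp_zero, neg_div_neg_eq]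
    ring
  have e3 : ∀ u ∈ Set.Ioi (0 : ℝ), ∫ t in Set.Ioi (0 : ℝ),
      t ^ (s - 1) * Real.exp (-u * t ^ (2 : ℝ)) * Real.exp (-u) =
      (1 / 2 * Real.Gamma (s / 2)) * (Real.exp (-u) * u ^ (1 - s / 2 - 1)) := by
    intro u hu
    rw [integral_mul_const, e1 u hu]
    ring_nf
  have hc : IntegrableOn (fun u : ℝ => (1 / 2 * Real.Gamma (s / 2)) *
      (Real.exp (-u) * u ^ (1 - s / 2 - 1))) (Set.Ioi 0) :=
    (Real.GammaIntegral_convergent (by linarith)).const_mul _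
  have hswap := integral_Ioi_swap_of_nonneg
    (f := fun u t => t ^ (s - 1) * Real.exp (-u * t ^ (2 : ℝ)) * Real.exp (-u))
    (by unfold Function.uncurry; fun_prop)
    (fun u _ t ht => by positivity)
    (fun u hu => (i1 u hu).mul_const _)
    (hc.congr_fun (fun u hu => (e3 u hu).symm) measurableSet_Ioi)
  simp only [e2] at hswap
  rw [← hswap, setIntegral_congr_fun measurableSet_Ioi e3, integral_const_mul,
    ← Real.Gamma_eq_integral (by linarith)]
  have h := Real.Gamma_mul_Gamma_one_sub (s / 2)
  rw [mul_assoc, h, mul_div_assoc]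
  field_simp

/-- The spectral density of the increments, before periodization. -/
def fgnPhi (s x : ℝ) : ℝ := (1 - Real.cos x) * |x| ^ (-1 - s)

/-- At the origin `1 - cos x` supplies two powers, leaving `x^{1-s}` with `s < 2`; at infinity `2
x^{-1-s}` needs `s > 0`. -/
lemma integrable_fgnPhi {s : ℝ} (hs : 0 < s) (hs2 : s < 2) : Integrable (fgnPhi s) := by
  have h : IntegrableOn (fun x : ℝ => (1 - Real.cos x) * x ^ (-1 - s)) (Set.Ioi 0) := by
    have hm : Measurable fun x : ℝ => (1 - Real.cos x) * x ^ (-1 - s) := by fun_prop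
    rw [← Set.Ioc_union_Ioi_eq_Ioi (show (0 : ℝ) ≤ 1 by norm_num)]
    refine IntegrableOn.union ?_ ?_
    · have h1 : IntegrableOn (fun x : ℝ => x ^ (1 - s)) (Set.Ioc 0 1) := by
        rw [← intervalIntegrable_iff_integrableOn_Ioc_of_le (by norm_num)]
        exact intervalIntegral.intervalIntegrable_rpow' (by linarith)
      refine Integrable.mono' h1 hm.aestronglyMeasurable ?_
      filter_upwards [ae_restrict_mem measurableSet_Ioc] with x hx
      have hx0 : 0 < x := hx.1
      have h2 : x ^ (1 - s) = x ^ 2 * x ^ (-1 - s) := by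
        rw [← Real.rpow_two, ← Real.rpow_add hx0]
        ring_nf
      have h3 := Real.one_sub_sq_div_two_le_cos (x := x)
      have h4 : 0 ≤ 1 - Real.cos x := by linarith [Real.cos_le_one x]
      rw [norm_mul, Real.norm_of_nonneg h4, Real.norm_of_nonneg (by positivity), h2]
      gcongr
      nlinarith [sq_nonneg x]
    · have h1 : IntegrableOn (fun x : ℝ => 2 * x ^ (-1 - s)) (Set.Ioi 1) :=
        (integrableOn_Ioi_rpow_of_lt (by linarith) one_pos).const_mul 2
      refine Integrable.mono' h1 hm.aestronglyMeasurable ?_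
      filter_upwards [ae_restrict_mem measurableSet_Ioi] with x hx
      have hx0 : 0 < x := one_pos.trans hx
      have h4 : 0 ≤ 1 - Real.cos x := by linarith [Real.cos_le_one x]
      rw [norm_mul, Real.norm_of_nonneg h4, Real.norm_of_nonneg (by positivity)]
      gcongr
      linarith [Real.neg_one_le_cos x]
  refine (integrable_comp_abs h).congr (ae_of_all _ fun x => ?_)
  simp only [fgnPhi, Real.cos_abs]

lemma integral_one_sub_cos_mul_exp {t : ℝ} (ht : 0 < t) :
    ∫ x in Set.Ioi (0 : ℝ), (1 - Real.cos x) * Real.exp (-(x * t)) = 1 / (t * (1 + t ^ 2)) := by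
  have h1 := integral_exp_mul_Ioi (a := -t) (by linarith) 0
  have h1i : IntegrableOn (fun x : ℝ => Real.exp (-t * x)) (Set.Ioi 0) :=
    integrableOn_exp_mul_Ioi (by linarith) 0
  have hre : ((-t : ℂ) + Complex.I).re < 0 := by simpa using ht
  have h2 := integral_exp_mul_complex_Ioi hre 0
  have h2i := integrableOn_exp_mul_complex_Ioi hre 0
  have e : ∀ x : ℝ, (Complex.exp ((-t + Complex.I) * x)).re = Real.exp (-t * x) * Real.cos x := by
    intro x
    rw [Complex.exp_re]
    simp
  have h3 : ∫ x in Set.Ioi (0 : ℝ), Real.exp (-t * x) * Real.cos x = t / (1 + t ^ 2) := by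
    have h4 := integral_re h2i
    simp only [RCLike.re_to_complex, e] at h4
    rw [h4, h2]
    simp only [Complex.ofReal_zero, mul_zero, Complex.exp_zero, Complex.div_re, Complex.normSq_apply,
      Complex.neg_re, Complex.one_re, Complex.add_re, Complex.ofReal_re, Complex.I_re,
      Complex.neg_im, Complex.one_im, Complex.add_im, Complex.ofReal_im, Complex.I_im]
    ring
  have h3i : IntegrableOn (fun x : ℝ => Real.exp (-t * x) * Real.cos x) (Set.Ioi 0) := by
    exact (Integrable.re h2i).congr (ae_of_all _ fun x => e x)
  have e' : (fun x : ℝ => (1 - Real.cos x) * Real.exp (-(x * t))) =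
      fun x => Real.exp (-t * x) - Real.exp (-t * x) * Real.cos x := by
    funext x
    ring_nf
  rw [e', integral_sub h1i h3i, h1, h3]
  simp only [mul_zero, Real.exp_zero, neg_div_neg_eq]
  have : (1 + t ^ 2) ≠ 0 := by positivity
  field_simp
  ring

/-- Write `Γ(s+1) x^{-1-s}` as `∫ t^s e^{-xt} dt` and swap; the Laplace transform of `1 - cos`
reduces the half-line integral to `∫ t^{s-1}/(1+t²) dt`, and evenness doubles it. -/
lemma integral_fgnPhi {s : ℝ} (hs : 0 < s) (hs2 : s < 2) :
    (∫ x, fgnPhi s x) * (Real.Gamma (s + 1) * Real.sin (Real.pi * s / 2)) = Real.pi := by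
  have hG : 0 < Real.Gamma (s + 1) := Real.Gamma_pos_of_pos (by linarith)
  have e1 : ∀ x : ℝ, 0 < x → ∫ t in Set.Ioi (0 : ℝ), t ^ s * Real.exp (-(x * t)) =
      x ^ (-1 - s) * Real.Gamma (s + 1) := by
    intro x hx
    have := Real.integral_rpow_mul_exp_neg_mul_Ioi (a := s + 1) (by linarith) hx
    rw [add_sub_cancel_right] at this
    rw [this, one_div, Real.inv_rpow hx.le, ← Real.rpow_neg hx.le]
    ring_nf
  have i1 : ∀ x : ℝ, 0 < x →
      IntegrableOn (fun t : ℝ => t ^ s * Real.exp (-(x * t))) (Set.Ioi 0) := by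
    intro x hx
    refine Integrable.of_integral_ne_zero ?_
    rw [e1 x hx]
    positivity
  have e3 : ∀ x ∈ Set.Ioi (0 : ℝ), ∫ t in Set.Ioi (0 : ℝ),
      (1 - Real.cos x) * (t ^ s * Real.exp (-(x * t))) = Real.Gamma (s + 1) * fgnPhi s x := by
    intro x hx
    rw [integral_const_mul, e1 x hx, fgnPhi, abs_of_pos (Set.mem_Ioi.1 hx)]
    ring
  have e2 : ∀ t ∈ Set.Ioi (0 : ℝ), ∫ x in Set.Ioi (0 : ℝ),
      (1 - Real.cos x) * (t ^ s * Real.exp (-(x * t))) = t ^ (s - 1) / (1 + t ^ 2) := by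
    intro t ht
    have ht : 0 < t := ht
    have e : (fun x : ℝ => (1 - Real.cos x) * (t ^ s * Real.exp (-(x * t)))) =
        fun x => t ^ s * ((1 - Real.cos x) * Real.exp (-(x * t))) := by
      funext x
      ring
    rw [e, integral_const_mul, integral_one_sub_cos_mul_exp ht, Real.rpow_sub_one ht.ne']
    field_simp
  have hc : IntegrableOn (fun x => Real.Gamma (s + 1) * fgnPhi s x) (Set.Ioi 0) :=
    (integrable_fgnPhi hs hs2).integrableOn.const_mul _
  have hswap := integral_Ioi_swap_of_nonneg
    (f := fun x t => (1 - Real.cos x) * (t ^ s * Real.exp (-(x * t))))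
    (by unfold Function.uncurry; fun_prop)
    (fun x _ t ht => mul_nonneg (by linarith [Real.cos_le_one x]) (by positivity))
    (fun x hx => (i1 x hx).const_mul _)
    (hc.congr_fun (fun x hx => (e3 x hx).symm) measurableSet_Ioi)
  rw [setIntegral_congr_fun measurableSet_Ioi e3, setIntegral_congr_fun measurableSet_Ioi e2,
    integral_const_mul, integral_rpow_div_one_add_sq hs hs2] at hswap
  have h2 : ∫ x, fgnPhi s x = 2 * ∫ x in Set.Ioi (0 : ℝ), fgnPhi s x := by
    rw [← integral_comp_abs]
    simp only [fgnPhi, Real.cos_abs, abs_abs]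
  have hsin : 0 < Real.sin (Real.pi * s / 2) :=
    Real.sin_pos_of_pos_of_lt_pi (by positivity) (by nlinarith [Real.pi_pos])
  rw [h2]
  have h3 : Real.pi / (2 * Real.sin (Real.pi * s / 2)) * (2 * Real.sin (Real.pi * s / 2)) =
      Real.pi := by field_simp
  linear_combination 2 * Real.sin (Real.pi * s / 2) * hswap + h3

/-! ### Second differences of powers as Fourier coefficients -/

/-- The autocovariance function of standard fractional Gaussian noise with exponent `s = 2H`. -/
def fgnCov (s h : ℝ) : ℝ := (|h + 1| ^ s + |h - 1| ^ s - 2 * |h| ^ s) / 2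

lemma integrable_and_integral_one_sub_cos {s : ℝ} (hs : 0 < s) (hs2 : s < 2) (h : ℝ) :
    Integrable (fun x => (1 - Real.cos (h * x)) * |x| ^ (-1 - s)) ∧
      ∫ x, (1 - Real.cos (h * x)) * |x| ^ (-1 - s) = |h| ^ s * ∫ x, fgnPhi s x := by
  rcases eq_or_ne h 0 with rfl | hh
  · simp [Real.zero_rpow hs.ne']
  have h0 : 0 < |h| := abs_pos.2 hh
  have e : (fun x => (1 - Real.cos (h * x)) * |x| ^ (-1 - s)) =
      fun x => |h| ^ (1 + s) * fgnPhi s (h * x) := by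
    funext x
    rw [fgnPhi, abs_mul, Real.mul_rpow h0.le (abs_nonneg x)]
    have : |h| ^ (1 + s) * |h| ^ (-1 - s) = 1 := by
      rw [← Real.rpow_add h0]
      ring_nf
      exact Real.rpow_zero _
    linear_combination -(1 - Real.cos (h * x)) * |x| ^ (-1 - s) * this
  rw [e]
  refine ⟨((integrable_fgnPhi hs hs2).comp_mul_left' hh).const_mul _, ?_⟩
  rw [integral_const_mul, Measure.integral_comp_mul_left, smul_eq_mul, abs_inv,
    Real.rpow_add h0, Real.rpow_one]
  field_simp

/-- `2 cos(hx)(1 - cos x)` is the second difference in `h` of `1 - cos(hx)`, whose integral against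
`|x|^{-1-s}` scales like `|h|^s`. -/
lemma integral_cos_mul_fgnPhi {s : ℝ} (hs : 0 < s) (hs2 : s < 2) (h : ℝ) :
    ∫ x, Real.cos (h * x) * fgnPhi s x = fgnCov s h * ∫ x, fgnPhi s x := by
  obtain ⟨i0, v0⟩ := integrable_and_integral_one_sub_cos hs hs2 h
  obtain ⟨i1, v1⟩ := integrable_and_integral_one_sub_cos hs hs2 (h + 1)
  obtain ⟨i2, v2⟩ := integrable_and_integral_one_sub_cos hs hs2 (h - 1)
  have e : (fun x => Real.cos (h * x) * fgnPhi s x) = fun x =>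
      2⁻¹ * (((1 - Real.cos ((h + 1) * x)) * |x| ^ (-1 - s) +
        (1 - Real.cos ((h - 1) * x)) * |x| ^ (-1 - s)) -
        2 * ((1 - Real.cos (h * x)) * |x| ^ (-1 - s))) := by
    funext x
    have e1 : (h + 1) * x = h * x + x := by ring
    have e2 : (h - 1) * x = h * x - x := by ring
    rw [fgnPhi, e1, e2, Real.cos_add, Real.cos_sub]
    ring
  have i3 : Integrable fun x => (1 - Real.cos ((h + 1) * x)) * |x| ^ (-1 - s) +
        (1 - Real.cos ((h - 1) * x)) * |x| ^ (-1 - s) := i1.add i2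
  rw [e, integral_const_mul, integral_sub i3 (i0.const_mul 2), integral_add i1 i2,
    integral_const_mul, v0, v1, v2, fgnCov]
  ring

lemma integral_exp_mul_fgnPhi {s : ℝ} (hs : 0 < s) (hs2 : s < 2) (h : ℝ) :
    ∫ x : ℝ, Complex.exp (Complex.I * h * x) * (fgnPhi s x : ℂ) =
      ((fgnCov s h * ∫ x, fgnPhi s x : ℝ) : ℂ) := by
  have hodd : ∫ x, Real.sin (h * x) * fgnPhi s x = 0 := by
    have h1 := integral_neg_eq_self (fun x => Real.sin (h * x) * fgnPhi s x) volume
    have e : (fun x => Real.sin (h * -x) * fgnPhi s (-x)) =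
        fun x => -(Real.sin (h * x) * fgnPhi s x) := by
      funext x
      simp [fgnPhi]
    rw [e, integral_neg] at h1
    linarith
  have hi := integrable_fgnPhi hs hs2
  have ic : Integrable fun x => Real.cos (h * x) * fgnPhi s x :=
    hi.bdd_mul (c := 1) (by fun_prop : Continuous fun x => Real.cos (h * x)).aestronglyMeasurable
      (ae_of_all _ fun x => by simpa using Real.abs_cos_le_one (h * x))
  have is : Integrable fun x => Real.sin (h * x) * fgnPhi s x :=
    hi.bdd_mul (c := 1) (by fun_prop : Continuous fun x => Real.sin (h * x)).aestronglyMeasurable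
      (ae_of_all _ fun x => by simpa using Real.abs_sin_le_one (h * x))
  have e : (fun x : ℝ => Complex.exp (Complex.I * h * x) * (fgnPhi s x : ℂ)) = fun x =>
      ((Real.cos (h * x) * fgnPhi s x : ℝ) : ℂ) +
        Complex.I * ((Real.sin (h * x) * fgnPhi s x : ℝ) : ℂ) := by
    funext x
    have : Complex.I * h * x = ((h * x : ℝ) : ℂ) * Complex.I := by
      push_cast
      ring
    rw [this, Complex.exp_mul_I]
    push_cast
    ring
  rw [e, integral_add ic.ofReal (is.ofReal.const_mul _), integral_const_mul,
    integral_complex_ofReal, integral_complex_ofReal, hodd, integral_cos_mul_fgnPhi hs hs2]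
  simp

/-! ### Pointwise convergence of Fourier series -/

section Fourier

variable {E : Type*} [NormedAddCommGroup E] [NormedSpace ℝ E]

lemma setIntegral_Ioc_zsmul (g : ℝ → E) {p : ℝ} (hp : 0 < p) (n : ℤ) :
    ∫ x in Set.Ioc (n • p) ((n + 1) • p), g x = ∫ x in Set.Ioc 0 p, g (x + p * n) := by
  rw [← intervalIntegral.integral_of_le hp.le, ← intervalIntegral.integral_of_le,
    intervalIntegral.integral_comp_add_right]
  · simp only [zsmul_eq_mul]
    push_cast
    ring_nf
  · simp only [zsmul_eq_mul]
    push_cast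
    nlinarith

/-- Folding the line onto one period; it turns Fourier integrals at integer frequencies into Fourier
coefficients. -/
lemma integral_eq_integral_tsum_translates [CompleteSpace E] {F : ℝ → E} (hF : Integrable F) {p : ℝ} (hp : 0 < p) :
    ∫ x, F x = ∫ x in Set.Ioc 0 p, ∑' n : ℤ, F (x + p * n) := by
  have hdisj : Pairwise (Function.onFun Disjoint fun n : ℤ => Set.Ioc (n • p) ((n + 1) • p)) := by
    simpa using Set.pairwise_disjoint_Ioc_add_zsmul (0 : ℝ) p
  have h1 := hasSum_integral_iUnion (μ := volume) (fun n : ℤ => measurableSet_Ioc) hdisj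
    hF.integrableOn
  have h2 := (hasSum_integral_iUnion (μ := volume) (fun n : ℤ => measurableSet_Ioc) hdisj
    hF.norm.integrableOn).summable
  rw [iUnion_Ioc_zsmul hp, setIntegral_univ] at h1
  simp only [setIntegral_Ioc_zsmul _ hp] at h1 h2
  rw [← h1.tsum_eq]
  exact integral_tsum_of_summable_integral_norm
    (fun n => (hF.comp_add_right (p * n)).integrableOn) h2

end Fourier

lemma integral_exp_int_Ioc (h : ℤ) :
    ∫ x in Set.Ioc 0 (2 * Real.pi), Complex.exp (Complex.I * h * x) =
      if h = 0 then 2 * (Real.pi : ℂ) else 0 := by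
  rw [← intervalIntegral.integral_of_le (by positivity)]
  split_ifs with h0
  · simp [h0]
  · have hc : Complex.I * (h : ℂ) ≠ 0 := mul_ne_zero Complex.I_ne_zero (Int.cast_ne_zero.2 h0)
    rw [integral_exp_mul_complex hc]
    have : Complex.I * (h : ℂ) * ((2 * Real.pi : ℝ) : ℂ) = h * (2 * Real.pi * Complex.I) := by
      push_cast
      ring
    rw [this, Complex.exp_int_mul_two_pi_mul_I]
    simp

lemma exp_I_mul_sub_one_ne_zero {θ : ℝ} (h0 : θ ≠ 0) (h1 : |θ| < 2 * Real.pi) :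
    Complex.exp (Complex.I * θ) - 1 ≠ 0 := by
  intro h
  rw [sub_eq_zero, Complex.exp_eq_one_iff] at h
  obtain ⟨n, hn⟩ := h
  have h2 : (θ : ℂ) = ((n * (2 * Real.pi) : ℝ) : ℂ) := by
    apply mul_left_cancel₀ Complex.I_ne_zero
    rw [hn]
    push_cast
    ring
  rw [Complex.ofReal_inj] at h2
  rcases eq_or_ne n 0 with rfl | hn0
  · simp at h2
    exact h0 h2
  · have h3 : (1 : ℝ) ≤ |(n : ℝ)| := by exact_mod_cast Int.one_le_abs hn0
    rw [h2, abs_mul, abs_of_pos (by positivity : 0 < 2 * Real.pi)] at h1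
    nlinarith [Real.pi_pos]

/-- The difference quotient, extended by the derivative at `μ`, is continuous without zeros on the
compact interval `[0, 2π]`, since other zeros of `e^{i(x-μ)} - 1` are at distance at least `2π` from
`μ`. Its minimal norm is `c`. -/
lemma exists_mul_abs_le_norm_exp_sub_one {μ : ℝ} (hμ : 0 < μ) (hμ2 : μ < 2 * Real.pi) :
    ∃ c, 0 < c ∧ ∀ x ∈ Set.Ioc 0 (2 * Real.pi),
      c * |x - μ| ≤ ‖Complex.exp (Complex.I * (x - μ)) - 1‖ := by
  set f : ℝ → ℂ := fun x => Complex.exp (Complex.I * (x - μ)) - 1 with hf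
  have hd : Differentiable ℝ f := by
    have h1 : Differentiable ℝ fun x : ℝ => (x : ℂ) := Complex.ofRealCLM.differentiable
    have h2 : Differentiable ℝ fun x : ℝ => Complex.I * ((x : ℂ) - μ) :=
      (h1.sub_const _).const_mul _
    exact h2.cexp.sub_const 1
  have hder : deriv f μ = Complex.I := by
    have h1 : HasDerivAt (fun x : ℝ => Complex.I * ((x : ℂ) - μ)) (Complex.I * 1) μ :=
      ((Complex.ofRealCLM.hasDerivAt (x := μ)).sub_const (μ : ℂ)).const_mul Complex.I
    have h2 := (h1.cexp.sub_const 1).deriv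
    simpa [hf] using h2
  have hcont : Continuous (dslope f μ) := by
    rw [← continuousOn_univ, continuousOn_dslope univ_mem]
    exact ⟨hd.continuous.continuousOn, hd μ⟩
  have hfμ : f μ = 0 := by simp [hf]
  have hne : ∀ x ∈ Set.Icc 0 (2 * Real.pi), dslope f μ x ≠ 0 := by
    intro x hx
    rcases eq_or_ne x μ with rfl | hxμ
    · rw [dslope_same, hder]
      exact Complex.I_ne_zero
    · rw [dslope_of_ne _ hxμ, slope_def_module, hfμ, sub_zero]
      refine smul_ne_zero (inv_ne_zero (sub_ne_zero.2 hxμ)) ?_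
      have := exp_I_mul_sub_one_ne_zero (θ := x - μ) (sub_ne_zero.2 hxμ)
        (abs_lt.2 ⟨by linarith [hx.1], by linarith [hx.2]⟩)
      simpa [hf] using this
  obtain ⟨x₀, hx₀, hmin⟩ := isCompact_Icc.exists_isMinOn
    (Set.nonempty_Icc.2 (by positivity : (0 : ℝ) ≤ 2 * Real.pi)) hcont.norm.continuousOn
  refine ⟨‖dslope f μ x₀‖, norm_pos_iff.2 (hne x₀ hx₀), fun x hx => ?_⟩
  have h1 : ‖dslope f μ x₀‖ ≤ ‖dslope f μ x‖ := hmin (Set.Ioc_subset_Icc_self hx)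
  have h2 : (x - μ) • dslope f μ x = f x := by
    rw [sub_smul_dslope, hfμ, sub_zero]
  rw [← show f x = Complex.exp (Complex.I * (x - μ)) - 1 from rfl, ← h2, norm_smul,
    Real.norm_eq_abs, mul_comm]
  gcongr

lemma tendsto_integral_exp_int_mul {Q : ℝ → ℂ} (μ : ℝ) {u : ℕ → ℤ}
    (hu : Tendsto (fun N => (u N : ℝ)) atTop (cocompact ℝ)) :
    Tendsto (fun N => ∫ x in Set.Ioc 0 (2 * Real.pi),
      Complex.exp (Complex.I * (u N) * (x - μ)) * Q x) atTop (𝓝 0) := by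
  have h1 := Real.tendsto_integral_exp_smul_cocompact
    ((Set.Ioc 0 (2 * Real.pi)).indicator Q)
  -- The Riemann–Lebesgue lemma uses the character `e^{-2πivw}`; taking `w = -u/(2π)` produces
  -- `e^{iuv}`.
  have hne : -(2 * Real.pi)⁻¹ ≠ 0 := neg_ne_zero.2 (inv_ne_zero (by positivity))
  have h2 : Tendsto (fun N => (u N : ℝ) * -(2 * Real.pi)⁻¹) atTop (cocompact ℝ) :=
    (Homeomorph.mulRight₀ _ hne).isClosedEmbedding.tendsto_cocompact.comp hu
  have h3 := h1.comp h2
  rw [tendsto_zero_iff_norm_tendsto_zero] at h3 ⊢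
  refine h3.congr fun N => ?_
  have e : (fun v : ℝ => Real.fourierChar (-(v * ((u N : ℝ) * -(2 * Real.pi)⁻¹))) •
      (Set.Ioc 0 (2 * Real.pi)).indicator Q v) = (Set.Ioc 0 (2 * Real.pi)).indicator
      fun v => Complex.exp (Complex.I * (u N) * v) * Q v := by
    funext v
    by_cases hv : v ∈ Set.Ioc 0 (2 * Real.pi)
    · rw [Set.indicator_of_mem hv, Set.indicator_of_mem hv, Circle.smul_def, Real.fourierChar_apply,
        smul_eq_mul]
      congr 2
      push_cast
      field_simp
    · simp [Set.indicator_of_notMem hv]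
  have e2 : (fun x : ℝ => Complex.exp (Complex.I * (u N) * (x - μ)) * Q x) = fun x : ℝ =>
      Complex.exp (((-(u N * μ) : ℝ) : ℂ) * Complex.I) * (Complex.exp (Complex.I * (u N) * x) * Q x) := by
    funext x
    rw [← mul_assoc, ← Complex.exp_add]
    congr 2
    push_cast
    ring
  rw [Function.comp, e, integral_indicator measurableSet_Ioc, e2, integral_const_mul, norm_mul,
    Complex.norm_exp_ofReal_mul_I, one_mul]

/-- A Fourier series converges at every point of Lipschitz continuity. -/
theorem tendsto_symmetric_fourier_sum {G : ℝ → ℂ} {μ : ℝ} (hμ : 0 < μ) (hμ2 : μ < 2 * Real.pi)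
    (hG : IntegrableOn G (Set.Ioc 0 (2 * Real.pi))) {C δ : ℝ} (hδ : 0 < δ) (hC : 0 ≤ C)
    (hLip : ∀ x, |x - μ| < δ → ‖G x - G μ‖ ≤ C * |x - μ|) :
    Tendsto (fun N : ℕ => ∑ h ∈ Finset.Icc (-(N : ℤ)) N,
      (∫ x in Set.Ioc 0 (2 * Real.pi), Complex.exp (Complex.I * h * x) * G x) *
        Complex.exp (-Complex.I * μ * h)) atTop (𝓝 (2 * Real.pi * G μ)) := by
  obtain ⟨c, hc, hcb⟩ := exists_mul_abs_le_norm_exp_sub_one hμ hμ2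
  set S := Set.Ioc 0 (2 * Real.pi) with hS
  -- Dividing by `e^{i(x-μ)} - 1` makes the partial sums telescope, so no Dirichlet kernel is
  -- needed. The Lipschitz bound at `μ` is what makes `Q` integrable: near `μ` it is bounded by
  -- `C/c`, farther away the denominator is at least `cδ`.
  set Q : ℝ → ℂ := fun x => (G x - G μ) / (Complex.exp (Complex.I * (x - μ)) - 1) with hQ
  have hexp : Continuous fun x : ℝ => Complex.exp (Complex.I * (x - μ)) - 1 := by fun_prop
  have hSfin : volume S ≠ ∞ := measure_Ioc_lt_top.ne
  have hconst : IntegrableOn (fun _ : ℝ => G μ) S := integrableOn_const hSfin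
  have hQi : IntegrableOn Q S := by
    have hb : IntegrableOn (fun x => C / c + (‖G x‖ + ‖G μ‖) / (c * δ)) S :=
      (integrableOn_const hSfin).add ((hG.norm.add hconst.norm).div_const _)
    refine Integrable.mono' hb ((hG.sub hconst).aestronglyMeasurable.div₀
      hexp.aestronglyMeasurable) ?_
    filter_upwards [ae_restrict_mem measurableSet_Ioc] with x hx
    have hx' := hcb x hx
    have hnn : 0 ≤ (‖G x‖ + ‖G μ‖) / (c * δ) := by positivity
    have hnn' : 0 ≤ C / c := by positivity
    rw [hQ]
    simp only [norm_div]
    rcases eq_or_ne x μ with rfl | hxμ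
    · simp only [sub_self, norm_zero, zero_div]
      positivity
    have hpos : 0 < |x - μ| := abs_pos.2 (sub_ne_zero.2 hxμ)
    have hpos2 : 0 < ‖Complex.exp (Complex.I * (x - μ)) - 1‖ :=
      (mul_pos hc hpos).trans_le hx'
    by_cases hd : |x - μ| < δ
    · have : ‖G x - G μ‖ / ‖Complex.exp (Complex.I * (x - μ)) - 1‖ ≤ C / c := by
        rw [div_le_div_iff₀ hpos2 hc]
        calc ‖G x - G μ‖ * c ≤ C * |x - μ| * c := by gcongr; exact hLip x hd
          _ = C * (c * |x - μ|) := by ring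
          _ ≤ _ := by gcongr
      linarith
    · push Not at hd
      have : ‖G x - G μ‖ / ‖Complex.exp (Complex.I * (x - μ)) - 1‖ ≤
          (‖G x‖ + ‖G μ‖) / (c * δ) := by
        gcongr
        · exact norm_sub_le _ _
        · exact (mul_le_mul_of_nonneg_left hd hc.le).trans hx'
      linarith
  set q : ℤ → ℂ := fun m => ∫ x in S, Complex.exp (Complex.I * m * (x - μ)) * Q x with hq
  have hbdd : ∀ (m : ℤ) (F : ℝ → ℂ) (ν : ℝ), IntegrableOn F S →
      IntegrableOn (fun x : ℝ => Complex.exp (Complex.I * m * (x - ν)) * F x) S := by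
    intro m F ν hF
    refine Integrable.bdd_mul (c := 1) hF
      (by fun_prop : Continuous fun x : ℝ =>
        Complex.exp (Complex.I * m * (x - ν))).aestronglyMeasurable (ae_of_all _ fun x => ?_)
    have : Complex.I * m * ((x : ℂ) - ν) = ((m * (x - ν) : ℝ) : ℂ) * Complex.I := by
      push_cast
      ring
    rw [this, Complex.norm_exp_ofReal_mul_I]
  -- From `G = G(μ) + (e^{i(x-μ)} - 1) Q`: multiplying by the exponential shifts the frequency of
  -- `Q` by one, and the constant contributes only at `h = 0`.
  have hterm : ∀ h : ℤ, (∫ x in S, Complex.exp (Complex.I * h * x) * G x) *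
      Complex.exp (-Complex.I * μ * h) =
      (q (h + 1) - q h) + if h = 0 then 2 * Real.pi * G μ else 0 := by
    intro h
    have e1 : ∀ᵐ x : ℝ ∂(volume.restrict S), Complex.exp (Complex.I * h * x) * G x *
        Complex.exp (-Complex.I * μ * h) =
        (Complex.exp (Complex.I * (h + 1 : ℤ) * (x - μ)) * Q x -
          Complex.exp (Complex.I * h * (x - μ)) * Q x) +
        Complex.exp (Complex.I * h * x) * (Complex.exp (-Complex.I * μ * h) * G μ) := by
      have hneμ : ∀ᵐ x : ℝ ∂(volume.restrict S), x ≠ μ :=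
        ae_restrict_of_ae (by simp [ae_iff, measure_singleton])
      filter_upwards [hneμ, ae_restrict_mem measurableSet_Ioc] with x hxμ hx
      have hne := exp_I_mul_sub_one_ne_zero (θ := x - μ) (sub_ne_zero.2 hxμ)
        (abs_lt.2 ⟨by linarith [hx.1], by linarith [hx.2]⟩)
      push_cast at hne
      have h1 : Complex.exp (Complex.I * (h + 1 : ℤ) * (x - μ)) =
          Complex.exp (Complex.I * h * (x - μ)) * Complex.exp (Complex.I * (x - μ)) := by
        rw [← Complex.exp_add]
        congr 1
        push_cast
        ring
      have h2 : Complex.exp (Complex.I * h * (x - μ)) =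
          Complex.exp (Complex.I * h * x) * Complex.exp (-Complex.I * μ * h) := by
        rw [← Complex.exp_add]
        congr 1
        ring
      have h3 : (Complex.exp (Complex.I * (x - μ)) - 1) * Q x = G x - G μ := by
        rw [hQ]
        field_simp
      rw [h1, h2]
      linear_combination -(Complex.exp (Complex.I * h * x) * Complex.exp (-Complex.I * μ * h)) * h3
    have i1 : IntegrableOn (fun x : ℝ => Complex.exp (Complex.I * (h + 1 : ℤ) * (x - μ)) * Q x -
        Complex.exp (Complex.I * h * (x - μ)) * Q x) S :=
      (hbdd (h + 1) Q μ hQi).sub (hbdd h Q μ hQi)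
    have i2 : IntegrableOn (fun x : ℝ => Complex.exp (Complex.I * h * x) *
        (Complex.exp (-Complex.I * μ * h) * G μ)) S := by
      have := hbdd h (fun _ => Complex.exp (-Complex.I * μ * h) * G μ) 0
        (integrableOn_const hSfin)
      simpa using this
    rw [← integral_mul_const, integral_congr_ae e1, integral_add i1 i2,
      integral_sub (hbdd (h + 1) Q μ hQi) (hbdd h Q μ hQi), integral_mul_const, hS,
      integral_exp_int_Ioc]
    split_ifs with h0
    · simp [h0, hq, hS]
    · simp [hq, hS]
  have hsum : ∀ N : ℕ, ∑ h ∈ Finset.Icc (-(N : ℤ)) N,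
      (∫ x in S, Complex.exp (Complex.I * h * x) * G x) * Complex.exp (-Complex.I * μ * h) =
      q ((N + 1 : ℕ) : ℤ) - q (-(N : ℤ)) + 2 * Real.pi * G μ := by
    intro N
    simp only [hterm, Finset.sum_add_distrib]
    rw [Finset.sum_ite_eq' _ (0 : ℤ), if_pos (by simp)]
    congr 1
    induction N with
    | zero => simp
    | succ k ih =>
      have h1 : Finset.Icc (-((k + 1 : ℕ) : ℤ)) ((k + 1 : ℕ) : ℤ) =
          insert (((k + 1 : ℕ) : ℤ)) (insert (-((k + 1 : ℕ) : ℤ)) (Finset.Icc (-(k : ℤ)) k)) := by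
        ext m
        simp only [Finset.mem_Icc, Finset.mem_insert]
        push_cast
        omega
      rw [h1, Finset.sum_insert, Finset.sum_insert, ih]
      · push_cast
        have h2 : -((k : ℤ) + 1) + 1 = -(k : ℤ) := by ring
        rw [h2]
        ring
      · simp
      · simp only [Finset.mem_Icc, Finset.mem_insert]
        push_cast
        omega
  simp only [hsum]
  have t1 : Tendsto (fun N : ℕ => q ((N + 1 : ℕ) : ℤ)) atTop (𝓝 0) := by
    refine tendsto_integral_exp_int_mul μ (u := fun N => ((N + 1 : ℕ) : ℤ)) ?_
    rw [cocompact_eq_atBot_atTop]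
    refine Tendsto.mono_right ?_ le_sup_right
    have := (tendsto_natCast_atTop_atTop (R := ℝ)).comp (tendsto_add_atTop_nat 1)
    simpa [Function.comp_def] using this
  have t2 : Tendsto (fun N : ℕ => q (-(N : ℤ))) atTop (𝓝 0) := by
    refine tendsto_integral_exp_int_mul μ (u := fun N => -(N : ℤ)) ?_
    rw [cocompact_eq_atBot_atTop]
    refine Tendsto.mono_right ?_ le_sup_left
    exact (tendsto_neg_atTop_atBot.comp (tendsto_natCast_atTop_atTop (R := ℝ))).congr
      fun N => by simp
  simpa using (t1.sub t2).add_const (2 * Real.pi * G μ)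

/-! ### The spectral density of fractional Gaussian noise -/

/-- The periodized power `∑ₙ |x + 2πn| ^ (-1 - s)`. -/
def periodicPow (s x : ℝ) : ℝ := ∑' n : ℤ, |x + 2 * Real.pi * n| ^ (-1 - s)

/-- `|1 - e^{-iμ}|² ∑ₙ |μ + 2πn| ^ (-1 - s)`. -/
def fgnDensity (s μ : ℝ) : ℝ :=
  ‖1 - Complex.exp (-Complex.I * μ)‖ ^ 2 * periodicPow s μ

lemma norm_one_sub_exp_sq (μ : ℝ) :
    ‖1 - Complex.exp (-Complex.I * μ)‖ ^ 2 = 2 * (1 - Real.cos μ) := by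
  have h : -Complex.I * (μ : ℂ) = ((-μ : ℝ) : ℂ) * Complex.I := by
    push_cast
    ring
  rw [Complex.sq_norm, Complex.normSq_apply, h, Complex.sub_re, Complex.sub_im,
    Complex.exp_ofReal_mul_I_re, Complex.exp_ofReal_mul_I_im]
  simp only [Complex.one_re, Complex.one_im, Real.cos_neg, Real.sin_neg]
  nlinarith [Real.sin_sq_add_cos_sq μ]

lemma summable_periodicPow {s : ℝ} (hs : 0 < s) (x : ℝ) :
    Summable fun n : ℤ => |x + 2 * Real.pi * n| ^ (-1 - s) := by
  have h := ((Real.summable_one_div_int_add_rpow (x / (2 * Real.pi)) (1 + s)).2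
    (by linarith)).mul_left ((2 * Real.pi) ^ (-1 - s))
  refine h.congr fun n => ?_
  have e : x + 2 * Real.pi * n = 2 * Real.pi * (n + x / (2 * Real.pi)) := by
    field_simp
    ring
  have e2 : -1 - s = -(1 + s) := by ring
  rw [e, abs_mul, abs_of_pos (by positivity : 0 < 2 * Real.pi),
    Real.mul_rpow (by positivity) (abs_nonneg _), e2, Real.rpow_neg (abs_nonneg _), one_div]

lemma periodicPow_add_int_mul (s x : ℝ) (k : ℤ) :
    periodicPow s (x + 2 * Real.pi * k) = periodicPow s x := by
  rw [periodicPow, periodicPow,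
    ← (Equiv.addRight k).tsum_eq fun n : ℤ => |x + 2 * Real.pi * n| ^ (-1 - s)]
  refine tsum_congr fun n => ?_
  simp only [Equiv.coe_addRight]
  push_cast
  ring_nf

lemma fgnDensity_add_int_mul (s x : ℝ) (k : ℤ) :
    fgnDensity s (x + 2 * Real.pi * k) = fgnDensity s x := by
  rw [fgnDensity, fgnDensity, norm_one_sub_exp_sq, norm_one_sub_exp_sq, periodicPow_add_int_mul,
    mul_comm (2 * Real.pi), Real.cos_add_int_mul_two_pi]

lemma convexOn_rpow_of_neg {p : ℝ} (hp : p < 0) :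
    ConvexOn ℝ (Set.Ioi 0) fun x : ℝ => x ^ p := by
  have h1 : ConvexOn ℝ (Set.Ioi 0) fun x : ℝ => (-p) • (-Real.log) x :=
    (strictConcaveOn_log_Ioi.concaveOn.neg).smul (by linarith)
  have h2 : ConvexOn ℝ (Set.Ioi 0) (Real.exp ∘ fun x : ℝ => (-p) • (-Real.log) x) := by
    refine ConvexOn.comp (convexOn_exp.subset (Set.subset_univ _) ?_) h1
      (Real.exp_monotone.monotoneOn _)
    have : IsPreconnected ((fun x : ℝ => (-p) • (-Real.log) x) '' Set.Ioi 0) :=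
      isPreconnected_Ioi.image _
        (((Real.continuousOn_log.mono fun x hx => (Set.mem_Ioi.1 hx).ne').neg).const_smul (-p))
    exact this.ordConnected.convex
  refine h2.congr fun x hx => ?_
  simp only [Function.comp, Pi.neg_apply, smul_eq_mul, neg_mul_neg]
  rw [Real.rpow_def_of_pos hx, mul_comm]

/-- On `(0, 2π)` no translate `x + 2πn` changes sign, so every term is a convex power. Convexity
then yields the local Lipschitz bound without differentiating the series. -/
lemma convexOn_periodicPow {s : ℝ} (hs : 0 < s) :
    ConvexOn ℝ (Set.Ioo 0 (2 * Real.pi)) (periodicPow s) := by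
  refine ⟨convex_Ioo _ _, fun x hx y hy a b ha hb hab => ?_⟩
  simp only [periodicPow, smul_eq_mul]
  rw [← tsum_mul_left, ← tsum_mul_left, ← ((summable_periodicPow hs x).mul_left a).tsum_add
    ((summable_periodicPow hs y).mul_left b)]
  refine Summable.tsum_le_tsum (fun n => ?_) (summable_periodicPow hs _)
    (((summable_periodicPow hs x).mul_left a).add ((summable_periodicPow hs y).mul_left b))
  have hconv := convexOn_rpow_of_neg (p := -1 - s) (by linarith)
  have e : a * x + b * y + 2 * Real.pi * n =
      a * (x + 2 * Real.pi * n) + b * (y + 2 * Real.pi * n) := by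
    linear_combination -(2 * Real.pi * n) * hab
  rw [e]
  rcases le_or_gt 0 n with hn | hn
  · have hn' : (0 : ℝ) ≤ n := by exact_mod_cast hn
    have hx' : 0 < x + 2 * Real.pi * n := add_pos_of_pos_of_nonneg hx.1 (by positivity)
    have hy' : 0 < y + 2 * Real.pi * n := add_pos_of_pos_of_nonneg hy.1 (by positivity)
    rw [abs_of_pos hx', abs_of_pos hy', abs_of_nonneg (by positivity)]
    exact hconv.2 hx' hy' ha hb hab
  · have hn' : (n : ℝ) ≤ -1 := by exact_mod_cast Int.le_sub_one_of_lt hn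
    have hx' : 0 < -(x + 2 * Real.pi * n) := by nlinarith [hx.2, Real.pi_pos]
    have hy' : 0 < -(y + 2 * Real.pi * n) := by nlinarith [hy.2, Real.pi_pos]
    have h := hconv.2 hx' hy' ha hb hab
    simp only [smul_eq_mul] at h
    rw [← abs_neg (x + 2 * Real.pi * n), ← abs_neg (y + 2 * Real.pi * n),
      ← abs_neg (a * (x + 2 * Real.pi * n) + b * (y + 2 * Real.pi * n)),
      abs_of_pos hx', abs_of_pos hy', neg_add, ← mul_neg, ← mul_neg, abs_of_nonneg (by positivity)]
    exact h

lemma tsum_fgnPhi (s x : ℝ) :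
    ∑' n : ℤ, fgnPhi s (x + 2 * Real.pi * n) = (1 - Real.cos x) * periodicPow s x := by
  rw [periodicPow, ← tsum_mul_left]
  refine tsum_congr fun n => ?_
  rw [fgnPhi, mul_comm (2 * Real.pi) (n : ℝ), Real.cos_add_int_mul_two_pi]

lemma exists_lipschitz_tsum_fgnPhi {s μ : ℝ} (hs : 0 < s) (hμ : 0 < μ) (hμ2 : μ < 2 * Real.pi) :
    ∃ C δ : ℝ, 0 < δ ∧ 0 ≤ C ∧ ∀ x, |x - μ| < δ →
      |(1 - Real.cos x) * periodicPow s x - (1 - Real.cos μ) * periodicPow s μ| ≤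
        C * |x - μ| := by
  obtain ⟨K, t, ht, hK⟩ := (convexOn_periodicPow hs).locallyLipschitzOn isOpen_Ioo
    (⟨hμ, hμ2⟩ : μ ∈ Set.Ioo 0 (2 * Real.pi))
  rw [isOpen_Ioo.nhdsWithin_eq ⟨hμ, hμ2⟩] at ht
  obtain ⟨δ, hδ, hball⟩ := Metric.mem_nhds_iff.1 ht
  refine ⟨|periodicPow s μ| + 2 * K + K * δ, δ, hδ, by positivity, fun x hx => ?_⟩
  have h1 : |periodicPow s x - periodicPow s μ| ≤ K * |x - μ| := by
    have := hK.dist_le_mul x (hball (by simpa [Real.dist_eq] using hx)) μ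
      (hball (Metric.mem_ball_self hδ))
    simpa [Real.dist_eq] using this
  have h2 : |Real.cos μ - Real.cos x| ≤ |x - μ| := by
    rw [abs_sub_comm x μ]
    exact Real.abs_cos_sub_cos_le μ x
  have h3 : |1 - Real.cos x| ≤ 2 := by
    rw [abs_of_nonneg (by linarith [Real.cos_le_one x])]
    linarith [Real.neg_one_le_cos x]
  have e : (1 - Real.cos x) * periodicPow s x - (1 - Real.cos μ) * periodicPow s μ =
      (1 - Real.cos x) * (periodicPow s x - periodicPow s μ) +
        (Real.cos μ - Real.cos x) * periodicPow s μ := by ring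
  rw [e]
  refine (abs_add_le _ _).trans ?_
  rw [abs_mul, abs_mul]
  have h4 : |1 - Real.cos x| * |periodicPow s x - periodicPow s μ| ≤ 2 * (K * |x - μ|) := by
    gcongr
  have h5 : |Real.cos μ - Real.cos x| * |periodicPow s μ| ≤ |x - μ| * |periodicPow s μ| := by
    gcongr
  have h6 : 0 ≤ K * δ * |x - μ| := by positivity
  linarith

lemma hasSum_fgnCov_of_mem_Ioo {s μ : ℝ} (hs : 0 < s) (hs2 : s < 2) (hμ : 0 < μ)
    (hμ2 : μ < 2 * Real.pi) :
    HasSum (fun h : ℤ => (fgnCov s h : ℂ) * Complex.exp (-Complex.I * μ * h))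
      ((Real.Gamma (s + 1) * Real.sin (Real.pi * s / 2) * fgnDensity s μ : ℝ) : ℂ)
      (SummationFilter.symmetricIcc ℤ) := by
  have hκ := integral_fgnPhi hs hs2
  set κ := ∫ x, fgnPhi s x with hκ'
  have hκ0 : κ ≠ 0 := by
    rintro h
    rw [h, zero_mul] at hκ
    exact Real.pi_ne_zero hκ.symm
  have hi := integrable_fgnPhi hs hs2
  set G : ℝ → ℝ := fun x => (1 - Real.cos x) * periodicPow s x with hG
  have hfold : κ = ∫ x in Set.Ioc 0 (2 * Real.pi), G x := by
    rw [hκ', integral_eq_integral_tsum_translates hi (by positivity : 0 < 2 * Real.pi)]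
    simp only [tsum_fgnPhi, hG]
  -- Integrability again follows from the nonzero value `κ` of the integral.
  have hGi : IntegrableOn G (Set.Ioc 0 (2 * Real.pi)) :=
    Integrable.of_integral_ne_zero (hfold ▸ hκ0)
  have hcoef : ∀ h : ℤ, ∫ x in Set.Ioc 0 (2 * Real.pi),
      Complex.exp (Complex.I * h * x) * (G x : ℂ) = ((fgnCov s h * κ : ℝ) : ℂ) := by
    intro h
    have h1 := integral_exp_mul_fgnPhi hs hs2 h
    have h2 : Integrable fun x : ℝ =>
        Complex.exp (Complex.I * (h : ℝ) * x) * (fgnPhi s x : ℂ) := by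
      refine Integrable.bdd_mul (c := 1) hi.ofReal
        (by fun_prop : Continuous fun x : ℝ =>
          Complex.exp (Complex.I * (h : ℝ) * x)).aestronglyMeasurable (ae_of_all _ fun x => ?_)
      have : Complex.I * (h : ℝ) * (x : ℂ) = ((h * x : ℝ) : ℂ) * Complex.I := by
        push_cast
        ring
      rw [this, Complex.norm_exp_ofReal_mul_I]
    rw [← h1, integral_eq_integral_tsum_translates h2 (by positivity : 0 < 2 * Real.pi)]
    congr 1
    funext x
    rw [hG]
    simp only
    rw [← tsum_fgnPhi, Complex.ofReal_tsum, ← tsum_mul_left]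
    refine tsum_congr fun n => ?_
    congr 1
    have : Complex.I * ((h : ℝ) : ℂ) * ((x + 2 * Real.pi * n : ℝ) : ℂ) =
        Complex.I * h * x + ((h * n : ℤ) : ℂ) * (2 * Real.pi * Complex.I) := by
      push_cast
      ring
    rw [this, Complex.exp_add, Complex.exp_int_mul_two_pi_mul_I, mul_one]
  obtain ⟨C, δ, hδ, hC, hLip⟩ := exists_lipschitz_tsum_fgnPhi hs hμ hμ2
  have hmain := tendsto_symmetric_fourier_sum (G := fun x => (G x : ℂ)) hμ hμ2 hGi.ofReal hδ hC
    (fun x hx => by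
      rw [← Complex.ofReal_sub, Complex.norm_real]
      exact hLip x hx)
  simp only [hcoef] at hmain
  rw [HasSum, SummationFilter.symmetricIcc_eq_map_Icc_nat, tendsto_map'_iff]
  have h2 := hmain.const_mul ((κ : ℂ)⁻¹)
  -- Here `κ⁻¹π = Γ(s+1) sin(πs/2)`, and the remaining `2` completes `1 - cos μ` to `|1 -
  -- e^{-iμ}|²`.
  have e : (κ : ℂ)⁻¹ * (2 * Real.pi * (G μ : ℂ)) =
      ((Real.Gamma (s + 1) * Real.sin (Real.pi * s / 2) * fgnDensity s μ : ℝ) : ℂ) := by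
    have h3 : κ⁻¹ * Real.pi = Real.Gamma (s + 1) * Real.sin (Real.pi * s / 2) :=
      (eq_inv_mul_iff_mul_eq₀ hκ0).2 hκ |>.symm
    have h4 : κ⁻¹ * (2 * Real.pi * G μ) =
        Real.Gamma (s + 1) * Real.sin (Real.pi * s / 2) * fgnDensity s μ := by
      rw [fgnDensity, norm_one_sub_exp_sq, ← h3, hG]
      ring
    rw [← h4]
    push_cast
    rfl
  rw [e] at h2
  refine h2.congr fun N => ?_
  rw [Finset.mul_sum]
  refine Finset.sum_congr rfl fun h _ => ?_
  have : (κ : ℂ) ≠ 0 := Complex.ofReal_ne_zero.2 hκ0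
  push_cast
  field_simp

/-- The Fourier series of the autocovariance of fractional Gaussian noise. -/
theorem hasSum_fgnCov {s μ : ℝ} (hs : 0 < s) (hs2 : s < 2) (hμ : ∀ k : ℤ, μ ≠ 2 * Real.pi * k) :
    HasSum (fun h : ℤ => (fgnCov s h : ℂ) * Complex.exp (-Complex.I * μ * h))
      ((Real.Gamma (s + 1) * Real.sin (Real.pi * s / 2) * fgnDensity s μ : ℝ) : ℂ)
      (SummationFilter.symmetricIcc ℤ) := by
  set k : ℤ := ⌊μ / (2 * Real.pi)⌋ with hk
  have hp : 0 < 2 * Real.pi := by positivity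
  have h1 : 2 * Real.pi * k ≤ μ := by
    have := Int.floor_le (μ / (2 * Real.pi))
    rw [le_div_iff₀ hp] at this
    linarith
  have h2 : μ < 2 * Real.pi * k + 2 * Real.pi := by
    have := Int.lt_floor_add_one (μ / (2 * Real.pi))
    rw [div_lt_iff₀ hp] at this
    linarith
  have h3 : 0 < μ - 2 * Real.pi * k := sub_pos.2 (lt_of_le_of_ne h1 (hμ k).symm)
  have h := hasSum_fgnCov_of_mem_Ioo hs hs2 h3 (by linarith)
  have e : fgnDensity s (μ - 2 * Real.pi * k) = fgnDensity s μ := by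
    rw [← fgnDensity_add_int_mul s (μ - 2 * Real.pi * k) k, sub_add_cancel]
  rw [e] at h
  convert h using 3 with n
  have : -Complex.I * ((μ - 2 * Real.pi * k : ℝ) : ℂ) * n =
      -Complex.I * μ * n + ((k * n : ℤ) : ℂ) * (2 * Real.pi * Complex.I) := by
    push_cast
    ring
  rw [this, Complex.exp_add, Complex.exp_int_mul_two_pi_mul_I, mul_one]

/-! ### Behaviour of the spectral density at the origin -/

/-- For `|μ| ≤ π` and `n ≠ 0` one has `|μ + 2πn| ≥ 2π|n| - π ≥ π|n|`, so all terms but `n = 0` have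
a summable majorant independent of `μ`. -/
lemma exists_periodicPow_bound {s : ℝ} (hs : 0 < s) :
    ∃ C, ∀ μ : ℝ, |μ| ≤ Real.pi →
      |periodicPow s μ - |μ| ^ (-1 - s)| ≤ C := by
  have hsum : Summable fun n : ℤ => (Real.pi * |(n : ℝ)|) ^ (-1 - s) := by
    have h := ((Real.summable_one_div_int_add_rpow 0 (1 + s)).2
      (by linarith)).mul_left (Real.pi ^ (-1 - s))
    refine h.congr fun n => ?_
    have e2 : -1 - s = -(1 + s) := by ring
    rw [add_zero, Real.mul_rpow Real.pi_nonneg (abs_nonneg _), e2, Real.rpow_neg (abs_nonneg _),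
      one_div]
  refine ⟨∑' n : ℤ, (Real.pi * |(n : ℝ)|) ^ (-1 - s), fun μ hμ => ?_⟩
  rw [periodicPow, (summable_periodicPow hs μ).tsum_eq_add_tsum_ite 0]
  simp only [Int.cast_zero, mul_zero, add_zero, add_sub_cancel_left]
  have hterm : ∀ n : ℤ, (if n = 0 then 0 else |μ + 2 * Real.pi * n| ^ (-1 - s)) ≤
      (Real.pi * |(n : ℝ)|) ^ (-1 - s) := by
    intro n
    split_ifs with hn
    · positivity
    · have h1 : (1 : ℝ) ≤ |(n : ℝ)| := by exact_mod_cast Int.one_le_abs hn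
      refine Real.rpow_le_rpow_of_nonpos (by positivity) ?_ (by linarith)
      have h2 : |2 * Real.pi * n| ≤ |μ + 2 * Real.pi * n| + |μ| := by
        have := abs_sub (μ + 2 * Real.pi * n) μ
        rwa [add_sub_cancel_left] at this
      rw [abs_mul, abs_of_pos (by positivity : 0 < 2 * Real.pi)] at h2
      nlinarith [Real.pi_pos]
  have hnn : ∀ n : ℤ, 0 ≤ (if n = 0 then 0 else |μ + 2 * Real.pi * n| ^ (-1 - s)) := by
    intro n
    split_ifs <;> positivity
  rw [abs_of_nonneg (tsum_nonneg hnn)]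
  exact (Summable.of_nonneg_of_le hnn hterm hsum).tsum_le_tsum hterm hsum

/-- The prefactor is `μ² sinc²(μ/2)`. It turns the `n = 0` term into `|μ|^{1-s}` times a factor
tending to `1`, while the bounded rest is of lower order. -/
lemma tendsto_fgnDensity {s : ℝ} (hs : 0 < s) :
    Tendsto (fun μ => fgnDensity s μ * |μ| ^ (s - 1)) (𝓝[≠] 0) (𝓝 1) := by
  obtain ⟨C, hC⟩ := exists_periodicPow_bound hs
  have hC0 : 0 ≤ C := (abs_nonneg _).trans (hC 0 (by simpa using Real.pi_nonneg))
  have hsinc : Tendsto (fun μ : ℝ => Real.sinc (μ / 2) ^ 2) (𝓝[≠] 0) (𝓝 1) := by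
    have : Continuous fun μ : ℝ => Real.sinc (μ / 2) ^ 2 :=
      (Real.continuous_sinc.comp (by fun_prop)).pow 2
    simpa using (this.tendsto 0).mono_left nhdsWithin_le_nhds
  have hpow : Tendsto (fun μ : ℝ => |μ| ^ (1 + s)) (𝓝[≠] 0) (𝓝 0) := by
    have : Continuous fun μ : ℝ => |μ| ^ (1 + s) :=
      continuous_abs.rpow_const fun _ => Or.inr (by linarith)
    have h := (this.tendsto 0).mono_left (nhdsWithin_le_nhds (s := {0}ᶜ))
    rwa [abs_zero, Real.zero_rpow (by linarith)] at h
  have hrest : Tendsto (fun μ : ℝ => |μ| ^ (1 + s) * (periodicPow s μ - |μ| ^ (-1 - s)))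
      (𝓝[≠] 0) (𝓝 0) := by
    have h1 : Tendsto (fun μ : ℝ => |μ| ^ (1 + s) * C) (𝓝[≠] 0) (𝓝 0) := by
      simpa using hpow.mul_const C
    refine squeeze_zero_norm' ?_ h1
    have h2 : ∀ᶠ μ : ℝ in 𝓝[≠] 0, |μ| < Real.pi :=
      nhdsWithin_le_nhds
        ((continuous_abs.tendsto' (0 : ℝ) 0 abs_zero).eventually_lt_const Real.pi_pos)
    filter_upwards [h2] with μ hμ
    rw [norm_mul, Real.norm_eq_abs, Real.norm_eq_abs, abs_of_nonneg (by positivity)]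
    gcongr
    exact hC μ hμ.le
  have h := hsinc.mul (hrest.const_add 1)
  rw [add_zero, one_mul] at h
  refine h.congr' ?_
  filter_upwards [self_mem_nhdsWithin] with μ hμ
  have hμ : μ ≠ 0 := hμ
  have hpos : 0 < |μ| := abs_pos.2 hμ
  have e1 : 2 * (1 - Real.cos μ) = |μ| ^ (2 : ℝ) * Real.sinc (μ / 2) ^ 2 := by
    rw [Real.sinc_of_ne_zero (div_ne_zero hμ two_ne_zero), Real.rpow_two, sq_abs, div_pow,
      div_pow, Real.sin_sq_eq_half_sub]
    field_simp
  have e2 : |μ| ^ (1 + s) * |μ| ^ (-1 - s) = 1 := by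
    rw [← Real.rpow_add hpos]
    ring_nf
    exact Real.rpow_zero _
  have e3 : |μ| ^ (2 : ℝ) * |μ| ^ (s - 1) = |μ| ^ (1 + s) := by
    rw [← Real.rpow_add hpos]
    ring_nf
  rw [fgnDensity, norm_one_sub_exp_sq, e1]
  linear_combination -Real.sinc (μ / 2) ^ 2 * e2 - Real.sinc (μ / 2) ^ 2 * periodicPow s μ * e3

lemma tendsto_fgnDensity_of_lt {s p : ℝ} (hs : 0 < s) (hp : p < 1 - s) :
    Tendsto (fun μ => fgnDensity s μ * |μ| ^ (-p)) (𝓝[≠] 0) (𝓝 0) := by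
  have hpow : Tendsto (fun μ : ℝ => |μ| ^ (1 - s - p)) (𝓝[≠] 0) (𝓝 0) := by
    have : Continuous fun μ : ℝ => |μ| ^ (1 - s - p) :=
      continuous_abs.rpow_const fun _ => Or.inr (by linarith)
    have h := (this.tendsto 0).mono_left (nhdsWithin_le_nhds (s := {0}ᶜ))
    rwa [abs_zero, Real.zero_rpow (by linarith)] at h
  have h := (tendsto_fgnDensity hs).mul hpow
  rw [mul_zero] at h
  refine h.congr' ?_
  filter_upwards [self_mem_nhdsWithin] with μ hμ
  have hpos : 0 < |μ| := abs_pos.2 hμ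
  rw [mul_assoc, ← Real.rpow_add hpos]
  ring_nf

/-! ### The spectral matrix -/

section Spec

variable (M : Model) (H σ : Fin 2 → ℝ) (ρ : ℝ)

lemma specDensity_term (s : ℝ) (c : ℂ) {x : ℝ} (hx : x ≠ 0) :
    ((posPow (1 - s) x : ℂ) * c + (negPow (1 - s) x : ℂ) * (starRingEnd ℂ) c) / (x : ℂ) ^ 2 =
      ((|x| ^ (-1 - s) : ℝ) : ℂ) * (if 0 < x then c else (starRingEnd ℂ) c) := by
  have e : |x| ^ (1 - s) = |x| ^ (-1 - s) * x ^ 2 := by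
    rw [← sq_abs, ← Real.rpow_two, ← Real.rpow_add (abs_pos.2 hx)]
    ring_nf
  have hx2 : (x : ℂ) ^ 2 ≠ 0 := pow_ne_zero _ (Complex.ofReal_ne_zero.2 hx)
  rw [div_eq_iff hx2]
  rcases lt_or_gt_of_ne hx with h | h
  · rw [if_neg (not_lt.2 h.le), negPow, posPow, posPow, if_neg (not_lt.2 h.le),
      if_pos (by linarith), ← abs_of_neg h, e]
    push_cast
    ring
  · rw [if_pos h, negPow, posPow, posPow, if_pos h, if_neg (by linarith),
      show x ^ (1 - s) = |x| ^ (1 - s) by rw [abs_of_pos h], e]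
    push_cast
    ring

variable {H}

lemma specDensity_eq (j k : Fin 2) {μ : ℝ} (hμ : ∀ n : ℤ, μ ≠ 2 * Real.pi * n) :
    specDensity M H σ ρ j k μ = ((‖1 - Complex.exp (-Complex.I * μ)‖ ^ 2 : ℝ) : ℂ) *
      ∑' n : ℤ, ((|μ + 2 * Real.pi * n| ^ (-1 - (H j + H k)) : ℝ) : ℂ) *
        (if 0 < μ + 2 * Real.pi * n then cTilde M H σ ρ j k
          else (starRingEnd ℂ) (cTilde M H σ ρ j k)) := by
  rw [specDensity]
  congr 1
  refine tsum_congr fun n => ?_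
  have hne : μ + 2 * Real.pi * n ≠ 0 := fun h => hμ (-n) (by push_cast; linarith)
  rw [← specDensity_term _ _ hne, sub_sub]

/-- A number and its conjugate share their real part, so the sign of `μ + 2πn` drops out and only
`|μ + 2πn|^{-1-s}` is left. -/
lemma re_specDensity (hH : ∀ j, H j ∈ Set.Ioo (0 : ℝ) 1) (j k : Fin 2) {μ : ℝ}
    (hμ : ∀ n : ℤ, μ ≠ 2 * Real.pi * n) :
    (specDensity M H σ ρ j k μ).re = (cTilde M H σ ρ j k).re * fgnDensity (H j + H k) μ := by
  have hs : 0 < H j + H k := add_pos (hH j).1 (hH k).1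
  rw [specDensity_eq M σ ρ j k hμ, Complex.re_ofReal_mul, Complex.re_tsum, fgnDensity, periodicPow]
  · have : ∀ n : ℤ, (((|μ + 2 * Real.pi * n| ^ (-1 - (H j + H k)) : ℝ) : ℂ) *
        (if 0 < μ + 2 * Real.pi * n then cTilde M H σ ρ j k
          else (starRingEnd ℂ) (cTilde M H σ ρ j k))).re =
        |μ + 2 * Real.pi * n| ^ (-1 - (H j + H k)) * (cTilde M H σ ρ j k).re := by
      intro n
      rw [Complex.re_ofReal_mul]
      split_ifs <;> simp
    simp only [this]
    rw [tsum_mul_right]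
    ring
  · refine Summable.of_norm_bounded
      ((summable_periodicPow hs μ).mul_right ‖cTilde M H σ ρ j k‖) fun n => ?_
    rw [norm_mul, Complex.norm_real, Real.norm_of_nonneg (by positivity)]
    split_ifs <;> simp

lemma cTilde_self_im (j : Fin 2) : (cTilde M H σ ρ j j).im = 0 := by
  cases M <;> simp only [cTilde, if_true, Complex.ofReal_im]

lemma specDensity_self (hH : ∀ j, H j ∈ Set.Ioo (0 : ℝ) 1) (j : Fin 2) {μ : ℝ}
    (hμ : ∀ n : ℤ, μ ≠ 2 * Real.pi * n) :
    specDensity M H σ ρ j j μ = (((cTilde M H σ ρ j j).re * fgnDensity (H j + H j) μ : ℝ) : ℂ) := by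
  rw [← re_specDensity M σ ρ hH j j hμ]
  have hc : (starRingEnd ℂ) (cTilde M H σ ρ j j) = cTilde M H σ ρ j j :=
    Complex.conj_eq_iff_im.2 (cTilde_self_im M σ ρ j)
  refine (Complex.conj_eq_iff_re.1 ?_).symm
  rw [specDensity_eq M σ ρ j j hμ, map_mul, Complex.conj_ofReal, Complex.conj_tsum]
  congr 1
  refine tsum_congr fun n => ?_
  rw [map_mul, Complex.conj_ofReal]
  split_ifs <;> simp only [hc]

lemma cfgnSpectrum_eq (hH : ∀ j, H j ∈ Set.Ioo (0 : ℝ) 1) {lam0 lam : ℝ}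
    (hμ : ∀ n : ℤ, lam - lam0 ≠ 2 * Real.pi * n) :
    cfgnSpectrum M H σ ρ lam0 lam = 1 / 4 *
      (((cTilde M H σ ρ 0 0).re : ℂ) * (fgnDensity (H 0 + H 0) (lam - lam0) : ℂ) -
        ((cTilde M H σ ρ 1 1).re : ℂ) * (fgnDensity (H 1 + H 1) (lam - lam0) : ℂ) -
        2 * Complex.I * (((cTilde M H σ ρ 0 1).re : ℂ) *
          (fgnDensity (H 0 + H 1) (lam - lam0) : ℂ))) := by
  rw [cfgnSpectrum, specDensity_self M σ ρ hH 0 hμ, specDensity_self M σ ρ hH 1 hμ,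
    re_specDensity M σ ρ hH 0 1 hμ]
  push_cast
  rfl

/-- In the well-balanced case `1 - 2h` and `cos(πh)` change sign together at `h = 1/2`, so the
quotient under the root is positive on either side. -/
lemma normConst_pos {h : ℝ} (h0 : 0 < h) (h1 : h < 1)
    (hM : M = Model.wellBalanced → h ≠ 1 / 2) : 0 < normConst M h := by
  have hπ := Real.pi_pos
  have hG : 0 < Real.Gamma (h + 1 / 2) := Real.Gamma_pos_of_pos (by linarith)
  cases M with
  | causal =>
    refine Real.sqrt_pos.2 (div_pos (mul_pos (Real.Gamma_pos_of_pos (by linarith)) ?_)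
      (by positivity))
    exact Real.sin_pos_of_pos_of_lt_pi (by positivity) (by nlinarith)
  | wellBalanced =>
    have hne := hM rfl
    have hG2 : 0 < Real.Gamma (2 - 2 * h) := Real.Gamma_pos_of_pos (by linarith)
    have hcos2 : 0 < Real.cos ((h + 1 / 2) * Real.pi / 2) ^ 2 := by
      refine sq_pos_of_ne_zero ?_
      rcases lt_or_gt_of_ne hne with hlt | hgt
      · exact (Real.cos_pos_of_mem_Ioo ⟨by nlinarith, by nlinarith⟩).ne'
      · exact (Real.cos_neg_of_pi_div_two_lt_of_lt (by nlinarith) (by nlinarith)).ne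
    refine Real.sqrt_pos.2 ?_
    rcases lt_or_gt_of_ne hne with hlt | hgt
    · have hcos : 0 < Real.cos (h * Real.pi) :=
        Real.cos_pos_of_mem_Ioo ⟨by nlinarith, by nlinarith⟩
      have : 0 < 1 - 2 * h := by linarith
      positivity
    · have hcos : Real.cos (h * Real.pi) < 0 :=
        Real.cos_neg_of_pi_div_two_lt_of_lt (by nlinarith) (by nlinarith)
      have h2 : 1 - 2 * h < 0 := by linarith
      refine div_pos_of_neg_of_neg ?_ ?_
      · nlinarith [mul_pos (mul_pos two_pos h0) hπ]
      · have : 0 < 8 * Real.Gamma (2 - 2 * h) := by positivity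
        exact mul_neg_of_neg_of_pos (mul_neg_of_neg_of_pos (mul_neg_of_pos_of_neg this hcos)
          (by positivity)) hcos2

lemma cTilde_self_ne_zero (hH : ∀ j, H j ∈ Set.Ioo (0 : ℝ) 1) (hσ : ∀ j, 0 < σ j)
    (hM : M = Model.wellBalanced → ∀ j, H j ≠ 1 / 2) (j : Fin 2) :
    (cTilde M H σ ρ j j).re ≠ 0 := by
  have hn : 0 < normConst M (H j) := normConst_pos M (hH j).1 (hH j).2 fun h => hM h j
  have hG : 0 < Real.Gamma (H j + 1 / 2) := Real.Gamma_pos_of_pos (by linarith [(hH j).1])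
  have hσj := hσ j
  have hπ := Real.pi_pos
  obtain ⟨h0, h1⟩ := hH j
  cases M with
  | causal =>
    simp only [cTilde, if_true, Complex.ofReal_re]
    positivity
  | wellBalanced =>
    have hcos : Real.cos ((H j + 1 / 2) * Real.pi / 2) ≠ 0 := by
      rcases lt_or_gt_of_ne (hM rfl j) with hlt | hgt
      · exact (Real.cos_pos_of_mem_Ioo ⟨by nlinarith, by nlinarith⟩).ne'
      · exact (Real.cos_neg_of_pi_div_two_lt_of_lt (by nlinarith) (by nlinarith)).ne
    simp only [cTilde, if_true, Complex.ofReal_re]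
    positivity

lemma ofReal_re_cTilde_self (j : Fin 2) :
    ((cTilde M H σ ρ j j).re : ℂ) = cTilde M H σ ρ j j :=
  Complex.conj_eq_iff_re.1 (Complex.conj_eq_iff_im.2 (cTilde_self_im M σ ρ j))

end Spec

/-- A nonzero limit is essential: equivalence to the zero function would mean eventual equality,
which no limit can give. -/
lemma isEquivalent_of_tendsto_mul_rpow {u : ℝ → ℂ} {K : ℂ} {p : ℝ} (hK : K ≠ 0)
    (h : Tendsto (fun μ : ℝ => u μ * ((|μ| ^ (-p) : ℝ) : ℂ)) (𝓝[≠] 0) (𝓝 K)) :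
    Asymptotics.IsEquivalent (𝓝[≠] 0) u fun μ : ℝ => K * ((|μ| ^ p : ℝ) : ℂ) := by
  have h1 := ((Asymptotics.isEquivalent_const_iff_tendsto hK).2 h).mul
    (Asymptotics.IsEquivalent.refl (u := fun μ : ℝ => ((|μ| ^ p : ℝ) : ℂ)) (l := 𝓝[≠] 0))
  refine h1.congr_left ?_
  filter_upwards [self_mem_nhdsWithin] with μ hμ
  have hpos : 0 < |μ| := abs_pos.2 hμ
  simp only [Pi.mul_apply]
  rw [mul_assoc, ← Complex.ofReal_mul, ← Real.rpow_add hpos]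
  simp

/-- The behaviour of the cyclic spectrum near the cyclic frequency. -/
theorem isEquivalent_cfgnSpectrum (M : Model) {H σ : Fin 2 → ℝ} (ρ lam0 : ℝ)
    (hH : ∀ j, H j ∈ Set.Ioo (0 : ℝ) 1) (hσ : ∀ j, 0 < σ j)
    (hM : M = Model.wellBalanced → ∀ j, H j ≠ 1 / 2) :
    Asymptotics.IsEquivalent (𝓝[≠] lam0)
      (fun lam : ℝ => cfgnSpectrum M H σ ρ lam0 lam)
      (fun lam : ℝ => coeffK M H σ ρ *
        ((|lam - lam0| ^ (-2 * max (memD H 0) (memD H 1)) : ℝ) : ℂ)) := by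
  have hshift : Tendsto (fun lam : ℝ => lam - lam0) (𝓝[≠] lam0) (𝓝[≠] 0) := by
    refine tendsto_nhdsWithin_of_tendsto_nhds_of_eventually_within _ ?_ ?_
    · have : Continuous fun lam : ℝ => lam - lam0 := by fun_prop
      simpa using (this.tendsto lam0).mono_left nhdsWithin_le_nhds
    · filter_upwards [self_mem_nhdsWithin] with lam hlam
      exact sub_ne_zero.2 hlam
  set A := (cTilde M H σ ρ 0 0).re with hA
  set B := (cTilde M H σ ρ 1 1).re with hB
  set C := (cTilde M H σ ρ 0 1).re with hC
  set u : ℝ → ℂ := fun μ => 1 / 4 * ((A : ℂ) * (fgnDensity (H 0 + H 0) μ : ℂ) -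
    (B : ℂ) * (fgnDensity (H 1 + H 1) μ : ℂ) -
    2 * Complex.I * ((C : ℂ) * (fgnDensity (H 0 + H 1) μ : ℂ))) with hu
  suffices hmain : Asymptotics.IsEquivalent (𝓝[≠] 0) u (fun μ : ℝ => coeffK M H σ ρ *
      ((|μ| ^ (-2 * max (memD H 0) (memD H 1)) : ℝ) : ℂ)) by
    refine (hmain.comp_tendsto hshift).congr_left ?_
    have hnear : ∀ᶠ lam in 𝓝[≠] lam0, |lam - lam0| < 2 * Real.pi :=
      nhdsWithin_le_nhds (by
        simpa [Real.dist_eq, Metric.ball] using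
          Metric.ball_mem_nhds lam0 (by positivity : 0 < 2 * Real.pi))
    filter_upwards [self_mem_nhdsWithin, hnear] with lam hlam hlam2
    refine (cfgnSpectrum_eq M σ ρ hH fun n hn => ?_).symm
    rcases eq_or_ne n 0 with rfl | hn0
    · exact hlam (by simpa [sub_eq_zero] using hn)
    · have h3 : (1 : ℝ) ≤ |(n : ℝ)| := by exact_mod_cast Int.one_le_abs hn0
      rw [hn, abs_mul, abs_of_pos (by positivity : 0 < 2 * Real.pi)] at hlam2
      nlinarith [Real.pi_pos]
  have hH0 := (hH 0).1
  have hH1 := (hH 1).1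
  have hofReal : ∀ {f : ℝ → ℝ} {a : ℝ}, Tendsto f (𝓝[≠] 0) (𝓝 a) →
      Tendsto (fun μ => (f μ : ℂ)) (𝓝[≠] 0) (𝓝 (a : ℂ)) := fun h =>
    (Complex.continuous_ofReal.tendsto _).comp h
  have hsplit : ∀ p : ℝ, (fun μ => u μ * ((|μ| ^ (-p) : ℝ) : ℂ)) = fun μ =>
      1 / 4 * ((A : ℂ) * ((fgnDensity (H 0 + H 0) μ * |μ| ^ (-p) : ℝ) : ℂ) -
      (B : ℂ) * ((fgnDensity (H 1 + H 1) μ * |μ| ^ (-p) : ℝ) : ℂ) -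
      2 * Complex.I * ((C : ℂ) * ((fgnDensity (H 0 + H 1) μ * |μ| ^ (-p) : ℝ) : ℂ))) := by
    intro p
    funext μ
    rw [hu]
    push_cast
    ring
  rcases lt_trichotomy (H 1) (H 0) with hlt | heq | hgt
  · have e : coeffK M H σ ρ = (A : ℂ) / 4 := by
      rw [coeffK, if_pos (by simp only [memD]; linarith), hA, ofReal_re_cTilde_self]
    have e2 : -2 * max (memD H 0) (memD H 1) = 1 - (H 0 + H 0) := by
      rw [max_eq_left (by simp only [memD]; linarith), memD]
      ring
    rw [e, e2]
    refine isEquivalent_of_tendsto_mul_rpow (div_ne_zero (Complex.ofReal_ne_zero.2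
      (cTilde_self_ne_zero M σ ρ hH hσ hM 0)) (by norm_num)) ?_
    rw [hsplit]
    -- Both `2H₁` and `H₀ + H₁` are below `2H₀`, so the other two densities vanish after rescaling
    -- by `|μ|^{2H₀-1}`.
    have t0 := tendsto_fgnDensity (s := H 0 + H 0) (by linarith)
    have t1 := tendsto_fgnDensity_of_lt (s := H 1 + H 1) (p := 1 - (H 0 + H 0)) (by linarith)
      (by linarith)
    have t2 := tendsto_fgnDensity_of_lt (s := H 0 + H 1) (p := 1 - (H 0 + H 0)) (by linarith)
      (by linarith)
    rw [show H 0 + H 0 - 1 = -(1 - (H 0 + H 0)) by ring] at t0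
    have t := ((((hofReal t0).const_mul (A : ℂ)).sub ((hofReal t1).const_mul (B : ℂ))).sub
      (((hofReal t2).const_mul (C : ℂ)).const_mul (2 * Complex.I))).const_mul (1 / 4 : ℂ)
    convert t using 2
    push_cast
    ring
  · have e : coeffK M H σ ρ = 1 / 4 * ((A : ℂ) - B - 2 * Complex.I * C) := by
      rw [coeffK, if_neg (by simp only [memD]; linarith), if_neg (by simp only [memD]; linarith),
        hA, hB, ofReal_re_cTilde_self, ofReal_re_cTilde_self]
    have e2 : -2 * max (memD H 0) (memD H 1) = 1 - (H 0 + H 0) := by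
      rw [max_eq_left (by simp only [memD]; linarith), memD]
      ring
    -- An exact factorization rather than a limit, so that the case of a vanishing coefficient is
    -- covered.
    have e3 : u = fun μ => (1 / 4 * ((A : ℂ) - B - 2 * Complex.I * C)) *
        (fgnDensity (H 0 + H 0) μ : ℂ) := by
      funext μ
      rw [hu]
      simp only [heq]
      ring
    rw [e, e2, e3]
    refine Asymptotics.IsEquivalent.refl.mul ?_
    have t0 := hofReal (tendsto_fgnDensity (s := H 0 + H 0) (by linarith))
    have h1 := isEquivalent_of_tendsto_mul_rpow (u := fun μ => (fgnDensity (H 0 + H 0) μ : ℂ))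
      (K := 1) (p := 1 - (H 0 + H 0)) one_ne_zero (by
        rw [show H 0 + H 0 - 1 = -(1 - (H 0 + H 0)) by ring] at t0
        simpa using t0)
    simpa using h1
  · have e : coeffK M H σ ρ = -(B : ℂ) / 4 := by
      rw [coeffK, if_neg (by simp only [memD]; linarith), if_pos (by simp only [memD]; linarith),
        hB, ofReal_re_cTilde_self]
    have e2 : -2 * max (memD H 0) (memD H 1) = 1 - (H 1 + H 1) := by
      rw [max_eq_right (by simp only [memD]; linarith), memD]
      ring
    rw [e, e2]
    refine isEquivalent_of_tendsto_mul_rpow (div_ne_zero (neg_ne_zero.2 (Complex.ofReal_ne_zero.2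
      (cTilde_self_ne_zero M σ ρ hH hσ hM 1))) (by norm_num)) ?_
    rw [hsplit]
    have t1 := tendsto_fgnDensity (s := H 1 + H 1) (by linarith)
    have t0 := tendsto_fgnDensity_of_lt (s := H 0 + H 0) (p := 1 - (H 1 + H 1)) (by linarith)
      (by linarith)
    have t2 := tendsto_fgnDensity_of_lt (s := H 0 + H 1) (p := 1 - (H 1 + H 1)) (by linarith)
      (by linarith)
    rw [show H 1 + H 1 - 1 = -(1 - (H 1 + H 1)) by ring] at t1
    have t := ((((hofReal t0).const_mul (A : ℂ)).sub ((hofReal t1).const_mul (B : ℂ))).sub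
      (((hofReal t2).const_mul (C : ℂ)).const_mul (2 * Complex.I))).const_mul (1 / 4 : ℂ)
    convert t using 2
    push_cast
    ring

/-! ### The spectral matrix in terms of the kernels -/

/-- Matches the explicit matrix with the kernel integrals. In the causal case the phase
`e^{-iπ(H_j-H_k)/2}` contributes its real part, the cosine in `∫ f₊f₊`. The normalising constants
stand on both sides, so their values play no role. -/
lemma re_cTilde (M : Model) {H : Fin 2 → ℝ} (σ : Fin 2 → ℝ) (ρ : ℝ)
    (hH : ∀ j, H j ∈ Set.Ioo (0 : ℝ) 1) (j k : Fin 2) :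
    2 * Real.pi * (cTilde M H σ ρ j k).re = driverCorr ρ j k *
      (∫ x, fbmKernel M (H j) (σ j) 1 x * fbmKernel M (H k) (σ k) 1 x) *
      (Real.Gamma (H j + H k + 1) * Real.sin (Real.pi * (H j + H k) / 2)) := by
  have hπ : 2 * Real.pi * (1 / (2 * Real.pi)) = 1 := mul_one_div_cancel (by positivity)
  have hπ' : 2 * Real.pi * (2 / Real.pi) = 4 := by
    field_simp
    norm_num
  have ha : -(1 / 2) < H j - 1 / 2 := by linarith [(hH j).1]
  have ha' : H j - 1 / 2 < 1 / 2 := by linarith [(hH j).2]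
  have hb : -(1 / 2) < H k - 1 / 2 := by linarith [(hH k).1]
  have hb' : H k - 1 / 2 < 1 / 2 := by linarith [(hH k).2]
  have e1 : H j - 1 / 2 + (H k - 1 / 2) + 2 = H j + H k + 1 := by ring
  have e2 : H j - 1 / 2 + (H k - 1 / 2) + 1 = H j + H k := by ring
  have e3 : H j - 1 / 2 + 1 = H j + 1 / 2 := by ring
  have e4 : H k - 1 / 2 + 1 = H k + 1 / 2 := by ring
  have e5 : H j - 1 / 2 - (H k - 1 / 2) = H j - H k := by ring
  cases M with
  | causal =>
    have h := integral_kernelPlus_mul_kernelPlus ha ha' hb hb'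
    rw [e1, e2, e3, e4, e5] at h
    have e : (fun x => fbmKernel .causal (H j) (σ j) 1 x * fbmKernel .causal (H k) (σ k) 1 x) =
        fun x => (σ j * normConst .causal (H j) * (σ k * normConst .causal (H k))) *
          (kernelPlus 1 (H j - 1 / 2) x * kernelPlus 1 (H k - 1 / 2) x) := by
      funext x
      simp only [fbmKernel]
      ring
    rw [e, integral_const_mul, cTilde]
    by_cases hjk : j = k
    · subst hjk
      simp only [if_true, Complex.ofReal_re, driverCorr]
      rw [sub_self, mul_zero, zero_div, Real.cos_zero] at h
      rw [one_mul, mul_assoc _ (∫ x, _), h]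
      linear_combination (σ j ^ 2 * Real.Gamma (H j + 1 / 2) ^ 2 *
        normConst .causal (H j) ^ 2) * hπ
    · have hexp : -Complex.I * ((Real.pi : ℂ) / 2) * ((H j : ℂ) - (H k : ℂ)) =
          ((-(Real.pi * (H j - H k) / 2) : ℝ) : ℂ) * Complex.I := by
        push_cast
        ring
      simp only [if_neg hjk, driverCorr]
      rw [hexp, Complex.re_ofReal_mul, Complex.exp_ofReal_mul_I_re, Real.cos_neg, mul_assoc ρ,
        mul_assoc _ (∫ x, _), h]
      linear_combination (ρ * σ j * σ k * Real.Gamma (H j + 1 / 2) * Real.Gamma (H k + 1 / 2) *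
        normConst .causal (H j) * normConst .causal (H k) *
        Real.cos (Real.pi * (H j - H k) / 2)) * hπ
  | wellBalanced =>
    have h := integral_wellBalanced ha ha' hb hb'
    rw [e1, e2, e3, e4] at h
    have e : (fun x => fbmKernel .wellBalanced (H j) (σ j) 1 x *
        fbmKernel .wellBalanced (H k) (σ k) 1 x) =
        fun x => (σ j * normConst .wellBalanced (H j) * (σ k * normConst .wellBalanced (H k))) *
          ((kernelPlus 1 (H j - 1 / 2) x + kernelMinus 1 (H j - 1 / 2) x) *
            (kernelPlus 1 (H k - 1 / 2) x + kernelMinus 1 (H k - 1 / 2) x)) := by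
      funext x
      simp only [fbmKernel]
      ring
    rw [e, integral_const_mul, cTilde]
    by_cases hjk : j = k
    · subst hjk
      simp only [if_true, Complex.ofReal_re, driverCorr]
      rw [one_mul, mul_assoc _ (∫ x, _), h]
      linear_combination (σ j ^ 2 * Real.cos ((H j + 1 / 2) * Real.pi / 2) ^ 2 *
        Real.Gamma (H j + 1 / 2) ^ 2 * normConst .wellBalanced (H j) ^ 2) * hπ'
    · simp only [if_neg hjk, driverCorr, Complex.ofReal_re]
      rw [mul_assoc ρ, mul_assoc _ (∫ x, _), h]
      linear_combination (ρ * σ j * σ k * Real.cos ((H j + 1 / 2) * Real.pi / 2) *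
        Real.cos ((H k + 1 / 2) * Real.pi / 2) * Real.Gamma (H j + 1 / 2) *
        Real.Gamma (H k + 1 / 2) * normConst .wellBalanced (H j) *
        normConst .wellBalanced (H k)) * hπ'

/-! ### Self-similarity and stationary increments of the kernels -/

lemma fbmKernel_sub (M : Model) (H σ t s x : ℝ) :
    fbmKernel M H σ t x - fbmKernel M H σ s x = fbmKernel M H σ (t - s) (x - s) := by
  have e1 : t - s - (x - s) = t - x := by ring
  have e2 : -(x - s) = s - x := by ring
  cases M <;> simp only [fbmKernel, kernelPlus, kernelMinus, negPow, e1, e2] <;> ring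

lemma posPow_mul {t : ℝ} (ht : 0 < t) (a x : ℝ) : posPow a (t * x) = t ^ a * posPow a x := by
  simp only [posPow, mul_pos_iff_of_pos_left ht]
  split_ifs with hx
  · exact Real.mul_rpow ht.le hx.le
  · simp

lemma fbmKernel_mul (M : Model) (H σ : ℝ) {t : ℝ} (ht : 0 < t) (x : ℝ) :
    fbmKernel M H σ t (t * x) = t ^ (H - 1 / 2) * fbmKernel M H σ 1 x := by
  have e1 : t - t * x = t * (1 - x) := by ring
  have e2 : -(t * x) = t * -x := by ring
  have e3 : -(t * (1 - x)) = t * -(1 - x) := by ring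
  have e4 : -(t * -x) = t * - -x := by ring
  cases M <;> simp only [fbmKernel, kernelPlus, kernelMinus, negPow, e1, e2, e3, e4,
    posPow_mul ht] <;> ring

lemma integral_fbmKernel_mul (M : Model) (H H' σ σ' : ℝ) {t : ℝ} (ht : 0 < t) :
    ∫ x, fbmKernel M H σ t x * fbmKernel M H' σ' t x =
      t ^ (H + H') * ∫ x, fbmKernel M H σ 1 x * fbmKernel M H' σ' 1 x := by
  have h := Measure.integral_comp_mul_left
    (fun x => fbmKernel M H σ t x * fbmKernel M H' σ' t x) t
  have e : (fun x => fbmKernel M H σ t (t * x) * fbmKernel M H' σ' t (t * x)) = fun x =>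
      (t ^ (H - 1 / 2) * t ^ (H' - 1 / 2)) *
        (fbmKernel M H σ 1 x * fbmKernel M H' σ' 1 x) := by
    funext x
    rw [fbmKernel_mul M H σ ht, fbmKernel_mul M H' σ' ht]
    ring
  rw [e, integral_const_mul, smul_eq_mul, abs_inv, abs_of_pos ht, eq_inv_mul_iff_mul_eq₀ ht.ne'] at h
  rw [← h, ← mul_assoc]
  congr 1
  nth_rewrite 1 [← Real.rpow_one t]
  rw [← Real.rpow_add ht, ← Real.rpow_add ht]
  congr 1
  ring

/-- Translation reduces to time `t - s`, and scaling gives `t^{H-1/2}` per kernel plus one power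
from `dx`. At `t = s` the convention `0^{H+H'} = 0` is used, valid as `H + H' > 0`. -/
lemma integral_fbmKernel_sub_mul (M : Model) {H H' : ℝ} (σ σ' t s : ℝ) (hs : 0 < H + H') :
    ∫ x, (fbmKernel M H σ t x - fbmKernel M H σ s x) *
        (fbmKernel M H' σ' t x - fbmKernel M H' σ' s x) =
      |t - s| ^ (H + H') * ∫ x, fbmKernel M H σ 1 x * fbmKernel M H' σ' 1 x := by
  have key : ∀ t s : ℝ, s < t → ∫ x, (fbmKernel M H σ t x - fbmKernel M H σ s x) *
      (fbmKernel M H' σ' t x - fbmKernel M H' σ' s x) =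
      |t - s| ^ (H + H') * ∫ x, fbmKernel M H σ 1 x * fbmKernel M H' σ' 1 x := by
    intro t s hst
    have hpos : 0 < t - s := sub_pos.2 hst
    simp only [fbmKernel_sub]
    rw [integral_sub_right_eq_self
      (fun x => fbmKernel M H σ (t - s) x * fbmKernel M H' σ' (t - s) x) s,
      integral_fbmKernel_mul M H H' σ σ' hpos, abs_of_pos hpos]
  rcases lt_trichotomy s t with h | rfl | h
  · exact key t s h
  · simp [Real.zero_rpow hs.ne']
  · rw [abs_sub_comm, ← key s t h]
    congr 1
    funext x
    ring

/-- The inner product of the kernels of two unit increments at distance `h`. -/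
def incrInner (M : Model) (H σ : Fin 2 → ℝ) (j k : Fin 2) (h : ℝ) : ℝ :=
  ∫ x, fbmKernel M (H j) (σ j) 1 (x - h) * fbmKernel M (H k) (σ k) 1 x

lemma integral_incr_mul_incr (M : Model) (H σ : Fin 2 → ℝ) (j k : Fin 2) (m n : ℝ) :
    ∫ x, (fbmKernel M (H j) (σ j) (m + 1) x - fbmKernel M (H j) (σ j) m x) *
        (fbmKernel M (H k) (σ k) (n + 1) x - fbmKernel M (H k) (σ k) n x) =
      incrInner M H σ j k (m - n) := by
  simp only [fbmKernel_sub, add_sub_cancel_left]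
  rw [incrInner, ← integral_sub_right_eq_self (fun x => fbmKernel M (H j) (σ j) 1 (x - (m - n)) *
    fbmKernel M (H k) (σ k) 1 x) n]
  congr 1
  funext x
  ring_nf

lemma incrInner_neg (M : Model) (H σ : Fin 2 → ℝ) (j k : Fin 2) (h : ℝ) :
    incrInner M H σ k j h = incrInner M H σ j k (-h) := by
  rw [incrInner, incrInner, ← integral_sub_right_eq_self
    (fun x => fbmKernel M (H j) (σ j) 1 (x - -h) * fbmKernel M (H k) (σ k) 1 x) h]
  congr 1
  funext x
  rw [mul_comm]
  ring_nf

section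

variable {M : Model} {H σ : Fin 2 → ℝ} (hH : ∀ j, H j ∈ Set.Ioo (0 : ℝ) 1)
  (hmem : ∀ j, ∀ t : ℝ, 0 ≤ t → MemLp (fbmKernel M (H j) (σ j) t) 2 volume)

include hH hmem

/-- Polarization: the symmetrized product of two increments is a combination of products of
increments over common intervals, of lengths `|h ± 1|` and twice `|h|`. Times are kept nonnegative
because square integrability is available only there. -/
lemma incrInner_add_of_nonneg (j k : Fin 2) {m n : ℝ} (hm : 0 ≤ m) (hn : 0 ≤ n) :
    incrInner M H σ j k (m - n) + incrInner M H σ k j (m - n) =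
      2 * fgnCov (H j + H k) (m - n) *
        ∫ x, fbmKernel M (H j) (σ j) 1 x * fbmKernel M (H k) (σ k) 1 x := by
  have hs : 0 < H j + H k := add_pos (hH j).1 (hH k).1
  have hint : ∀ a b c d : ℝ, 0 ≤ a → 0 ≤ b → 0 ≤ c → 0 ≤ d → Integrable fun x =>
      (fbmKernel M (H j) (σ j) a x - fbmKernel M (H j) (σ j) b x) *
        (fbmKernel M (H k) (σ k) c x - fbmKernel M (H k) (σ k) d x) :=
    fun a b c d ha hb hc hd => ((hmem j a ha).sub (hmem j b hb)).integrable_mul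
      ((hmem k c hc).sub (hmem k d hd))
  have hm1 : 0 ≤ m + 1 := by linarith
  have hn1 : 0 ≤ n + 1 := by linarith
  have e := incrInner_neg M H σ j k (m - n)
  rw [neg_sub] at e
  rw [e, ← integral_incr_mul_incr, ← integral_incr_mul_incr,
    ← integral_add (hint _ _ _ _ hm1 hm hn1 hn) (hint _ _ _ _ hn1 hn hm1 hm)]
  have e2 : (fun x => (fbmKernel M (H j) (σ j) (m + 1) x - fbmKernel M (H j) (σ j) m x) *
      (fbmKernel M (H k) (σ k) (n + 1) x - fbmKernel M (H k) (σ k) n x) +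
      (fbmKernel M (H j) (σ j) (n + 1) x - fbmKernel M (H j) (σ j) n x) *
      (fbmKernel M (H k) (σ k) (m + 1) x - fbmKernel M (H k) (σ k) m x)) = fun x =>
      ((fbmKernel M (H j) (σ j) (m + 1) x - fbmKernel M (H j) (σ j) n x) *
      (fbmKernel M (H k) (σ k) (m + 1) x - fbmKernel M (H k) (σ k) n x) +
      (fbmKernel M (H j) (σ j) m x - fbmKernel M (H j) (σ j) (n + 1) x) *
      (fbmKernel M (H k) (σ k) m x - fbmKernel M (H k) (σ k) (n + 1) x)) -
      ((fbmKernel M (H j) (σ j) (m + 1) x - fbmKernel M (H j) (σ j) (n + 1) x) *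
      (fbmKernel M (H k) (σ k) (m + 1) x - fbmKernel M (H k) (σ k) (n + 1) x) +
      (fbmKernel M (H j) (σ j) m x - fbmKernel M (H j) (σ j) n x) *
      (fbmKernel M (H k) (σ k) m x - fbmKernel M (H k) (σ k) n x)) := by
    funext x
    ring
  have i1 := (hint _ _ _ _ hm1 hn hm1 hn).add (hint _ _ _ _ hm hn1 hm hn1)
  have i2 := (hint _ _ _ _ hm1 hn1 hm1 hn1).add (hint _ _ _ _ hm hn hm hn)
  rw [e2]
  refine (integral_sub i1 i2).trans ?_
  refine (congrArg₂ (· - ·)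
    (integral_add (hint _ _ _ _ hm1 hn hm1 hn) (hint _ _ _ _ hm hn1 hm hn1))
    (integral_add (hint _ _ _ _ hm1 hn1 hm1 hn1) (hint _ _ _ _ hm hn hm hn))).trans ?_
  simp only [integral_fbmKernel_sub_mul M _ _ _ _ hs]
  have f1 : m + 1 - n = m - n + 1 := by ring
  have f2 : m - (n + 1) = m - n - 1 := by ring
  have f3 : m + 1 - (n + 1) = m - n := by ring
  rw [f1, f2, f3, fgnCov]
  ring

lemma incrInner_add (j k : Fin 2) (h : ℝ) :
    incrInner M H σ j k h + incrInner M H σ k j h = 2 * fgnCov (H j + H k) h *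
      ∫ x, fbmKernel M (H j) (σ j) 1 x * fbmKernel M (H k) (σ k) 1 x := by
  rcases le_total 0 h with h0 | h0
  · simpa using incrInner_add_of_nonneg hH hmem j k h0 le_rfl
  -- A negative lag is realized as `0 - (-h)`, with both times nonnegative.
  · simpa using incrInner_add_of_nonneg hH hmem j k le_rfl (neg_nonneg.2 h0)

end

/-! ### Covariances -/

section Cov

variable {Ω : Type*} [MeasurableSpace Ω] {P : Measure Ω} [IsProbabilityMeasure P]
  {M : Model} {H σ : Fin 2 → ℝ} {ρ : ℝ} {Z : Fin 2 → ℝ → Ω → ℝ}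

omit [IsProbabilityMeasure P] in
lemma IsFBM2.memLp_kernel (hZ : IsFBM2 M H σ ρ Z P) (j : Fin 2) {t : ℝ} (ht : 0 ≤ t) :
    MemLp (fbmKernel M (H j) (σ j) t) 2 volume := by
  obtain ⟨B, -, -, h⟩ := hZ
  exact (h j t ht).1

omit [IsProbabilityMeasure P] in
lemma IsFBM2.memLp (hZ : IsFBM2 M H σ ρ Z P) (j : Fin 2) {t : ℝ} (ht : 0 ≤ t) :
    MemLp (Z j t) 2 P := by
  obtain ⟨B, -, -, h⟩ := hZ
  exact (h j t ht).2.1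

omit [IsProbabilityMeasure P] in
lemma IsFBM2.memLp_fgn (hZ : IsFBM2 M H σ ρ Z P) (j : Fin 2) (n : ℕ) :
    MemLp (fgn Z j n) 2 P :=
  (hZ.memLp j (by positivity)).sub (hZ.memLp j (by positivity))

lemma IsFBM2.covariance_eq (hZ : IsFBM2 M H σ ρ Z P) (hρ : |ρ| ≤ 1) (j k : Fin 2) {t s : ℝ}
    (ht : 0 ≤ t) (hs : 0 ≤ s) : cov[Z j t, Z k s; P] = driverCorr ρ j k *
      ∫ x, fbmKernel M (H j) (σ j) t x * fbmKernel M (H k) (σ k) s x := by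
  rw [covariance_eq_sub (hZ.memLp j ht) (hZ.memLp k hs)]
  obtain ⟨B, hB, hind, h⟩ := hZ
  have h0 := (h j t ht).integral_eq_zero (memLp_driver hB j) (integral_driver hB j)
  have h1 := (h j t ht).integral_mul (memLp_driver hB j) (memLp_driver hB k)
    (integral_driver_mul hB hρ hind j k) (h k s hs)
  rw [h0, zero_mul, sub_zero]
  exact h1

lemma IsFBM2.covariance_fgn (hZ : IsFBM2 M H σ ρ Z P) (hρ : |ρ| ≤ 1) (j k : Fin 2) (m n : ℕ) :
    cov[fgn Z j m, fgn Z k n; P] =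
      driverCorr ρ j k * incrInner M H σ j k ((m : ℝ) - n) := by
  have hn : ∀ n : ℕ, (0 : ℝ) ≤ n := fun n => by positivity
  have hn1 : ∀ n : ℕ, (0 : ℝ) ≤ (n : ℝ) + 1 := fun n => by positivity
  have e : ∀ j n, fgn Z j n = fun ω => Z j ((n : ℝ) + 1) ω - Z j (n : ℝ) ω := fun _ _ => rfl
  have hi : ∀ a b : ℝ, 0 ≤ a → 0 ≤ b → Integrable fun x =>
      fbmKernel M (H j) (σ j) a x * fbmKernel M (H k) (σ k) b x := fun a b ha hb =>
    (hZ.memLp_kernel j ha).integrable_mul (hZ.memLp_kernel k hb)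
  rw [e, e, covariance_fun_sub_fun_sub (hZ.memLp j (hn1 m)) (hZ.memLp j (hn m))
    (hZ.memLp k (hn1 n)) (hZ.memLp k (hn n)), hZ.covariance_eq hρ j k (hn1 m) (hn1 n),
    hZ.covariance_eq hρ j k (hn1 m) (hn n), hZ.covariance_eq hρ j k (hn m) (hn1 n),
    hZ.covariance_eq hρ j k (hn m) (hn n), ← integral_incr_mul_incr]
  have e2 : (fun x => (fbmKernel M (H j) (σ j) (m + 1) x - fbmKernel M (H j) (σ j) m x) *
      (fbmKernel M (H k) (σ k) (n + 1) x - fbmKernel M (H k) (σ k) n x)) = fun x =>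
      (fbmKernel M (H j) (σ j) (m + 1) x * fbmKernel M (H k) (σ k) (n + 1) x -
        fbmKernel M (H j) (σ j) (m + 1) x * fbmKernel M (H k) (σ k) n x) -
      (fbmKernel M (H j) (σ j) m x * fbmKernel M (H k) (σ k) (n + 1) x -
        fbmKernel M (H j) (σ j) m x * fbmKernel M (H k) (σ k) n x) := by
    funext x
    ring
  have i1 : ∀ a, 0 ≤ a → Integrable fun x =>
      fbmKernel M (H j) (σ j) a x * fbmKernel M (H k) (σ k) (n + 1) x -
        fbmKernel M (H j) (σ j) a x * fbmKernel M (H k) (σ k) n x := fun a ha =>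
    (hi a _ ha (hn1 n)).sub (hi a _ ha (hn n))
  rw [e2, integral_sub (i1 _ (hn1 m)) (i1 _ (hn m)),
    integral_sub (hi _ _ (hn1 m) (hn1 n)) (hi _ _ (hn1 m) (hn n)),
    integral_sub (hi _ _ (hn m) (hn1 n)) (hi _ _ (hn m) (hn n))]
  ring

/-- The cross-covariance function of fractional Gaussian noise. -/
def fgnCrossCov (M : Model) (H σ : Fin 2 → ℝ) (ρ : ℝ) (j k : Fin 2) (h : ℝ) : ℝ :=
  driverCorr ρ j k * incrInner M H σ j k h

lemma IsFBM2.covariance_cfgn (hZ : IsFBM2 M H σ ρ Z P) (hρ : |ρ| ≤ 1) (lam0 : ℝ) (m n : ℕ) :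
    cov[cfgn lam0 Z m, cfgn lam0 Z n; P] =
      Real.cos (lam0 * m) * Real.cos (lam0 * n) * fgnCrossCov M H σ ρ 0 0 ((m : ℝ) - n) +
      Real.cos (lam0 * m) * Real.sin (lam0 * n) * fgnCrossCov M H σ ρ 0 1 ((m : ℝ) - n) +
      Real.sin (lam0 * m) * Real.cos (lam0 * n) * fgnCrossCov M H σ ρ 1 0 ((m : ℝ) - n) +
      Real.sin (lam0 * m) * Real.sin (lam0 * n) * fgnCrossCov M H σ ρ 1 1 ((m : ℝ) - n) := by
  have hc : ∀ (j : Fin 2) (n : ℕ) (c : ℝ), MemLp (fun ω => c * fgn Z j n ω) 2 P :=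
    fun j n c => (hZ.memLp_fgn j n).const_mul c
  have e : ∀ n : ℕ, cfgn lam0 Z n = (fun ω => Real.cos (lam0 * n) * fgn Z 0 n ω) +
      fun ω => Real.sin (lam0 * n) * fgn Z 1 n ω := fun _ => rfl
  rw [e, e, covariance_add_left (hc _ _ _) (hc _ _ _) ((hc _ _ _).add (hc _ _ _)),
    covariance_add_right (hc _ _ _) (hc _ _ _) (hc _ _ _),
    covariance_add_right (hc _ _ _) (hc _ _ _) (hc _ _ _)]
  simp only [covariance_const_mul_left, covariance_const_mul_right, hZ.covariance_fgn hρ,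
    fgnCrossCov]
  ring

end Cov

/-! ### Cyclic autocorrelation functions -/

lemma hasSum_triple_iff {a b c : ℝ} (hab : a ≠ b) (hac : a ≠ c) (hbc : b ≠ c) (f : ℝ → ℂ) (z : ℂ) :
    HasSum (fun α : ({a, b, c} : Set ℝ) => f α) z ↔ f a + (f b + f c) = z := by
  have h := Finset.hasSum ({a, b, c} : Finset ℝ) f
  rw [Finset.sum_insert (by simp [hab, hac]), Finset.sum_insert (by simp [hbc]),
    Finset.sum_singleton] at h
  have e : ((({a, b, c} : Finset ℝ) : Set ℝ)) = {a, b, c} := by simp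
  rw [e] at h
  exact ⟨fun h' => h.unique h', fun h' => h' ▸ h⟩

/-- Three distinct exponentials `1, z, z⁻¹` are linearly independent on three consecutive
integers. -/
lemma eq_zero_of_three_terms {a b c E z : ℂ} (hE : E ≠ 0) (hz : z ≠ 0) (hz1 : z ≠ 1)
    (hz2 : z ^ 2 ≠ 1) (h0 : a + b * E + c * E⁻¹ = 0)
    (h1 : a + b * (E * z) + c * (E * z)⁻¹ = 0)
    (h2 : a + b * (E * z ^ 2) + c * (E * z ^ 2)⁻¹ = 0) : b = 0 := by
  have k1 : b * E * (z - 1) + c * E⁻¹ * (z⁻¹ - 1) = 0 := by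
    rw [mul_inv] at h1
    linear_combination h1 - h0
  have k2 : b * E * (z - 1) * z + c * E⁻¹ * (z⁻¹ - 1) * z⁻¹ = 0 := by
    rw [mul_inv] at h1 h2
    rw [← inv_pow] at h2
    linear_combination h2 - h1
  have k3 : b * E * (z - 1) * (z - z⁻¹) = 0 := by
    linear_combination k2 - z⁻¹ * k1
  have hzz : z - z⁻¹ ≠ 0 := by
    intro h
    apply hz2
    have : z * z⁻¹ = 1 := mul_inv_cancel₀ hz
    linear_combination z * h + this
  simpa [hE, sub_ne_zero.2 hz1, hzz] using k3

section Caf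

variable (M : Model) (H σ : Fin 2 → ℝ) (ρ lam0 : ℝ)

/-- The cyclic autocorrelation function of cyclic fractional Gaussian noise at the cyclic
frequency `2λ₀` for `ε = 1`, and at `-2λ₀` for `ε = -1`. -/
def cfgnCaf (ε : ℝ) (h : ℤ) : ℂ :=
  1 / 4 * Complex.exp (Complex.I * (ε * lam0 * h)) *
    (fgnCrossCov M H σ ρ 0 0 h - fgnCrossCov M H σ ρ 1 1 h -
      ε * Complex.I * (fgnCrossCov M H σ ρ 0 1 h + fgnCrossCov M H σ ρ 1 0 h))

/-- The cyclic autocorrelation function of cyclic fractional Gaussian noise at frequency `0`. -/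
def cfgnCafZero (h : ℤ) : ℂ :=
  1 / 2 * (Complex.cos (lam0 * h) * (fgnCrossCov M H σ ρ 0 0 h + fgnCrossCov M H σ ρ 1 1 h) +
    Complex.sin (lam0 * h) * (fgnCrossCov M H σ ρ 1 0 h - fgnCrossCov M H σ ρ 0 1 h))

variable {M H σ ρ}

/-- Product-to-sum formulas, with `e^{iλ₀h} e^{2iλ₀n} = e^{iλ₀(m+n)}` for `h = m - n`. -/
lemma IsFBM2.covariance_expansion {Ω : Type*} [MeasurableSpace Ω] {P : Measure Ω}
    [IsProbabilityMeasure P] {Z : Fin 2 → ℝ → Ω → ℝ} (hZ : IsFBM2 M H σ ρ Z P) (hρ : |ρ| ≤ 1)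
    (m n : ℕ) :
    cfgnCafZero M H σ ρ lam0 ((m : ℤ) - n) +
      (cfgnCaf M H σ ρ lam0 1 ((m : ℤ) - n) *
          Complex.exp (Complex.I * ((2 * lam0 : ℝ) : ℂ) * n) +
        cfgnCaf M H σ ρ lam0 (-1) ((m : ℤ) - n) *
          Complex.exp (Complex.I * ((-(2 * lam0) : ℝ) : ℂ) * n)) =
      ((cov[cfgn lam0 Z m, cfgn lam0 Z n; P] : ℝ) : ℂ) := by
  rw [hZ.covariance_cfgn hρ, cfgnCafZero, cfgnCaf, cfgnCaf]
  push_cast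
  -- From here on the covariances are mere symbols and only a trigonometric identity is left.
  generalize (fgnCrossCov M H σ ρ 0 0 ((m : ℝ) - n) : ℂ) = g00
  generalize (fgnCrossCov M H σ ρ 0 1 ((m : ℝ) - n) : ℂ) = g01
  generalize (fgnCrossCov M H σ ρ 1 0 ((m : ℝ) - n) : ℂ) = g10
  generalize (fgnCrossCov M H σ ρ 1 1 ((m : ℝ) - n) : ℂ) = g11
  have e1 : Complex.exp (Complex.I * (1 * lam0 * ((m : ℂ) - n))) *
      Complex.exp (Complex.I * (2 * lam0) * n) =
      Complex.cos (lam0 * m + lam0 * n) + Complex.sin (lam0 * m + lam0 * n) * Complex.I := by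
    rw [← Complex.exp_add, ← Complex.exp_mul_I]
    congr 1
    ring
  have e2 : Complex.exp (Complex.I * (-1 * lam0 * ((m : ℂ) - n))) *
      Complex.exp (Complex.I * (-(2 * lam0)) * n) =
      Complex.cos (lam0 * m + lam0 * n) - Complex.sin (lam0 * m + lam0 * n) * Complex.I := by
    have h := Complex.exp_mul_I (-(lam0 * m + lam0 * n : ℂ))
    rw [Complex.cos_neg, Complex.sin_neg, neg_mul (Complex.sin _), ← sub_eq_add_neg] at h
    rw [← Complex.exp_add, ← h]
    congr 1
    ring
  have e3 : (lam0 : ℂ) * ((m : ℂ) - n) = lam0 * m - lam0 * n := by ring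
  rw [Complex.cos_add, Complex.sin_add] at e1 e2
  rw [e3, Complex.cos_sub, Complex.sin_sub]
  linear_combination (1 / 4 * (g00 - g11 - Complex.I * (g01 + g10))) * e1 +
    (1 / 4 * (g00 - g11 + Complex.I * (g01 + g10))) * e2 -
    1 / 2 * (g01 + g10) * (Complex.sin (lam0 * m) * Complex.cos (lam0 * n) +
      Complex.cos (lam0 * m) * Complex.sin (lam0 * n)) * Complex.I_sq

/-- The cyclic spectrum is the Fourier series of the cyclic autocorrelation function. -/
theorem hasCyclicSpectrum_cfgnCaf (hH : ∀ j, H j ∈ Set.Ioo (0 : ℝ) 1)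
    (hmem : ∀ j, ∀ t : ℝ, 0 ≤ t → MemLp (fbmKernel M (H j) (σ j) t) 2 volume) {lam : ℝ}
    (hlam : ∀ k : ℤ, lam - lam0 ≠ 2 * Real.pi * k) :
    HasCyclicSpectrum (cfgnCaf M H σ ρ lam0 1) lam (cfgnSpectrum M H σ ρ lam0 lam) := by
  have hsum : ∀ j k, HasSum (fun h : ℤ => (fgnCov (H j + H k) h : ℂ) *
      Complex.exp (-Complex.I * ((lam - lam0 : ℝ) : ℂ) * h)) _ (SummationFilter.symmetricIcc ℤ) :=
    fun j k => hasSum_fgnCov (s := H j + H k) (μ := lam - lam0)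
      (by linarith [(hH j).1, (hH k).1]) (by linarith [(hH j).2, (hH k).2]) hlam
  set V : Fin 2 → Fin 2 → ℝ := fun j k =>
    ∫ x, fbmKernel M (H j) (σ j) 1 x * fbmKernel M (H k) (σ k) 1 x with hV
  have hV2 : ∀ j k, 2 * Real.pi * (cTilde M H σ ρ j k).re = driverCorr ρ j k * V j k *
      (Real.Gamma (H j + H k + 1) * Real.sin (Real.pi * (H j + H k) / 2)) :=
    re_cTilde M σ ρ hH
  have hself : ∀ (j : Fin 2) (h : ℤ), fgnCrossCov M H σ ρ j j h =
      V j j * fgnCov (H j + H j) h := by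
    intro j h
    have := incrInner_add hH hmem j j h
    simp only [fgnCrossCov, driverCorr, if_true, one_mul, hV]
    linarith
  -- Only the sum of the two cross-covariances is explicit here, and only this sum enters the
  -- function at `2λ₀`.
  have hcross : ∀ h : ℤ, fgnCrossCov M H σ ρ 0 1 h + fgnCrossCov M H σ ρ 1 0 h =
      2 * (ρ * V 0 1 * fgnCov (H 0 + H 1) h) := by
    intro h
    have := incrInner_add hH hmem 0 1 h
    simp only [fgnCrossCov, driverCorr, zero_ne_one, one_ne_zero, if_false, hV]
    linear_combination ρ * this
  have hd : driverCorr ρ 0 1 = ρ := by simp [driverCorr]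
  have hd' : ∀ j, driverCorr ρ j j = 1 := by simp [driverCorr]
  have h := ((((hsum 0 0).mul_left (V 0 0 : ℂ)).sub ((hsum 1 1).mul_left (V 1 1 : ℂ))).sub
    (((hsum 0 1).mul_left (ρ * V 0 1 : ℂ)).mul_left (2 * Complex.I))).mul_left
    ((2 * (Real.pi : ℂ))⁻¹ * (1 / 4))
  rw [HasCyclicSpectrum]
  convert h using 1
  · rfl
  · funext h
    have hc := congrArg (fun r : ℝ => (r : ℂ)) (hcross h)
    push_cast at hc
    rw [cfgnCaf, Complex.ofReal_one, one_mul, one_mul, hc, hself, hself]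
    -- The modulation `e^{iλ₀h}` moves the spectrum from `λ` to `λ - λ₀`.
    have e : Complex.exp (-Complex.I * ((lam - lam0 : ℝ) : ℂ) * h) =
        Complex.exp (Complex.I * (lam0 * h)) * Complex.exp (-Complex.I * lam * h) := by
      rw [← Complex.exp_add]
      congr 1
      push_cast
      ring
    rw [e]
    push_cast
    ring
  · rw [cfgnSpectrum_eq M σ ρ hH hlam]
    have hπ : (2 * (Real.pi : ℂ))⁻¹ * (2 * Real.pi) = 1 :=
      inv_mul_cancel₀ (by simp [Real.pi_ne_zero])
    have q : ∀ j k, (((driverCorr ρ j k * V j k : ℝ) : ℂ)) *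
        ((Real.Gamma (H j + H k + 1) * Real.sin (Real.pi * (H j + H k) / 2) *
          fgnDensity (H j + H k) (lam - lam0) : ℝ) : ℂ) =
        2 * Real.pi * (((cTilde M H σ ρ j k).re : ℂ) *
          (fgnDensity (H j + H k) (lam - lam0) : ℂ)) := by
      intro j k
      have := congrArg (fun r : ℝ => (r : ℂ))
        (congrArg (· * fgnDensity (H j + H k) (lam - lam0)) (hV2 j k))
      rw [← Complex.ofReal_mul, ← mul_assoc, ← this]
      push_cast
      ring
    have q0 := q 0 0
    have q1 := q 1 1
    have q2 := q 0 1
    rw [hd', one_mul] at q0 q1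
    rw [hd, Complex.ofReal_mul] at q2
    rw [q0, q1, q2]
    linear_combination (-(1 / 4) * (((cTilde M H σ ρ 0 0).re : ℂ) *
      (fgnDensity (H 0 + H 0) (lam - lam0) : ℂ) - ((cTilde M H σ ρ 1 1).re : ℂ) *
      (fgnDensity (H 1 + H 1) (lam - lam0) : ℂ) - 2 * Complex.I * (((cTilde M H σ ρ 0 1).re : ℂ) *
          (fgnDensity (H 0 + H 1) (lam - lam0) : ℂ)))) * hπ

end Caf

/-! ### Distinct frequencies and uniqueness of the cyclic autocorrelation functions. -/

lemma exp_ne_one_of_not_mem {lam0 : ℝ} (hlam : ∀ k : ℤ, lam0 ≠ k * (Real.pi / 2)) :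
    Complex.exp (Complex.I * ((2 * lam0 : ℝ) : ℂ)) ^ 2 ≠ 1 := by
  rw [← Complex.exp_nat_mul]
  intro h
  rw [Complex.exp_eq_one_iff] at h
  obtain ⟨k, hk⟩ := h
  apply hlam k
  have : ((4 * lam0 : ℝ) : ℂ) = ((k * (2 * Real.pi) : ℝ) : ℂ) := by
    apply mul_left_cancel₀ Complex.I_ne_zero
    push_cast at hk ⊢
    linear_combination hk
  rw [Complex.ofReal_inj] at this
  linarith

lemma frequencies_distinct {lam0 : ℝ} (hlam : ∀ k : ℤ, lam0 ≠ k * (Real.pi / 2)) :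
    ∀ α ∈ ({0, 2 * lam0, -(2 * lam0)} : Set ℝ), ∀ β ∈ ({0, 2 * lam0, -(2 * lam0)} : Set ℝ),
      (∃ k : ℤ, α - β = 2 * Real.pi * k) → α = β := by
  rintro α hα β hβ ⟨k, hk⟩
  simp only [Set.mem_insert_iff, Set.mem_singleton_iff] at hα hβ
  have h1 := hlam (2 * k)
  have h2 := hlam (-(2 * k))
  have h3 := hlam k
  have h4 := hlam (-k)
  push_cast at h1 h2 h4
  rcases hα with rfl | rfl | rfl <;> rcases hβ with rfl | rfl | rfl
  · rfl
  · exact (h2 (by linarith)).elim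
  · exact (h1 (by linarith)).elim
  · exact (h1 (by linarith)).elim
  · rfl
  · exact (h3 (by linarith)).elim
  · exact (h2 (by linarith)).elim
  · exact (h4 (by linarith)).elim
  · rfl

section Uniqueness

variable {Ω : Type*} [MeasurableSpace Ω] {P : Measure Ω} {lam0 : ℝ}

lemma hasSum_frequencies_iff (hlam : ∀ k : ℤ, lam0 ≠ k * (Real.pi / 2)) (f : ℝ → ℂ) (z : ℂ) :
    HasSum (fun α : ({0, 2 * lam0, -(2 * lam0)} : Set ℝ) => f α) z ↔
      f 0 + (f (2 * lam0) + f (-(2 * lam0))) = z := by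
  have h0 : lam0 ≠ 0 := by simpa using hlam 0
  refine hasSum_triple_iff ?_ ?_ ?_ f z
  · exact fun h => h0 (by linarith)
  · exact fun h => h0 (by linarith)
  · exact fun h => h0 (by linarith)

/-- The cyclic autocorrelation function at `2λ₀` is determined by the autocovariance. -/
lemma HasCAF.eq_of_hasCAF {Y : ℕ → Ω → ℝ} (hlam : ∀ k : ℤ, lam0 ≠ k * (Real.pi / 2))
    {R R' : ℝ → ℤ → ℂ} (hR : HasCAF Y P {0, 2 * lam0, -(2 * lam0)} R)
    (hR' : HasCAF Y P {0, 2 * lam0, -(2 * lam0)} R') : R (2 * lam0) = R' (2 * lam0) := by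
  funext h
  set z := Complex.exp (Complex.I * ((2 * lam0 : ℝ) : ℂ)) with hz
  have hz2 : z ^ 2 ≠ 1 := exp_ne_one_of_not_mem hlam
  have hz1 : z ≠ 1 := fun h => hz2 (by rw [h, one_pow])
  have hz0 : z ≠ 0 := Complex.exp_ne_zero _
  -- Positive and negative parts of `h` give natural times with lag `h`; the pairs `(m + i, n + i)`
  -- for `i = 0, 1, 2` keep that lag and supply the three equations.
  set m := h.toNat with hm
  set n := (-h).toNat with hn
  have hmn : (m : ℤ) - n = h := by omega
  have key : ∀ i : ℕ, (R 0 h - R' 0 h) + (R (2 * lam0) h - R' (2 * lam0) h) * (z ^ n * z ^ i) +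
      (R (-(2 * lam0)) h - R' (-(2 * lam0)) h) * (z ^ n * z ^ i)⁻¹ = 0 := by
    intro i
    have e := (hasSum_frequencies_iff hlam (fun α => R α (((m + i : ℕ) : ℤ) - (n + i : ℕ)) *
      Complex.exp (Complex.I * (α : ℂ) * (n + i : ℕ))) _).1 (hR.expansion (m + i) (n + i))
    have e' := (hasSum_frequencies_iff hlam (fun α => R' α (((m + i : ℕ) : ℤ) - (n + i : ℕ)) *
      Complex.exp (Complex.I * (α : ℂ) * (n + i : ℕ))) _).1 (hR'.expansion (m + i) (n + i))
    have hmni : ((m + i : ℕ) : ℤ) - (n + i : ℕ) = h := by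
      push_cast
      linarith
    have hexp : Complex.exp (Complex.I * ((2 * lam0 : ℝ) : ℂ) * (n + i : ℕ)) = z ^ n * z ^ i := by
      rw [← pow_add, hz, ← Complex.exp_nat_mul, mul_comm]
    have hexp' : Complex.exp (Complex.I * ((-(2 * lam0) : ℝ) : ℂ) * (n + i : ℕ)) =
        (z ^ n * z ^ i)⁻¹ := by
      rw [← hexp, ← Complex.exp_neg]
      congr 1
      push_cast
      ring
    have hexp0 : Complex.exp (Complex.I * ((0 : ℝ) : ℂ) * (n + i : ℕ)) = 1 := by simp
    simp only [hmni, hexp, hexp', hexp0] at e e'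
    linear_combination e - e'
  refine sub_eq_zero.1 (eq_zero_of_three_terms (pow_ne_zero n hz0) hz0 hz1 hz2
    (a := R 0 h - R' 0 h) (c := R (-(2 * lam0)) h - R' (-(2 * lam0)) h) ?_ ?_ ?_)
  · simpa using key 0
  · simpa using key 1
  · simpa using key 2

lemma IsFBM2.exists_hasCAF [IsProbabilityMeasure P] {M : Model} {H σ : Fin 2 → ℝ} {ρ : ℝ}
    {Z : Fin 2 → ℝ → Ω → ℝ} (hZ : IsFBM2 M H σ ρ Z P) (hρ : |ρ| ≤ 1)
    (hlam : ∀ k : ℤ, lam0 ≠ k * (Real.pi / 2)) :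
    ∃ R : ℝ → ℤ → ℂ, HasCAF (cfgn lam0 Z) P {0, 2 * lam0, -(2 * lam0)} R ∧
      R (2 * lam0) = cfgnCaf M H σ ρ lam0 1 := by
  have h0 : lam0 ≠ 0 := by simpa using hlam 0
  have h1 : 2 * lam0 ≠ 0 := by simpa using h0
  have h2 : -(2 * lam0) ≠ 0 := neg_ne_zero.2 h1
  have h3 : -(2 * lam0) ≠ 2 * lam0 := fun h => h0 (by linarith)
  refine ⟨fun α => if α = 0 then cfgnCafZero M H σ ρ lam0 else
    if α = 2 * lam0 then cfgnCaf M H σ ρ lam0 1 else cfgnCaf M H σ ρ lam0 (-1),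
    ⟨frequencies_distinct hlam, fun m n => ?_⟩, by simp only [if_neg h1, if_true]⟩
  refine (hasSum_frequencies_iff hlam (fun α => (if α = 0 then cfgnCafZero M H σ ρ lam0 else
    if α = 2 * lam0 then cfgnCaf M H σ ρ lam0 1 else cfgnCaf M H σ ρ lam0 (-1)) ((m : ℤ) - n) *
      Complex.exp (Complex.I * (α : ℂ) * n)) _).2 ?_
  simp only [if_true, if_neg h1, if_neg h2, if_neg h3, Complex.ofReal_zero, mul_zero, zero_mul,
    Complex.exp_zero, mul_one]
  exact hZ.covariance_expansion lam0 hρ m n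

end Uniqueness

end CFGN

end

/-! ### Assembly of the two statements. -/

theorem proposition5 {Ω : Type*} [MeasurableSpace Ω] (P : Measure Ω) [IsProbabilityMeasure P]
    (M : CFGN.Model) (H σ : Fin 2 → ℝ) (ρ lam0 : ℝ)
    (hH : ∀ j, H j ∈ Set.Ioo (0 : ℝ) 1) (hσ : ∀ j, 0 < σ j) (hρ : |ρ| ≤ 1)
    (hM : M = CFGN.Model.wellBalanced → ∀ j, H j ≠ 1 / 2)
    (Z : Fin 2 → ℝ → Ω → ℝ) (hZ : CFGN.IsFBM2 M H σ ρ Z P) :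
    Asymptotics.IsEquivalent (𝓝[≠] lam0)
      (fun lam : ℝ => CFGN.cfgnSpectrum M H σ ρ lam0 lam)
      (fun lam : ℝ => CFGN.coeffK M H σ ρ *
        ((|lam - lam0| ^ (-2 * max (CFGN.memD H 0) (CFGN.memD H 1)) : ℝ) : ℂ)) ∧
    ((∀ k : ℤ, lam0 ≠ k * (Real.pi / 2)) →
      (∃ R : ℝ → ℤ → ℂ,
        CFGN.HasCAF (CFGN.cfgn lam0 Z) P {0, 2 * lam0, -(2 * lam0)} R) ∧
      ∀ R : ℝ → ℤ → ℂ,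
        CFGN.HasCAF (CFGN.cfgn lam0 Z) P {0, 2 * lam0, -(2 * lam0)} R →
        ∀ lam : ℝ, (∀ k : ℤ, lam - lam0 ≠ 2 * Real.pi * k) →
          CFGN.HasCyclicSpectrum (R (2 * lam0)) lam
            (CFGN.cfgnSpectrum M H σ ρ lam0 lam)) := by
  refine ⟨CFGN.isEquivalent_cfgnSpectrum M ρ lam0 hH hσ hM, fun hlam => ?_⟩
  obtain ⟨R', hR', hval⟩ := hZ.exists_hasCAF hρ hlam
  refine ⟨⟨R', hR'⟩, fun R hR lam hl => ?_⟩
  -- Uniqueness replaces an arbitrary expansion by the explicit one.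
  rw [hR.eq_of_hasCAF hlam hR', hval]
  exact CFGN.hasCyclicSpectrum_cfgnCaf lam0 hH (fun j t ht => hZ.memLp_kernel j ht) hl
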